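/- Let $K$ be a number field with ring of integers $\mathcal O_K$. **Lattices.** An $\mathcal O_K$-lattice $L$ in a finite-dimensional $K$-vector space $E$ is a finitely generated (hence projective) $\mathcal O_K$-submodule $L\subset E$ containing a $K$-basis of $E$, together with a positive definite Hermitian form $h_v$ on the complex vector space $E_v=E\otimes_{K,v}\mathbb C$ for every infinite place $v$ of $K$. Its automorphism group $\operatorname{Aut} L$ consists of the $K$-linear automorphisms $g$ of $E=KL$ with $g(L)=L$ that preserve all the forms $h_v$. The tensor product of lattices $L\subset E$ and $M\subset F$ is the $\mathcal O_K$-lattice $L\otimes M=L\otimes_{\mathcal O_K}M\subset E\otimes_K F$ with the Hermitian forms determined by $h_v(x\otimes y,x'\otimes y')=h_v(x,x')\,h_v(y,y')$. **Slopes.** A sublattice of $L$ is an $\mathcal O_K$-submodule $N\subset L$ with $L/N$ torsion-free, endowed with the restricted forms. If $N=\sum_{i=1}^{n}\mathfrak a_i b_i$ with nonzero fractional ideals $\mathfrak a_i$ and $K$-linearly independent vectors $b_1,\dots,b_n$, put $$\operatorname{vol}(N)=\mathrm N\Big(\prod_{i=1}^n\mathfrak a_i\Big)\prod_{v\mid\infty}\det\big(h_v(b_i,b_j)\big)^{e_v/2},\qquad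 e_v=\begin{cases}1&v\text{ real}\\2&v\text{ complex}\end{cases}$$ and, for $N\neq 0$, $\mu(N)=\operatorname{vol}(N)^{1/n}$; these do not depend on the choice of the $\mathfrak a_i,b_i$. The minimal slope of a nonzero lattice $L$ is $\mu_{\min}(L)=\min\{\mu(N): 0\ne N\subset L\text{ a sublattice}\}$. **Multiplicity-free modules.** For a group $G$, a $K[G]$-module $E$ is multiplicity-free with $r$ irreducible components if $E=\bigoplus_{i=1}^r E_i$ with pairwise non-isomorphic absolutely irreducible $K[G]$-submodules $E_i$ (absolutely irreducible: $E_i\otimes_K\overline K$ is an irreducible $\overline K[G]$-module). **Theorem.** Let $K$ be either a totally real or a CM number field, let $L$ and $M$ be nonzero $\mathcal O_K$-lattices, in $E=KL$ and $F=KM$ respectively, and let $G\le\operatorname{Aut}L$ and $H\le\operatorname{Aut}M$ be subgroups. Assume that $E$ is multiplicity-free as a $K[G]$-module, with $r$ irreducible components, and that $F$ is multiplicity-free as a $K[H]$-module, with $s$ irreducible components. If $\min(r,s)\le 2$, then the minima defining $\mu_{\min}(L)$, $\mu_{\min}(M)$ and $\mu_{\min}(L\otimes M)$ are attained and $$\mu_{\min}(L\otimes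 M)=\mu_{\min}(L)\,\mu_{\min}(M).$$ -/

import Mathlib

open scoped TensorProduct nonZeroDivisors
open NumberField

noncomputable section

/-! ### Complexification at an infinite place -/

/-- The field of complex numbers, regarded as a `K`-algebra through the embedding `K → ℂ` attached
to the infinite place `v`. -/
def CAt {K : Type*} [Field K] (_v : InfinitePlace K) : Type := ℂ

set_option synthInstance.checkSynthOrder false in
instance (priority := low) {K : Type*} {_ : Field K} (v : InfinitePlace K) : RCLike (CAt v) :=
  inferInstanceAs (RCLike ℂ)

instance {K : Type*} [Field K] (v : InfinitePlace K) : Algebra K (CAt v) :=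
  (show K →+* CAt v from v.embedding).toAlgebra

/-- A family `(h_v)` of positive definite Hermitian forms on the complex vector spaces
`E_v = ℂ ⊗_K E`, one for each infinite place `v` of `K`. -/
abbrev HermitianFamily (K E : Type*) [Field K] [AddCommGroup E] [Module K E] :=
  ∀ v : InfinitePlace K, InnerProductSpace.Core (CAt v) (CAt v ⊗[K] E)

section Tensor

variable {K E F : Type*} [Field K] [AddCommGroup E] [Module K E] [AddCommGroup F] [Module K F]

/-- The Hermitian form on `(E ⊗ F)_v`, which is `E_v ⊗ F_v`, determined by
`⟪x ⊗ y, x' ⊗ y'⟫ = ⟪x, x'⟫ ⟪y, y'⟫`. -/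
@[reducible] def tensorCore (v : InfinitePlace K)
    (h : InnerProductSpace.Core (CAt v) (CAt v ⊗[K] E))
    (h' : InnerProductSpace.Core (CAt v) (CAt v ⊗[K] F)) :
    InnerProductSpace.Core (CAt v) (CAt v ⊗[K] (E ⊗[K] F)) :=
  letI : NormedAddCommGroup (CAt v ⊗[K] E) := h.toNormedAddCommGroup
  letI : InnerProductSpace (CAt v) (CAt v ⊗[K] E) := InnerProductSpace.ofCore h.toCore
  letI : NormedAddCommGroup (CAt v ⊗[K] F) := h'.toNormedAddCommGroup
  letI : InnerProductSpace (CAt v) (CAt v ⊗[K] F) := InnerProductSpace.ofCore h'.toCore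
  let e := TensorProduct.AlgebraTensorModule.distribBaseChange K (CAt v) E F
  { inner := fun x y => inner (CAt v) (e x) (e y)
    conj_inner_symm := fun x y => inner_conj_symm (e x) (e y)
    re_inner_nonneg := fun x => inner_self_nonneg (x := e x)
    add_left := fun x y z => by rw [map_add, inner_add_left]
    smul_left := fun x y r => by rw [map_smul]; exact inner_smul_left (e x) (e y) r
    definite := fun x hx => e.map_eq_zero_iff.mp (inner_self_eq_zero.mp hx) }

theorem tensorCore_inner (v : InfinitePlace K)
    (h : InnerProductSpace.Core (CAt v) (CAt v ⊗[K] E))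
    (h' : InnerProductSpace.Core (CAt v) (CAt v ⊗[K] F)) (a a' : CAt v) (x x' : E) (y y' : F) :
    (tensorCore v h h').inner (a ⊗ₜ (x ⊗ₜ y)) (a' ⊗ₜ (x' ⊗ₜ y')) =
      h.inner (a ⊗ₜ x) (a' ⊗ₜ x') * h'.inner (1 ⊗ₜ y) (1 ⊗ₜ y') :=
  rfl

end Tensor

/-! ### Lattices -/

/-- An `𝓞 K`-lattice in the `K`-vector space `E`: a finitely generated `𝓞 K`-submodule containing
a `K`-basis of `E` (such a module is torsion-free over a Dedekind domain, so it is automatically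
projective), together with Hermitian forms at all the infinite places. -/
structure OKLattice (K E : Type*) [Field K] [AddCommGroup E] [Module K E]
    [Module (𝓞 K) E] [IsScalarTower (𝓞 K) K E] where
  carrier : Submodule (𝓞 K) E
  fg : carrier.FG
  span_eq_top : Submodule.span K (carrier : Set E) = ⊤
  herm : HermitianFamily K E

section PseudoBasis

variable {K E : Type*} [Field K] [NumberField K] [AddCommGroup E] [Module K E]
  [Module (𝓞 K) E] [IsScalarTower (𝓞 K) K E]

/-- The submodule `𝔞 b` of `E`, for a fractional ideal `𝔞` of `K` and a vector `b`. -/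
def idealSMul (𝔞 : FractionalIdeal (𝓞 K)⁰ K) (b : E) : Submodule (𝓞 K) E :=
  (𝔞 : Submodule (𝓞 K) K).map ((LinearMap.toSpanSingleton K E b).restrictScalars (𝓞 K))

/-- A pseudo-basis `(𝔞_i, b_i)` of an `𝓞 K`-submodule `N` of `E`: nonzero fractional ideals `𝔞_i`
and `K`-linearly independent vectors `b_i` with `N = ∑ 𝔞_i b_i`. -/
structure PseudoBasis (N : Submodule (𝓞 K) E) where
  rk : ℕ
  ideal : Fin rk → FractionalIdeal (𝓞 K)⁰ K
  vec : Fin rk → E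
  ideal_ne_zero : ∀ i, ideal i ≠ 0
  linearIndependent : LinearIndependent K vec
  eq_iSup : N = ⨆ i, idealSMul (ideal i) (vec i)

/-- The volume computed with a pseudo-basis:
`Norm(∏ 𝔞_i) ∏_v det(h_v(b_i, b_j))^(e_v / 2)`, with `e_v = 1` or `2` according to whether `v` is
real or complex. -/
def PseudoBasis.vol {N : Submodule (𝓞 K) E} (P : PseudoBasis N) (h : HermitianFamily K E) : ℝ :=
  (FractionalIdeal.absNorm (∏ i, P.ideal i) : ℝ) *
    ∏ v : InfinitePlace K,
      (RCLike.re (Matrix.det (Matrix.of fun i j =>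
        (h v).inner (1 ⊗ₜ[K] P.vec i) (1 ⊗ₜ[K] P.vec j)))) ^ ((v.mult : ℝ) / 2)

theorem mem_idealSMul {𝔞 : FractionalIdeal (𝓞 K)⁰ K} {b x : E} :
    x ∈ idealSMul 𝔞 b ↔ ∃ a ∈ 𝔞, a • b = x := by
  simp [idealSMul, Submodule.mem_map]

/-- One step of the construction of a pseudo-basis. -/
theorem exists_split (N : Submodule (𝓞 K) E) (hN : N.FG) (f : E →ₗ[K] K)
    (hf : ∃ x ∈ N, f x ≠ 0) :
    ∃ (𝔞 : FractionalIdeal (𝓞 K)⁰ K) (b : E), 𝔞 ≠ 0 ∧ f b = 1 ∧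
      N = (N ⊓ (LinearMap.ker f).restrictScalars (𝓞 K)) ⊔ idealSMul 𝔞 b := by
  have hfg : (N.map (f.restrictScalars (𝓞 K))).FG := hN.map _
  let 𝔞 : FractionalIdeal (𝓞 K)⁰ K :=
    ⟨N.map (f.restrictScalars (𝓞 K)), FractionalIdeal.isFractional_of_fg hfg⟩
  have hmem : ∀ y, y ∈ 𝔞 ↔ ∃ x ∈ N, f x = y := fun y => by
    change y ∈ N.map (f.restrictScalars (𝓞 K)) ↔ _
    simp [Submodule.mem_map]
  have h0 : 𝔞 ≠ 0 := by
    obtain ⟨x, hx, hfx⟩ := hf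
    intro h
    have h1 : f x ∈ 𝔞 := (hmem _).2 ⟨x, hx, rfl⟩
    rw [h, FractionalIdeal.mem_zero_iff] at h1
    exact hfx h1
  have hinv : 𝔞 * 𝔞⁻¹ = 1 := mul_inv_cancel₀ h0
  have key : ∀ z ∈ 𝔞 * 𝔞⁻¹, ∃ b : E, f b = z ∧ ∀ a ∈ 𝔞, a • b ∈ N := by
    intro z hz
    refine FractionalIdeal.mul_induction_on hz ?_ ?_
    · intro i hi j hj
      obtain ⟨x, hx, rfl⟩ := (hmem i).1 hi
      refine ⟨j • x, by simp [mul_comm], fun a ha => ?_⟩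
      have h1 : a * j ∈ 𝔞 * 𝔞⁻¹ := FractionalIdeal.mul_mem_mul ha hj
      rw [hinv, FractionalIdeal.mem_one_iff] at h1
      obtain ⟨c, hc⟩ := h1
      rw [smul_smul, ← hc, algebraMap_smul]
      exact N.smul_mem c hx
    · intro x y hx hy
      obtain ⟨b, hb, hb'⟩ := hx
      obtain ⟨c, hc, hc'⟩ := hy
      exact ⟨b + c, by simp [hb, hc], fun a ha => by
        rw [smul_add]; exact N.add_mem (hb' a ha) (hc' a ha)⟩
  obtain ⟨b, hb, hbN⟩ := key 1 (by rw [hinv]; exact FractionalIdeal.one_mem_one _)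
  refine ⟨𝔞, b, h0, hb, le_antisymm ?_ ?_⟩
  · intro x hx
    have hfx : f x ∈ 𝔞 := (hmem _).2 ⟨x, hx, rfl⟩
    refine Submodule.mem_sup.2 ⟨x - f x • b, ⟨N.sub_mem hx (hbN _ hfx), ?_⟩, f x • b,
      mem_idealSMul.2 ⟨_, hfx, rfl⟩, by abel⟩
    simp [hb]
  · refine sup_le inf_le_left ?_
    intro x hx
    obtain ⟨a, ha, rfl⟩ := mem_idealSMul.1 hx
    exact hbN a ha

/-- Every finitely generated `𝓞 K`-submodule of `E` has a pseudo-basis. -/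
theorem PseudoBasis.nonempty (N : Submodule (𝓞 K) E) (hN : N.FG) : Nonempty (PseudoBasis N) := by
  obtain ⟨d, hd⟩ : ∃ d, Module.finrank K (Submodule.span K (N : Set E)) = d := ⟨_, rfl⟩
  induction d using Nat.strong_induction_on generalizing N with
  | _ d ih =>
    by_cases h0 : N = ⊥
    · exact ⟨⟨0, Fin.elim0, Fin.elim0, fun i => i.elim0, linearIndependent_empty_type, by
        rw [h0, iSup_of_empty]⟩⟩
    obtain ⟨x, hxN, hx0⟩ := (Submodule.ne_bot_iff N).1 h0
    obtain ⟨f, hfx⟩ : ∃ f : E →ₗ[K] K, f x ≠ 0 := by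
      by_contra hcon
      push Not at hcon
      exact hx0 ((Module.forall_dual_apply_eq_zero_iff K x).1 hcon)
    obtain ⟨𝔞, b, h𝔞, hb, hN'⟩ := exists_split N hN f ⟨x, hxN, hfx⟩
    set N' : Submodule (𝓞 K) E := N ⊓ (LinearMap.ker f).restrictScalars (𝓞 K) with hdef
    have hker : ∀ y ∈ N', f y = 0 := fun y hy => hy.2
    have hfg : N'.FG := by
      have : IsNoetherian (𝓞 K) N := isNoetherian_of_fg_of_noetherian N hN
      have : IsNoetherian (𝓞 K) N' := isNoetherian_of_le (inf_le_left : N' ≤ N)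
      exact Module.Finite.iff_fg.1 inferInstance
    have hfin : Module.Finite K (Submodule.span K (N : Set E)) := by
      obtain ⟨S, hS⟩ := hN
      rw [← hS, Submodule.span_span_of_tower]
      exact FiniteDimensional.span_finset K S
    have hlt : Submodule.span K (N' : Set E) < Submodule.span K (N : Set E) := by
      refine lt_of_le_of_ne (Submodule.span_mono fun y hy => hy.1) fun heq => hfx ?_
      have h1 : Submodule.span K (N' : Set E) ≤ LinearMap.ker f :=
        Submodule.span_le.2 fun y hy => hker y hy
      exact h1 (heq ▸ Submodule.subset_span hxN)
    obtain ⟨P⟩ := ih _ (hd ▸ Submodule.finrank_lt_finrank_of_lt hlt) N' hfg rfl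
    refine ⟨⟨P.rk + 1, Fin.cons 𝔞 P.ideal, Fin.cons b P.vec, ?_, ?_, ?_⟩⟩
    · intro i
      refine Fin.cases ?_ (fun j => ?_) i
      · simpa using h𝔞
      · simpa using P.ideal_ne_zero j
    · refine linearIndependent_finCons.2 ⟨P.linearIndependent, fun hmem => ?_⟩
      have h1 : Submodule.span K (Set.range P.vec) ≤ LinearMap.ker f := by
        refine Submodule.span_le.2 ?_
        rintro _ ⟨i, rfl⟩
        obtain ⟨a, ha, ha0⟩ : ∃ a ∈ P.ideal i, a ≠ 0 := by
          by_contra hcon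
          push Not at hcon
          exact P.ideal_ne_zero i (FractionalIdeal.eq_zero_iff.2 hcon)
        have h2 : a • P.vec i ∈ N' :=
          P.eq_iSup.ge (Submodule.mem_iSup_of_mem i (mem_idealSMul.2 ⟨a, ha, rfl⟩))
        have h3 := hker _ h2
        rw [map_smul, smul_eq_mul] at h3
        exact (mul_eq_zero.1 h3).resolve_left ha0
      have h2 : f b = 0 := h1 hmem
      rw [hb] at h2
      exact one_ne_zero h2
    · refine hN'.trans (le_antisymm (sup_le ?_ ?_) (iSup_le fun i => ?_))
      · refine P.eq_iSup.le.trans ?_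
        exact iSup_le fun i => le_iSup_of_le i.succ (by simp)
      · exact le_iSup_of_le 0 (by simp)
      · refine Fin.cases ?_ (fun j => ?_) i
        · exact le_sup_of_le_right (by simp)
        · refine le_sup_of_le_left (le_trans ?_ P.eq_iSup.ge)
          exact le_iSup_of_le j (by simp)

/-- The volume of a finitely generated `𝓞 K`-submodule `N` of `E` with respect to the forms `h`;
it does not depend on the pseudo-basis used to compute it. (The default value `0` is not used for
a finitely generated `N`, which always has a pseudo-basis.) -/
def vol (h : HermitianFamily K E) (N : Submodule (𝓞 K) E) : ℝ :=
  open Classical in if P : Nonempty (PseudoBasis N) then P.some.vol h else 0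

/-- The slope `vol(N)^(1 / rk N)`. -/
def latticeSlope (h : HermitianFamily K E) (N : Submodule (𝓞 K) E) : ℝ :=
  vol h N ^ (1 / (Module.finrank K (Submodule.span K (N : Set E)) : ℝ))

end PseudoBasis

namespace OKLattice

section

variable {K E : Type*} [Field K] [AddCommGroup E] [Module K E]
  [Module (𝓞 K) E] [IsScalarTower (𝓞 K) K E]

/-- `N` is a (primitive) sublattice of `L`: an `𝓞 K`-submodule with `L / N` torsion-free. It
carries the restrictions of the Hermitian forms of `L`. -/
def IsSublattice (L : OKLattice K E) (N : Submodule (𝓞 K) E) : Prop :=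
  N ≤ L.carrier ∧ ∀ a : 𝓞 K, a ≠ 0 → ∀ x ∈ L.carrier, a • x ∈ N → x ∈ N

/-- The set of the slopes of all the nonzero sublattices of `L`. -/
def slopes [NumberField K] (L : OKLattice K E) : Set ℝ :=
  {t | ∃ N : Submodule (𝓞 K) E, L.IsSublattice N ∧ N ≠ ⊥ ∧ t = latticeSlope L.herm N}

/-- The minimal slope of `L`. -/
def minSlope [NumberField K] (L : OKLattice K E) : ℝ := sInf L.slopes

/-- The automorphism group of `L`: the automorphisms of `E = K L` that map `L` onto itself and
preserve the Hermitian forms at all the infinite places. -/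
def aut (L : OKLattice K E) : Subgroup (E ≃ₗ[K] E) where
  carrier := {g | (∀ x, g x ∈ L.carrier ↔ x ∈ L.carrier) ∧
    ∀ (v : InfinitePlace K) (x y : CAt v ⊗[K] E),
      (L.herm v).inner ((g : E →ₗ[K] E).baseChange (CAt v) x)
        ((g : E →ₗ[K] E).baseChange (CAt v) y) = (L.herm v).inner x y}
  one_mem' := ⟨fun _ => Iff.rfl, fun v x y => by simp⟩
  mul_mem' := fun {g h} hg hh => ⟨fun x => (hg.1 (h x)).trans (hh.1 x), fun v x y => by
    have : ((g * h : E ≃ₗ[K] E) : E →ₗ[K] E) = (g : E →ₗ[K] E) ∘ₗ (h : E →ₗ[K] E) := rfl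
    simp only [this, LinearMap.baseChange_comp, LinearMap.comp_apply]
    rw [hg.2, hh.2]⟩
  inv_mem' := fun {g} hg => by
    have key : ∀ z, g (g⁻¹ z) = z := fun z => g.apply_symm_apply z
    refine ⟨fun x => ?_, fun v x y => ?_⟩
    · have := hg.1 (g⁻¹ x)
      rw [key] at this
      exact this.symm
    · have h1 : (g : E →ₗ[K] E) ∘ₗ ((g⁻¹ : E ≃ₗ[K] E) : E →ₗ[K] E) = LinearMap.id :=
        LinearMap.ext key
      have h2 : ∀ z : CAt v ⊗[K] E, (g : E →ₗ[K] E).baseChange (CAt v)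
          (((g⁻¹ : E ≃ₗ[K] E) : E →ₗ[K] E).baseChange (CAt v) z) = z := fun z => by
        rw [← LinearMap.comp_apply, ← LinearMap.baseChange_comp, h1, LinearMap.baseChange_id,
          LinearMap.id_apply]
      rw [← hg.2, h2, h2]

end

section

variable {K E F : Type*} [Field K] [AddCommGroup E] [Module K E]
  [Module (𝓞 K) E] [IsScalarTower (𝓞 K) K E] [AddCommGroup F] [Module K F]
  [Module (𝓞 K) F] [IsScalarTower (𝓞 K) K F]

/-- The tensor product `L ⊗ M` over `𝓞 K`, as the lattice in `E ⊗_K F` generated over `𝓞 K` by the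
`x ⊗ y` with `x ∈ L` and `y ∈ M`, with the tensor product Hermitian forms. -/
def tensor (L : OKLattice K E) (M : OKLattice K F) : OKLattice K (E ⊗[K] F) where
  carrier := Submodule.map₂ ((TensorProduct.mk K E F).restrictScalars₁₂ (𝓞 K) (𝓞 K))
    L.carrier M.carrier
  fg := Submodule.FG.map₂ _ L.fg M.fg
  span_eq_top := by
    have hE : ∀ (x : E), ∀ y ∈ M.carrier, x ⊗ₜ[K] y ∈ Submodule.span K
        ((Submodule.map₂ ((TensorProduct.mk K E F).restrictScalars₁₂ (𝓞 K) (𝓞 K))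
          L.carrier M.carrier : Submodule (𝓞 K) (E ⊗[K] F)) : Set (E ⊗[K] F)) := by
      intro x y hy
      have hx : x ∈ Submodule.span K (L.carrier : Set E) := by simp [L.span_eq_top]
      induction hx using Submodule.span_induction with
      | mem x hx => exact Submodule.subset_span (Submodule.apply_mem_map₂ _ hx hy)
      | zero => simp
      | add x x' _ _ hx hx' => rw [TensorProduct.add_tmul]; exact Submodule.add_mem _ hx hx'
      | smul a x _ hx => rw [← TensorProduct.smul_tmul']; exact Submodule.smul_mem _ a hx
    have hF : ∀ (x : E) (y : F), x ⊗ₜ[K] y ∈ Submodule.span K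
        ((Submodule.map₂ ((TensorProduct.mk K E F).restrictScalars₁₂ (𝓞 K) (𝓞 K))
          L.carrier M.carrier : Submodule (𝓞 K) (E ⊗[K] F)) : Set (E ⊗[K] F)) := by
      intro x y
      have hy : y ∈ Submodule.span K (M.carrier : Set F) := by simp [M.span_eq_top]
      induction hy using Submodule.span_induction with
      | mem y hy => exact hE x y hy
      | zero => simp
      | add y y' _ _ hy hy' => rw [TensorProduct.tmul_add]; exact Submodule.add_mem _ hy hy'
      | smul a y _ hy => rw [TensorProduct.tmul_smul]; exact Submodule.smul_mem _ a hy
    rw [eq_top_iff, ← TensorProduct.span_tmul_eq_top, Submodule.span_le]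
    rintro _ ⟨x, y, rfl⟩
    exact hF x y
  herm := fun v => tensorCore v (L.herm v) (M.herm v)

end

end OKLattice

/-! ### Multiplicity-free representations -/

section Representation

variable {K G E : Type*} [Field K] [Group G] [AddCommGroup E] [Module K E]

/-- Extension of scalars of a representation to an algebraic closure of the base field. -/
def geometricRep (ρ : Representation K G E) :
    Representation (AlgebraicClosure K) G (AlgebraicClosure K ⊗[K] E) :=
  ((Module.End.baseChangeHom K (AlgebraicClosure K) E : _ →* _)).comp ρ

/-- Absolute irreducibility: the representation is irreducible over an algebraic closure. -/
def IsAbsIrreducible (ρ : Representation K G E) : Prop :=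
  (geometricRep ρ).IsIrreducible

/-- `ρ` is multiplicity-free with `r` irreducible components: the space is the direct sum of `r`
pairwise non-isomorphic absolutely irreducible subrepresentations. -/
def IsMultiplicityFree (ρ : Representation K G E) (r : ℕ) : Prop :=
  ∃ W : Fin r → Subrepresentation ρ,
    DirectSum.IsInternal (fun i => (W i).toSubmodule) ∧
    (∀ i, IsAbsIrreducible (W i).toRepresentation) ∧
    ∀ i j, i ≠ j → IsEmpty ((W i).toRepresentation.Equiv (W j).toRepresentation)

/-- The tautological representation of a group of linear automorphisms of `E`. -/
def tautRep (G : Subgroup (E ≃ₗ[K] E)) : Representation K G E :=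
  (LinearEquiv.automorphismGroup.toLinearMapMonoidHom (R := K) (M := E)).comp G.subtype

end Representation

end

/-!
The equality is a pair of inequalities, and only `μ_min(L) μ_min(M) ≤ μ_min(L ⊗ M)` is hard. The
other one follows from `vol_tensorSub`: the tensor product of sublattices of minimal slope is a
sublattice of slope `μ_min(L) μ_min(M)`.

*Attainment.* A submodule of rank `n` is determined, as a primitive submodule, by the Plücker
coordinates of its span, up to a common factor. With `N = ∑ 𝔞_i b_i`, Minkowski's theorem gives an
element of `∏ 𝔞_i` which, used as the factor, makes all the conjugates of the coordinates bounded in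
terms of `vol N`, while their denominators stay bounded. There are finitely many such algebraic
numbers, hence finitely many primitive submodules of bounded volume (`finite_isPrim_vol_le`).

*A canonical sublattice.* Gram determinants are submodular, because they decrease under
contractions. Hence `vol(X + Y) vol(X ∩ Y) ≤ vol X vol Y` (`vol_submodular`), and so the sublattice
of minimal slope and maximal rank is unique. Let `N` be the one of `L ⊗ M`: it is stable under
`Aut(L ⊗ M)`, in particular under `G ⊗ 1`.

*Its shape.* Say that `E` has `r ≤ 2` components. By Schur's lemma over `K`, every endomorphism of
`E` that commutes with `G` acts by scalars on the components, and the density theorem shows that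
`K N = E₁ ⊗ A + E₂ ⊗ B` for subspaces `A`, `B` of `F` (`exists_eq_iSup_tensorSubspace`). No group
acting on `F` is needed. Moreover `E₁` and `E₂` are orthogonal for all the forms `h_v`
(`SchurDecomposition.inner_proj_eq_zero`).

*Its volume.* Let `L₁ = L ∩ E₁` and let `L₂` be the projection of `L` to `E₂`, so that
`vol L = vol L₁ vol L₂` by orthogonality, and let `M_A = M ∩ A`, `M_B = M ∩ B`. Intersecting `N`
with `E₁ ⊗ F` and projecting it to `E₂ ⊗ F` gives submodules of `L₁ ⊗ M_A` and `L₂ ⊗ M_B`. If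
`α = dim A`, `β = dim B`, `e_i = dim E_i` and, by symmetry, `α ≥ β`, then
`vol N ≥ vol(L₁ ⊗ M_A) vol(L₂ ⊗ M_B) = vol(L₁)^(α - β) vol(L)^β vol(M_A)^e₁ vol(M_B)^e₂`.
Now `L₁`, `L`, `M_A`, `M_B` are sublattices of `L` or `M`, although `L₂` is not, so the right-hand
side is at least `(μ_min(L) μ_min(M))^(e₁ α + e₂ β)`, and `e₁ α + e₂ β` is the rank of `N`
(`OKLattice.pow_le_vol_tensor`). The case `s ≤ 2` is the same with `L` and `M` exchanged.
-/

noncomputable section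

set_option linter.unusedSectionVars false

/-! ### Gram determinants -/

section Gram

open Matrix ComplexOrder MatrixOrder

theorem one_le_re_det_one_add {𝕜 n : Type*} [RCLike 𝕜] [Fintype n] [DecidableEq n]
    {C : Matrix n n 𝕜} (hC : C.PosSemidef) : 1 ≤ RCLike.re (1 + C).det := by
  have hH : (1 + C).IsHermitian := isHermitian_one.add hC.1
  rw [hH.det_eq_prod_eigenvalues]
  have : ∀ i, 1 ≤ hH.eigenvalues i := by
    intro i
    rw [hH.eigenvalues_eq, add_mulVec, dotProduct_add, map_add, one_mulVec]
    have h1 : star (hH.eigenvectorBasis i).ofLp ⬝ᵥ (hH.eigenvectorBasis i).ofLp = 1 := by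
      have := hH.eigenvectorBasis.orthonormal.1 i
      have h2 := inner_self_eq_norm_sq_to_K (𝕜 := 𝕜) (hH.eigenvectorBasis i)
      rw [this, EuclideanSpace.inner_eq_star_dotProduct, dotProduct_comm] at h2
      simpa using h2
    rw [h1]
    have := (RCLike.nonneg_iff.1 (hC.dotProduct_mulVec_nonneg (hH.eigenvectorBasis i).ofLp)).1
    simpa using this
  rw [← RCLike.ofReal_prod, RCLike.ofReal_re]
  calc (1 : ℝ) = ∏ _i : n, (1 : ℝ) := by simp
    _ ≤ _ := Finset.prod_le_prod (fun _ _ => zero_le_one) fun i _ => this i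

/-- The determinant is monotone on positive semidefinite matrices: with `A = Sᴴ S` invertible,
`A + C = Sᴴ (1 + C') S` for a positive semidefinite `C'`. -/
theorem re_det_le_re_det_add {𝕜 n : Type*} [RCLike 𝕜] [Fintype n] [DecidableEq n]
    {A C : Matrix n n 𝕜} (hA : A.PosSemidef) (hC : C.PosSemidef) :
    RCLike.re A.det ≤ RCLike.re (A + C).det := by
  by_cases h0 : A.det = 0
  · rw [h0, map_zero]
    exact (RCLike.nonneg_iff.1 (hA.add hC).det_nonneg).1
  have hP : A.PosDef := hA.posDef_iff_det_ne_zero.2 h0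
  obtain ⟨S, hS, rfl⟩ : ∃ S : Matrix n n 𝕜, IsUnit S.det ∧ A = Sᴴ * S := by
    obtain ⟨S, hS⟩ := CStarAlgebra.nonneg_iff_eq_star_mul_self.1 hA.nonneg
    rw [star_eq_conjTranspose] at hS
    refine ⟨S, ?_, hS⟩
    rw [isUnit_iff_ne_zero]
    intro h
    rw [hS, det_mul, h, mul_zero] at h0
    exact h0 rfl
  have hS' : IsUnit S := (isUnit_iff_isUnit_det S).2 hS
  have hSi : S * S⁻¹ = 1 := mul_nonsing_inv S hS
  have hSi' : S⁻¹ * S = 1 := nonsing_inv_mul S hS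
  have e : Sᴴ * S + C = Sᴴ * (1 + (S⁻¹)ᴴ * C * S⁻¹) * S := by
    have h2 : Sᴴ * (S⁻¹)ᴴ = 1 := by rw [← conjTranspose_mul, hSi', conjTranspose_one]
    rw [Matrix.mul_add, Matrix.add_mul, Matrix.mul_one]
    congr 1
    calc C = (Sᴴ * (S⁻¹)ᴴ) * C * (S⁻¹ * S) := by rw [h2, hSi', Matrix.one_mul, Matrix.mul_one]
      _ = _ := by simp only [Matrix.mul_assoc]
  have hpos : ((S⁻¹)ᴴ * C * S⁻¹).PosSemidef := hC.conjTranspose_mul_mul_same _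
  have h1 := one_le_re_det_one_add hpos
  have hd : ∀ X : Matrix n n 𝕜, RCLike.re (Sᴴ * X * S).det = ‖S.det‖ ^ 2 * RCLike.re X.det := by
    intro X
    rw [det_mul, det_mul, det_conjTranspose, mul_right_comm, RCLike.star_def, RCLike.conj_mul,
      ← RCLike.ofReal_pow, RCLike.re_ofReal_mul]
  rw [e, hd]
  have := hd 1
  rw [Matrix.mul_one] at this
  rw [this]
  simp only [det_one, RCLike.one_re]
  gcongr

/-- Gram determinants decrease under contractions. -/
theorem gramDet_contraction {𝕜 V W ι : Type*} [RCLike 𝕜] [Fintype ι] [DecidableEq ι]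
    [NormedAddCommGroup V] [InnerProductSpace 𝕜 V]
    [NormedAddCommGroup W] [InnerProductSpace 𝕜 W]
    (f : V →L[𝕜] W) (hf : ‖f‖ ≤ 1) (b : ι → V) :
    RCLike.re (gram 𝕜 (f ∘ b)).det ≤ RCLike.re (gram 𝕜 b).det := by
  have h1 : (gram 𝕜 b - gram 𝕜 (f ∘ b)).PosSemidef := by
    have h2 := posSemidef_opNorm_smul_gram_sub_gram b f
    have h3 : ((1 - ‖f‖ ^ 2) • gram 𝕜 b).PosSemidef :=
      (posSemidef_gram 𝕜 b).smul (by nlinarith [norm_nonneg f] : (0:ℝ) ≤ 1 - ‖f‖ ^ 2)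
    have := h2.add h3
    convert this using 1
    rw [sub_smul, one_smul]; abel
  have := re_det_le_re_det_add (posSemidef_gram 𝕜 (f ∘ b)) h1
  rwa [add_sub_cancel] at this

variable {𝕜 V : Type*} [RCLike 𝕜] [AddCommGroup V] [Module 𝕜 V]

/-- The Gram determinant of a family of vectors with respect to a positive definite form, as a
real number. -/
def gramDet {ι : Type*} [Fintype ι] [DecidableEq ι] (c : InnerProductSpace.Core 𝕜 V)
    (b : ι → V) : ℝ :=
  RCLike.re (Matrix.det (Matrix.of fun i j => c.inner (b i) (b j)))

variable (c : InnerProductSpace.Core 𝕜 V)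
variable {ι κ τ : Type*} [Fintype ι] [DecidableEq ι] [Fintype κ] [DecidableEq κ]
  [Fintype τ] [DecidableEq τ]

theorem gramDet_nonneg (b : ι → V) : 0 ≤ gramDet c b := by
  let _ : NormedAddCommGroup V := c.toNormedAddCommGroup
  let _ : InnerProductSpace 𝕜 V := InnerProductSpace.ofCore c.toCore
  exact (RCLike.nonneg_iff.1 (posSemidef_gram 𝕜 b).det_nonneg).1

theorem ofReal_gramDet (b : ι → V) :
    ((gramDet c b : ℝ) : 𝕜) = Matrix.det (Matrix.of fun i j => c.inner (b i) (b j)) := by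
  let _ : NormedAddCommGroup V := c.toNormedAddCommGroup
  let _ : InnerProductSpace 𝕜 V := InnerProductSpace.ofCore c.toCore
  exact RCLike.conj_eq_iff_re.1 (RCLike.conj_eq_iff_im.2
    (RCLike.nonneg_iff.1 (posSemidef_gram 𝕜 b).det_nonneg).2)

theorem gramDet_pos {b : ι → V} (hb : LinearIndependent 𝕜 b) : 0 < gramDet c b := by
  let _ : NormedAddCommGroup V := c.toNormedAddCommGroup
  let _ : InnerProductSpace 𝕜 V := InnerProductSpace.ofCore c.toCore
  exact (RCLike.pos_iff.1 (posDef_gram_of_linearIndependent hb).det_pos).1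

theorem gramDet_reindex (e : κ ≃ ι) (b : ι → V) : gramDet c (b ∘ e) = gramDet c b := by
  unfold gramDet
  rw [← Matrix.det_submatrix_equiv_self e]
  rfl

theorem gramDet_linearComb (T : Matrix ι ι 𝕜) (d : ι → V) :
    gramDet c (fun i => ∑ j, T i j • d j) = ‖T.det‖ ^ 2 * gramDet c d := by
  let _ : NormedAddCommGroup V := c.toNormedAddCommGroup
  let _ : InnerProductSpace 𝕜 V := InnerProductSpace.ofCore c.toCore
  have e : gram 𝕜 (fun i => ∑ j, T i j • d j) = T.map star * gram 𝕜 d * Tᵀ := by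
    ext i j
    simp only [gram_apply, mul_apply, sum_inner, inner_sum, inner_smul_left, inner_smul_right,
      map_apply, transpose_apply, Finset.sum_mul, Finset.mul_sum]
    refine Finset.sum_congr rfl fun x _ => Finset.sum_congr rfl fun y _ => ?_
    simp only [RCLike.star_def]; ring
  change RCLike.re (gram 𝕜 _).det = _ * RCLike.re (gram 𝕜 d).det
  have h2 : (T.map star).det = star T.det := by
    rw [← det_conjTranspose, ← det_transpose]; rfl
  rw [e, det_mul, det_mul, det_transpose, h2, mul_right_comm, RCLike.star_def, RCLike.conj_mul,
      ← RCLike.ofReal_pow, RCLike.re_ofReal_mul]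

/-- Splitting of a Gram determinant: the vectors `x` may be replaced by their components `x'`
orthogonal to the vectors `b`. -/
theorem gramDet_sumElim (b : ι → V) (x x' : κ → V)
    (hx : ∀ k, x k - x' k ∈ Submodule.span 𝕜 (Set.range b))
    (ho : ∀ i k, c.inner (b i) (x' k) = 0) :
    gramDet c (Sum.elim b x) = gramDet c b * gramDet c x' := by
  let _ : NormedAddCommGroup V := c.toNormedAddCommGroup
  let _ : InnerProductSpace 𝕜 V := InnerProductSpace.ofCore c.toCore
  choose t ht using fun k => (Submodule.mem_span_range_iff_exists_fun 𝕜).1 (hx k)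
  have e : Sum.elim b x = fun i => ∑ j, (fromBlocks 1 0 (of t) 1 : Matrix (ι ⊕ κ) (ι ⊕ κ) 𝕜) i j •
      Sum.elim b x' j := by
    funext i
    rcases i with i | k
    · simp [Fintype.sum_sum_type, one_apply]
    · simp [Fintype.sum_sum_type, one_apply, ht]
  rw [e, gramDet_linearComb, det_fromBlocks_zero₁₂, det_one, det_one]
  have e2 : gram 𝕜 (Sum.elim b x') = fromBlocks (gram 𝕜 b) 0 0 (gram 𝕜 x') := by
    ext i j
    rcases i with i | i <;> rcases j with j | j
    · rfl
    · exact ho i j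
    · change inner 𝕜 (x' i) (b j) = 0
      rw [inner_eq_zero_symm]; exact ho j i
    · rfl
  change _ * RCLike.re (gram 𝕜 (Sum.elim b x')).det =
    RCLike.re (gram 𝕜 b).det * RCLike.re (gram 𝕜 x').det
  have hr := RCLike.conj_eq_iff_re.1 (RCLike.conj_eq_iff_im.2
    (RCLike.nonneg_iff.1 (posSemidef_gram 𝕜 b).det_nonneg).2)
  rw [e2, det_fromBlocks_zero₂₁, ← hr, RCLike.re_ofReal_mul]
  simp

/-- The case of `gramDet_sumElim` where the components are given by the orthogonal projection. -/
theorem gramDet_sumElim_starProjection [FiniteDimensional 𝕜 V] (b : ι → V) (x : κ → V) :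
    letI : NormedAddCommGroup V := c.toNormedAddCommGroup
    letI : InnerProductSpace 𝕜 V := InnerProductSpace.ofCore c.toCore
    gramDet c (Sum.elim b x) = gramDet c b *
      gramDet c (fun k => (Submodule.span 𝕜 (Set.range b))ᗮ.starProjection (x k)) := by
  let _ : NormedAddCommGroup V := c.toNormedAddCommGroup
  let _ : InnerProductSpace 𝕜 V := InnerProductSpace.ofCore c.toCore
  apply gramDet_sumElim
  · intro k
    rw [Submodule.starProjection_orthogonal_val, sub_sub_cancel]
    exact Submodule.starProjection_apply_mem _ _
  · intro i k
    have := Submodule.starProjection_apply_mem (Submodule.span 𝕜 (Set.range b))ᗮ (x k)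
    exact (Submodule.mem_orthogonal _ _).1 this _ (Submodule.subset_span ⟨i, rfl⟩)

/-- Submodularity of Gram determinants: the component of `y` orthogonal to `b` and `x` arises by a
projection from the component orthogonal to `b`. -/
theorem gramDet_submodular [FiniteDimensional 𝕜 V] (b : ι → V) (x : κ → V) (y : τ → V) :
    gramDet c (Sum.elim (Sum.elim b x) y) * gramDet c b ≤
      gramDet c (Sum.elim b x) * gramDet c (Sum.elim b y) := by
  let _ : NormedAddCommGroup V := c.toNormedAddCommGroup
  let _ : InnerProductSpace 𝕜 V := InnerProductSpace.ofCore c.toCore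
  rw [gramDet_sumElim_starProjection, gramDet_sumElim_starProjection c b y, mul_assoc]
  refine mul_le_mul_of_nonneg_left ?_ (gramDet_nonneg _ _)
  rw [mul_comm]
  refine mul_le_mul_of_nonneg_left ?_ (gramDet_nonneg _ _)
  set P := (Submodule.span 𝕜 (Set.range (Sum.elim b x)))ᗮ.starProjection with hP
  set Q := (Submodule.span 𝕜 (Set.range b))ᗮ.starProjection with hQ
  have hPQ : (fun k => P (y k)) = P ∘ (fun k => Q (y k)) := by
    funext k
    have h0 : Q (y k) = y k - (Submodule.span 𝕜 (Set.range b)).starProjection (y k) :=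
      Submodule.starProjection_orthogonal_val _
    rw [Function.comp_apply, h0, map_sub]
    have : P ((Submodule.span 𝕜 (Set.range b)).starProjection (y k)) = 0 := by
      rw [hP, Submodule.starProjection_apply_eq_zero_iff, Submodule.orthogonal_orthogonal]
      refine Submodule.span_mono ?_ (Submodule.starProjection_apply_mem _ (y k))
      rintro _ ⟨i, rfl⟩
      exact ⟨Sum.inl i, rfl⟩
    rw [this, sub_zero]
  rw [hPQ]
  exact gramDet_contraction P (Submodule.starProjection_norm_le _) _

/-- A Gram determinant controls the coordinates of the exterior product: a multiple of `f` is a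
contraction into `𝕜ⁿ`, where the Gram determinant is the square of a determinant. -/
theorem exists_le_gramDet [FiniteDimensional 𝕜 V] (f : V →ₗ[𝕜] (ι → 𝕜)) :
    ∃ δ : ℝ, 0 < δ ∧ ∀ b : ι → V, δ * ‖(Matrix.of fun i => f (b i)).det‖ ^ 2 ≤ gramDet c b := by
  let _ : NormedAddCommGroup V := c.toNormedAddCommGroup
  let _ : InnerProductSpace 𝕜 V := InnerProductSpace.ofCore c.toCore
  let f' : V →L[𝕜] EuclideanSpace 𝕜 ι :=
    LinearMap.toContinuousLinearMap ((WithLp.linearEquiv 2 𝕜 (ι → 𝕜)).symm.toLinearMap ∘ₗ f)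
  obtain ⟨s, hs, hs1⟩ : ∃ s : ℝ, 0 < s ∧ s * ‖f'‖ ≤ 1 := by
    refine ⟨(‖f'‖ + 1)⁻¹, by positivity, ?_⟩
    rw [inv_mul_le_one₀ (by positivity)]; linarith
  refine ⟨(s ^ Fintype.card ι) ^ 2, by positivity, fun b => ?_⟩
  let g : V →L[𝕜] EuclideanSpace 𝕜 ι := (s : 𝕜) • f'
  have hg : ‖g‖ ≤ 1 := by
    rw [norm_smul, RCLike.norm_ofReal, abs_of_pos hs]; exact hs1
  refine le_trans (le_of_eq ?_) (gramDet_contraction g hg b)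
  have e : gram 𝕜 (g ∘ b) = (((s : 𝕜) • (Matrix.of fun i => f (b i))).map star) *
      ((s : 𝕜) • (Matrix.of fun i => f (b i)))ᵀ := by
    ext i j
    simp only [gram_apply, Function.comp, EuclideanSpace.inner_eq_star_dotProduct, mul_apply,
      dotProduct]
    refine Finset.sum_congr rfl fun k _ => ?_
    rw [mul_comm]
    rfl
  have h2 : ∀ T : Matrix ι ι 𝕜, (T.map star).det = star T.det := fun T => by
    rw [← det_conjTranspose, ← det_transpose]; rfl
  rw [e, det_mul, det_transpose, h2, det_smul, RCLike.star_def, RCLike.conj_mul,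
    ← RCLike.ofReal_pow, RCLike.ofReal_re, norm_mul, mul_pow, norm_pow, RCLike.norm_ofReal,
    abs_of_pos hs]

end Gram

/-! ### Pseudo-bases and the volume -/

section PseudoBases

variable {K E : Type*} [Field K] [NumberField K] [AddCommGroup E] [Module K E]
  [Module (𝓞 K) E] [IsScalarTower (𝓞 K) K E]

/-- `N = ∑ 𝔞_i b_i` with nonzero fractional ideals `𝔞_i` and linearly independent vectors `b_i`,
for an arbitrary index type. -/
structure IsPseudoBasis {ι : Type*} (N : Submodule (𝓞 K) E)
    (𝔞 : ι → FractionalIdeal (𝓞 K)⁰ K) (b : ι → E) : Prop where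
  ideal_ne_zero : ∀ i, 𝔞 i ≠ 0
  linearIndependent : LinearIndependent K b
  eq_iSup : N = ⨆ i, idealSMul (𝔞 i) (b i)

/-- The product of the real Gram determinants at the infinite places, with the exponents
`e_v / 2`. -/
def archVol {ι : Type*} [Fintype ι] [DecidableEq ι] (h : HermitianFamily K E) (b : ι → E) : ℝ :=
  ∏ v : InfinitePlace K,
    gramDet (h v) (fun i => (1 : CAt v) ⊗ₜ[K] b i) ^ ((v.mult : ℝ) / 2)

/-- The volume computed with a pseudo-basis. -/
def pseudoVol {ι : Type*} [Fintype ι] [DecidableEq ι] (h : HermitianFamily K E)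
    (𝔞 : ι → FractionalIdeal (𝓞 K)⁰ K) (b : ι → E) : ℝ :=
  (FractionalIdeal.absNorm (∏ i, 𝔞 i) : ℝ) * archVol h b

theorem absNorm_le_of_le {I J : FractionalIdeal (𝓞 K)⁰ K} (hI : I ≠ 0) (hIJ : I ≤ J) :
    FractionalIdeal.absNorm J ≤ FractionalIdeal.absNorm I := by
  have hJ : J ≠ 0 := fun h => hI (le_bot_iff.1 (by simpa [h] using hIJ))
  have h1 : I * J⁻¹ ≤ 1 := by
    calc I * J⁻¹ ≤ J * J⁻¹ := mul_le_mul_left hIJ _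
      _ = 1 := mul_inv_cancel₀ hJ
  obtain ⟨I₀, hI₀⟩ := FractionalIdeal.le_one_iff_exists_coeIdeal.1 h1
  have h2 : I = J * I₀ := by rw [hI₀, mul_comm I, mul_inv_cancel_left₀ hJ]
  have h0 : (I₀ : FractionalIdeal (𝓞 K)⁰ K) ≠ 0 := fun h => hI (by rw [h2, h, mul_zero])
  have h3 : (1 : ℚ) ≤ FractionalIdeal.absNorm (I₀ : FractionalIdeal (𝓞 K)⁰ K) := by
    rw [FractionalIdeal.coeIdeal_absNorm]
    have : Ideal.absNorm I₀ ≠ 0 := by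
      rw [Ne, Ideal.absNorm_eq_zero_iff]
      rintro rfl
      exact h0 (by simp)
    exact_mod_cast Nat.one_le_iff_ne_zero.2 this
  rw [h2, map_mul]
  exact le_mul_of_one_le_right (FractionalIdeal.absNorm_nonneg J) h3

theorem absNorm_pos {I : FractionalIdeal (𝓞 K)⁰ K} (hI : I ≠ 0) :
    0 < FractionalIdeal.absNorm I :=
  lt_of_le_of_ne (FractionalIdeal.absNorm_nonneg I)
    (fun h => hI (FractionalIdeal.absNorm_eq_zero_iff.1 h.symm))

theorem archVol_reindex {ι κ : Type*} [Fintype ι] [DecidableEq ι] [Fintype κ] [DecidableEq κ]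
    (h : HermitianFamily K E) (e : κ ≃ ι) (b : ι → E) : archVol h (b ∘ e) = archVol h b :=
  Finset.prod_congr rfl fun v _ => by
    rw [← gramDet_reindex (h v) e fun i => (1 : CAt v) ⊗ₜ[K] b i]; rfl

theorem pseudoVol_reindex {ι κ : Type*} [Fintype ι] [DecidableEq ι] [Fintype κ] [DecidableEq κ]
    (h : HermitianFamily K E) (e : κ ≃ ι) (𝔞 : ι → FractionalIdeal (𝓞 K)⁰ K) (b : ι → E) :
    pseudoVol h (𝔞 ∘ e) (b ∘ e) = pseudoVol h 𝔞 b := by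
  rw [pseudoVol, pseudoVol, archVol_reindex]
  congr 3
  exact Equiv.prod_comp e 𝔞

theorem archVol_pos {ι : Type*} [Fintype ι] [DecidableEq ι] (h : HermitianFamily K E) {b : ι → E}
    (hb : LinearIndependent K b) : 0 < archVol h b :=
  Finset.prod_pos fun v _ => Real.rpow_pos_of_pos (gramDet_pos (h v)
    (Module.Flat.linearIndependent_one_tmul (S := CAt v) hb)) _

/-- A change of basis multiplies the archimedean volume by the norm of its determinant, by the
product formula `∏ |x|_v ^ e_v = |N(x)|`. -/
theorem archVol_linearComb {ι : Type*} [Fintype ι] [DecidableEq ι] (h : HermitianFamily K E)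
    (T : Matrix ι ι K) (d : ι → E) :
    archVol h (fun i => ∑ j, T i j • d j) = |Algebra.norm ℚ T.det| * archVol h d := by
  have key : ∀ v : InfinitePlace K,
      gramDet (h v) (fun i => (1 : CAt v) ⊗ₜ[K] ∑ j, T i j • d j) ^ ((v.mult : ℝ) / 2) =
        v T.det ^ v.mult * gramDet (h v) (fun i => (1 : CAt v) ⊗ₜ[K] d i) ^ ((v.mult : ℝ) / 2) := by
    intro v
    have e : (fun i => (1 : CAt v) ⊗ₜ[K] ∑ j, T i j • d j) =
        fun i => ∑ j, T.map (algebraMap K (CAt v)) i j • ((1 : CAt v) ⊗ₜ[K] d j) := by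
      funext i
      rw [TensorProduct.tmul_sum]
      refine Finset.sum_congr rfl fun j _ => ?_
      rw [Matrix.map_apply, algebraMap_smul, TensorProduct.tmul_smul]
    have hn : ‖(T.map (algebraMap K (CAt v))).det‖ = v T.det := by
      rw [← RingHom.mapMatrix_apply, ← RingHom.map_det]
      exact InfinitePlace.norm_embedding_eq v T.det
    rw [e, gramDet_linearComb, hn, Real.mul_rpow (by positivity) (gramDet_nonneg _ _)]
    congr 1
    rw [← Real.rpow_natCast, ← Real.rpow_natCast, ← Real.rpow_mul (apply_nonneg v _)]
    congr 1
    push_cast; ring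
  unfold archVol
  rw [Finset.prod_congr rfl fun v _ => key v, Finset.prod_mul_distrib,
    InfinitePlace.prod_eq_abs_norm]

theorem IsPseudoBasis.mem_iff {ι : Type*} [Fintype ι] {N : Submodule (𝓞 K) E}
    {𝔞 : ι → FractionalIdeal (𝓞 K)⁰ K} {b : ι → E} (P : IsPseudoBasis N 𝔞 b) {x : E} :
    x ∈ N ↔ ∃ c : ι → K, (∀ i, c i ∈ 𝔞 i) ∧ x = ∑ i, c i • b i := by
  rw [P.eq_iSup, Submodule.mem_iSup_iff_exists_finsupp]
  constructor
  · rintro ⟨f, hf, rfl⟩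
    choose c hc hc' using fun i => mem_idealSMul.1 (hf i)
    refine ⟨c, hc, ?_⟩
    rw [Finsupp.sum_fintype _ _ (fun _ => rfl)]
    exact Finset.sum_congr rfl fun i _ => (hc' i).symm
  · rintro ⟨c, hc, rfl⟩
    refine ⟨Finsupp.equivFunOnFinite.symm fun i => c i • b i,
      fun i => mem_idealSMul.2 ⟨_, hc i, rfl⟩, ?_⟩
    rw [Finsupp.sum_fintype _ _ (fun _ => rfl)]
    rfl

theorem IsPseudoBasis.reindex {ι κ : Type*} {N : Submodule (𝓞 K) E}
    {𝔞 : ι → FractionalIdeal (𝓞 K)⁰ K} {b : ι → E} (P : IsPseudoBasis N 𝔞 b) (e : κ ≃ ι) :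
    IsPseudoBasis N (𝔞 ∘ e) (b ∘ e) :=
  ⟨fun _ => P.ideal_ne_zero _, P.linearIndependent.comp _ e.injective,
    P.eq_iSup.trans (Equiv.iSup_comp (g := fun i => idealSMul (𝔞 i) (b i)) e).symm⟩

theorem exists_mem_ne_zero {I : FractionalIdeal (𝓞 K)⁰ K} (hI : I ≠ 0) : ∃ a ∈ I, a ≠ 0 := by
  by_contra hcon
  push Not at hcon
  exact hI (FractionalIdeal.eq_zero_iff.2 hcon)

theorem IsPseudoBasis.smul_mem {ι : Type*} {N : Submodule (𝓞 K) E}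
    {𝔞 : ι → FractionalIdeal (𝓞 K)⁰ K} {b : ι → E} (P : IsPseudoBasis N 𝔞 b) {i : ι} {a : K}
    (ha : a ∈ 𝔞 i) : a • b i ∈ N := by
  rw [P.eq_iSup]
  exact Submodule.mem_iSup_of_mem i (mem_idealSMul.2 ⟨a, ha, rfl⟩)

theorem IsPseudoBasis.span_eq {ι : Type*} {N : Submodule (𝓞 K) E}
    {𝔞 : ι → FractionalIdeal (𝓞 K)⁰ K} {b : ι → E} (P : IsPseudoBasis N 𝔞 b) :
    Submodule.span K (N : Set E) = Submodule.span K (Set.range b) := by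
  apply le_antisymm
  · have : N ≤ (Submodule.span K (Set.range b)).restrictScalars (𝓞 K) := by
      rw [P.eq_iSup]
      refine iSup_le fun i x hx => ?_
      obtain ⟨a, -, rfl⟩ := mem_idealSMul.1 hx
      exact Submodule.smul_mem _ _ (Submodule.subset_span (Set.mem_range_self i))
    exact Submodule.span_le.2 this
  · rw [Submodule.span_le]
    rintro _ ⟨i, rfl⟩
    obtain ⟨a, ha, ha0⟩ := exists_mem_ne_zero (P.ideal_ne_zero i)
    have := Submodule.smul_mem (Submodule.span K (N : Set E)) a⁻¹ (Submodule.subset_span (R := K)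
      (s := (N : Set E)) (show a • b i ∈ (N : Set E) from P.smul_mem ha))
    rwa [smul_smul, inv_mul_cancel₀ ha0, one_smul] at this

theorem IsPseudoBasis.finrank_eq {ι : Type*} [Fintype ι] {N : Submodule (𝓞 K) E}
    {𝔞 : ι → FractionalIdeal (𝓞 K)⁰ K} {b : ι → E} (P : IsPseudoBasis N 𝔞 b) :
    Module.finrank K (Submodule.span K (N : Set E)) = Fintype.card ι := by
  rw [P.span_eq, finrank_span_eq_card P.linearIndependent]

theorem IsPseudoBasis.pseudoVol_pos {ι : Type*} [Fintype ι] [DecidableEq ι]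
    {N : Submodule (𝓞 K) E} {𝔞 : ι → FractionalIdeal (𝓞 K)⁰ K} {b : ι → E}
    (P : IsPseudoBasis N 𝔞 b) (h : HermitianFamily K E) : 0 < pseudoVol h 𝔞 b :=
  mul_pos (by exact_mod_cast absNorm_pos (Finset.prod_ne_zero_iff.2 fun i _ => P.ideal_ne_zero i))
    (archVol_pos h P.linearIndependent)

theorem prod_le_prod_fractionalIdeal {ι : Type*} (s : Finset ι)
    {f g : ι → FractionalIdeal (𝓞 K)⁰ K} (h : ∀ i ∈ s, f i ≤ g i) :
    ∏ i ∈ s, f i ≤ ∏ i ∈ s, g i := by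
  classical
  induction s using Finset.induction_on with
  | empty => simp
  | insert a s ha ih =>
    rw [Finset.prod_insert ha, Finset.prod_insert ha]
    exact mul_le_mul' (h a (by simp)) (ih fun i hi => h i (by simp [hi]))

/-- If `T_ij 𝔞_i ⊆ 𝔠_j` for all `i, j`, then `det T ∏ 𝔞_i ⊆ ∏ 𝔠_j`. -/
theorem spanSingleton_det_mul_prod_le {ι : Type*} [Fintype ι] [DecidableEq ι]
    {𝔞 𝔠 : ι → FractionalIdeal (𝓞 K)⁰ K} (T : Matrix ι ι K)
    (hT : ∀ i j, ∀ a ∈ 𝔞 i, T i j * a ∈ 𝔠 j) :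
    FractionalIdeal.spanSingleton (𝓞 K)⁰ T.det * ∏ i, 𝔞 i ≤ ∏ j, 𝔠 j := by
  have h1 : ∀ i j, FractionalIdeal.spanSingleton (𝓞 K)⁰ (T i j) * 𝔞 i ≤ 𝔠 j := fun i j =>
    FractionalIdeal.spanSingleton_mul_le_iff.2 (hT i j)
  have h2 : ∀ σ : Equiv.Perm ι, FractionalIdeal.spanSingleton (𝓞 K)⁰ (∏ i, T (σ i) i) *
      ∏ i, 𝔞 i ≤ ∏ j, 𝔠 j := by
    intro σ
    have h3 : ∀ s : Finset ι, FractionalIdeal.spanSingleton (𝓞 K)⁰ (∏ i ∈ s, T (σ i) i) =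
        ∏ i ∈ s, FractionalIdeal.spanSingleton (𝓞 K)⁰ (T (σ i) i) := by
      intro s
      induction s using Finset.induction_on with
      | empty => simp
      | insert a s ha ih => rw [Finset.prod_insert ha, Finset.prod_insert ha, ← ih,
          FractionalIdeal.spanSingleton_mul_spanSingleton]
    rw [h3, ← Equiv.prod_comp σ 𝔞, ← Finset.prod_mul_distrib]
    exact prod_le_prod_fractionalIdeal _ fun i _ => h1 _ _
  rw [FractionalIdeal.spanSingleton_mul_le_iff]
  intro z hz
  rw [Matrix.det_apply, Finset.sum_mul]
  refine Submodule.sum_mem (p := ((∏ j, 𝔠 j : FractionalIdeal (𝓞 K)⁰ K) : Submodule (𝓞 K) K))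
    fun σ _ => ?_
  have h4 := FractionalIdeal.spanSingleton_mul_le_iff.1 (h2 σ) z hz
  rcases Int.units_eq_one_or (Equiv.Perm.sign σ) with h5 | h5
  · rw [h5, one_smul]; exact h4
  · rw [h5, Units.neg_smul, one_smul, neg_mul]; exact neg_mem h4

theorem IsPseudoBasis.repr_mem {ι : Type*} [Fintype ι] {N : Submodule (𝓞 K) E}
    {𝔞 : ι → FractionalIdeal (𝓞 K)⁰ K} {b : ι → E} (P : IsPseudoBasis N 𝔞 b)
    {c : ι → K} (hc : ∑ i, c i • b i ∈ N) (i : ι) : c i ∈ 𝔞 i := by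
  obtain ⟨c', hc', e⟩ := P.mem_iff.1 hc
  rw [← sub_eq_zero, ← Finset.sum_sub_distrib] at e
  simp_rw [← sub_smul] at e
  have := Fintype.linearIndependent_iff.1 P.linearIndependent _ e i
  rw [sub_eq_zero.1 this]
  exact hc' i

/-- Volumes decrease when a module is enlarged inside its `K`-span. -/
theorem IsPseudoBasis.pseudoVol_le {ι : Type*} [Fintype ι] [DecidableEq ι]
    {N N' : Submodule (𝓞 K) E} {𝔞 𝔠 : ι → FractionalIdeal (𝓞 K)⁰ K} {b d : ι → E}
    (P : IsPseudoBasis N 𝔞 b) (Q : IsPseudoBasis N' 𝔠 d) (hle : N ≤ N')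
    (h : HermitianFamily K E) : pseudoVol h 𝔠 d ≤ pseudoVol h 𝔞 b := by
  have hb : ∀ i, ∃ t : ι → K, ∑ j, t j • d j = b i := by
    intro i
    have h1 : Submodule.span K (N : Set E) ≤ Submodule.span K (N' : Set E) :=
      Submodule.span_mono hle
    rw [P.span_eq, Q.span_eq] at h1
    exact (Submodule.mem_span_range_iff_exists_fun K).1
      (h1 (Submodule.subset_span (Set.mem_range_self i)))
  choose T hT using hb
  have hbT : b = fun i => ∑ j, Matrix.of T i j • d j := by
    funext i; exact (hT i).symm
  have hTa : ∀ i j, ∀ a ∈ 𝔞 i, Matrix.of T i j * a ∈ 𝔠 j := by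
    intro i j a ha
    have h1 : ∑ j, (T i j * a) • d j ∈ N' := by
      have := hle (P.smul_mem ha)
      rw [← hT i, Finset.smul_sum] at this
      simpa only [smul_smul, mul_comm] using this
    exact Q.repr_mem h1 j
  have hdet : (Matrix.of T).det ≠ 0 := by
    intro h0
    have h1 := archVol_pos h P.linearIndependent
    rw [hbT, archVol_linearComb, h0, Algebra.norm_zero] at h1
    simp at h1
  have hle' := spanSingleton_det_mul_prod_le _ hTa
  have h1 := absNorm_le_of_le (mul_ne_zero (FractionalIdeal.spanSingleton_ne_zero_iff.2 hdet)
    (Finset.prod_ne_zero_iff.2 fun i _ => P.ideal_ne_zero i)) hle'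
  rw [map_mul, FractionalIdeal.absNorm_span_singleton] at h1
  unfold pseudoVol
  rw [hbT, archVol_linearComb, ← mul_assoc]
  refine mul_le_mul_of_nonneg_right ?_ (archVol_pos h Q.linearIndependent).le
  rw [mul_comm]
  exact_mod_cast h1

theorem PseudoBasis.isPseudoBasis {N : Submodule (𝓞 K) E} (P : PseudoBasis N) :
    IsPseudoBasis N P.ideal P.vec :=
  ⟨P.ideal_ne_zero, P.linearIndependent, P.eq_iSup⟩

/-- The volume can be computed with any pseudo-basis, indexed by any finite type. -/
theorem IsPseudoBasis.vol_eq {ι : Type*} [Fintype ι] [DecidableEq ι]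
    {N : Submodule (𝓞 K) E} {𝔞 : ι → FractionalIdeal (𝓞 K)⁰ K} {b : ι → E}
    (P : IsPseudoBasis N 𝔞 b) (h : HermitianFamily K E) : vol h N = pseudoVol h 𝔞 b := by
  let e : Fin (Fintype.card ι) ≃ ι := (Fintype.equivFin ι).symm
  have P' := P.reindex e
  have hne : Nonempty (PseudoBasis N) := ⟨⟨Fintype.card ι, 𝔞 ∘ e, b ∘ e, P'.ideal_ne_zero,
    P'.linearIndependent, P'.eq_iSup⟩⟩
  rw [vol, dif_pos hne]
  generalize hne.some = Q
  have Q' := Q.isPseudoBasis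
  have hrk : Q.rk = Fintype.card ι := by
    have h1 := Q'.finrank_eq
    rw [P.finrank_eq, Fintype.card_fin] at h1
    exact h1.symm
  let e' : Fin Q.rk ≃ ι := (finCongr hrk).trans e
  have P'' := P.reindex e'
  have h1 : Q.vol h = pseudoVol h Q.ideal Q.vec := by
    unfold PseudoBasis.vol pseudoVol archVol gramDet
    rfl
  rw [h1, ← pseudoVol_reindex h e' 𝔞 b]
  exact le_antisymm (P''.pseudoVol_le Q' le_rfl h) (Q'.pseudoVol_le P'' le_rfl h)

end PseudoBases

/-! ### Primitive submodules and the volume of sums, intersections and tensor products -/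

section Primitive

variable {K E : Type*} [Field K] [NumberField K] [AddCommGroup E] [Module K E]
  [Module (𝓞 K) E] [IsScalarTower (𝓞 K) K E]

/-- Elements of the `K`-span have denominators in `𝓞 K`. -/
theorem exists_smul_mem_of_mem_span (N : Submodule (𝓞 K) E) {x : E}
    (hx : x ∈ Submodule.span K (N : Set E)) : ∃ a : 𝓞 K, a ≠ 0 ∧ a • x ∈ N := by
  induction hx using Submodule.span_induction with
  | mem x hx => exact ⟨1, one_ne_zero, by simpa using hx⟩
  | zero => exact ⟨1, one_ne_zero, by simp⟩
  | add x y _ _ hx hy =>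
    obtain ⟨a, ha, hax⟩ := hx
    obtain ⟨b, hb, hby⟩ := hy
    refine ⟨a * b, mul_ne_zero ha hb, ?_⟩
    rw [smul_add]
    refine N.add_mem ?_ ?_
    · rw [mul_comm, mul_smul]; exact N.smul_mem b hax
    · rw [mul_smul]; exact N.smul_mem a hby
  | smul c x _ hx =>
    obtain ⟨a, ha, hax⟩ := hx
    obtain ⟨n, d, hd, rfl⟩ := IsFractionRing.div_surjective (A := 𝓞 K) c
    have hd0 : d ≠ 0 := nonZeroDivisors.ne_zero hd
    refine ⟨d * a, mul_ne_zero hd0 ha, ?_⟩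
    have hdK : algebraMap (𝓞 K) K d ≠ 0 := by simpa using hd0
    have e : (d * a) • (algebraMap (𝓞 K) K n / algebraMap (𝓞 K) K d) • x = n • a • x := by
      rw [← algebraMap_smul K (d * a), ← algebraMap_smul K n, ← algebraMap_smul K a, smul_smul,
        smul_smul, map_mul]
      congr 1
      field_simp
    rw [e]
    exact N.smul_mem n hax

theorem mem_span_of_smul_mem {N : Submodule (𝓞 K) E} {a : 𝓞 K} (ha : a ≠ 0) {x : E}
    (h : a • x ∈ N) : x ∈ Submodule.span K (N : Set E) := by
  have haK : algebraMap (𝓞 K) K a ≠ 0 := by simpa using ha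
  have := Submodule.smul_mem (Submodule.span K (N : Set E)) (algebraMap (𝓞 K) K a)⁻¹
    (Submodule.subset_span (R := K) (s := (N : Set E)) (show a • x ∈ (N : Set E) from h))
  rwa [← algebraMap_smul K a, smul_smul, inv_mul_cancel₀ haK, one_smul] at this

/-- The rank of a submodule of `E`: the dimension of its `K`-span. -/
abbrev latticeRank (N : Submodule (𝓞 K) E) : ℕ :=
  Module.finrank K (Submodule.span K (N : Set E))

/-- `D` is a primitive submodule of `X`: it is the intersection of `X` with a `K`-subspace. -/
def IsPrim (X D : Submodule (𝓞 K) E) : Prop :=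
  D ≤ X ∧ ∀ x ∈ X, x ∈ Submodule.span K (D : Set E) → x ∈ D

/-- Sublattices, defined by a torsion-free quotient, are the primitive submodules. -/
theorem OKLattice.isSublattice_iff_isPrim {L : OKLattice K E} {N : Submodule (𝓞 K) E} :
    L.IsSublattice N ↔ IsPrim L.carrier N := by
  refine and_congr_right fun _ => ⟨fun h x hx hxs => ?_,
    fun h a ha x hx hax => h x hx (mem_span_of_smul_mem ha hax)⟩
  obtain ⟨a, ha, hax⟩ := exists_smul_mem_of_mem_span N hxs
  exact h a ha x hx hax

theorem isPrim_inf_restrictScalars (X : Submodule (𝓞 K) E) (V : Submodule K E) :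
    IsPrim X (X ⊓ V.restrictScalars (𝓞 K)) := by
  refine ⟨inf_le_left, fun x hx hxs => ⟨hx, ?_⟩⟩
  have : Submodule.span K ((X ⊓ V.restrictScalars (𝓞 K) : Submodule (𝓞 K) E) : Set E) ≤ V :=
    Submodule.span_le.2 fun y hy => hy.2
  exact this hxs

theorem fg_of_le {X D : Submodule (𝓞 K) E} (hX : X.FG) (h : D ≤ X) : D.FG := by
  have : IsNoetherian (𝓞 K) X := isNoetherian_of_fg_of_noetherian X hX
  have : IsNoetherian (𝓞 K) D := isNoetherian_of_le h
  exact Module.Finite.iff_fg.1 inferInstance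

theorem finiteDimensional_span {X : Submodule (𝓞 K) E} (hX : X.FG) :
    FiniteDimensional K (Submodule.span K (X : Set E)) := by
  obtain ⟨S, hS⟩ := hX
  rw [← hS, Submodule.span_span_of_tower]
  exact FiniteDimensional.span_finset K S

/-- Pseudo-bases of two modules with independent `K`-spans combine to a pseudo-basis of the sum. -/
theorem IsPseudoBasis.sup {ι κ : Type*} {X Y : Submodule (𝓞 K) E}
    {𝔞 : ι → FractionalIdeal (𝓞 K)⁰ K} {b : ι → E} (P : IsPseudoBasis X 𝔞 b)
    {𝔠 : κ → FractionalIdeal (𝓞 K)⁰ K} {d : κ → E} (Q : IsPseudoBasis Y 𝔠 d)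
    (hd : Disjoint (Submodule.span K (Set.range b)) (Submodule.span K (Set.range d))) :
    IsPseudoBasis (X ⊔ Y) (Sum.elim 𝔞 𝔠) (Sum.elim b d) where
  ideal_ne_zero := by
    rintro (i | i)
    · exact P.ideal_ne_zero i
    · exact Q.ideal_ne_zero i
  linearIndependent := P.linearIndependent.sum_type Q.linearIndependent hd
  eq_iSup := by rw [iSup_sum, P.eq_iSup, Q.eq_iSup]; rfl

/-- A pseudo-basis of a primitive submodule extends to a pseudo-basis. -/
theorem IsPseudoBasis.exists_extend {ι : Type*} {D : Submodule (𝓞 K) E}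
    {𝔞 : ι → FractionalIdeal (𝓞 K)⁰ K} {b : ι → E} (P : IsPseudoBasis D 𝔞 b)
    {X : Submodule (𝓞 K) E} (hX : X.FG) (hD : IsPrim X D) :
    ∃ (κ : Type) (_ : Fintype κ) (_ : DecidableEq κ) (𝔠 : κ → FractionalIdeal (𝓞 K)⁰ K)
      (x : κ → E), IsPseudoBasis X (Sum.elim 𝔞 𝔠) (Sum.elim b x) := by
  obtain ⟨d, hd⟩ : ∃ d, Module.finrank K (Submodule.span K (X : Set E)) = d := ⟨_, rfl⟩
  induction d using Nat.strong_induction_on generalizing X with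
  | _ d ih =>
    by_cases h0 : ∀ z ∈ X, z ∈ Submodule.span K (D : Set E)
    · have hXD : D = X := le_antisymm hD.1 fun z hz => hD.2 z hz (h0 z hz)
      subst hXD
      refine ⟨Empty, inferInstance, inferInstance, Empty.elim, Empty.elim, ?_, ?_, ?_⟩
      · rintro (i | i)
        · exact P.ideal_ne_zero i
        · exact i.elim
      · refine P.linearIndependent.sum_type (linearIndependent_empty_type) ?_
        rw [Set.range_eq_empty (Empty.elim : Empty → E), Submodule.span_empty]
        exact disjoint_bot_right
      · refine P.eq_iSup.trans ?_
        rw [iSup_sum, iSup_of_empty (ι := Empty), sup_bot_eq]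
        rfl
    push Not at h0
    obtain ⟨z, hzX, hz⟩ := h0
    obtain ⟨f, hfz, hf⟩ := Submodule.exists_le_ker_of_notMem hz
    obtain ⟨𝔢, c, h𝔢, hc, hX'⟩ := exists_split X hX f ⟨z, hzX, hfz⟩
    set X' : Submodule (𝓞 K) E := X ⊓ (LinearMap.ker f).restrictScalars (𝓞 K) with hdef
    have hker : Submodule.span K (X' : Set E) ≤ LinearMap.ker f :=
      Submodule.span_le.2 fun y hy => hy.2
    have hlt : Submodule.span K (X' : Set E) < Submodule.span K (X : Set E) := by
      refine lt_of_le_of_ne (Submodule.span_mono fun y hy => hy.1) fun heq => hfz ?_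
      exact hker (heq ▸ Submodule.subset_span hzX)
    have := finiteDimensional_span hX
    have hDX' : D ≤ X' := fun y hy => ⟨hD.1 hy, hf (Submodule.subset_span hy)⟩
    obtain ⟨κ, hκ, hκ', 𝔠, x, Q⟩ := ih _ (hd ▸ Submodule.finrank_lt_finrank_of_lt hlt)
      (fg_of_le hX inf_le_left) ⟨hDX', fun y hy hys => hD.2 y hy.1 hys⟩ rfl
    have hc0 : c ≠ 0 := by rintro rfl; simp at hc
    have R : IsPseudoBasis (idealSMul 𝔢 c) (fun _ : Unit => 𝔢) (fun _ : Unit => c) :=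
      ⟨fun _ => h𝔢, LinearIndependent.of_subsingleton () hc0, by simp⟩
    have S := Q.sup R (by
      rw [← Q.span_eq, Set.range_const, Submodule.disjoint_span_singleton' hc0]
      intro hmem
      have h2 : f c = 0 := hker hmem
      rw [hc] at h2
      exact one_ne_zero h2)
    rw [← hX'] at S
    refine ⟨κ ⊕ Unit, inferInstance, inferInstance, Sum.elim 𝔠 fun _ => 𝔢, Sum.elim x fun _ => c,
      ?_⟩
    have T := S.reindex (Equiv.sumAssoc ι κ Unit).symm
    convert T using 1
    · funext i; rcases i with i | i | i <;> rfl
    · funext i; rcases i with i | i | i <;> rfl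

theorem exists_isPseudoBasis {X : Submodule (𝓞 K) E} (hX : X.FG) :
    ∃ (n : ℕ) (𝔞 : Fin n → FractionalIdeal (𝓞 K)⁰ K) (b : Fin n → E), IsPseudoBasis X 𝔞 b :=
  let ⟨P⟩ := PseudoBasis.nonempty X hX
  ⟨P.rk, P.ideal, P.vec, P.isPseudoBasis⟩

/-- A primitive submodule is a direct summand: there is a `K`-linear retraction onto it. -/
theorem IsPrim.exists_retraction {X D : Submodule (𝓞 K) E} (hX : X.FG) (hD : IsPrim X D) :
    ∃ p : E →ₗ[K] E, (∀ x ∈ X, p x ∈ D) ∧ ∀ x ∈ Submodule.span K (D : Set E), p x = x := by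
  obtain ⟨n, 𝔞, b, P⟩ := exists_isPseudoBasis (fg_of_le hX hD.1)
  obtain ⟨κ, _, _, 𝔠, x, Q⟩ := P.exists_extend hX hD
  obtain ⟨g, hg⟩ := (Module.Basis.span Q.linearIndependent |>.constr K (Sum.elim b 0)).exists_extend
  have hgv : ∀ i, g (Sum.elim b x i) = Sum.elim b (0 : κ → E) i := by
    intro i
    have h1 := LinearMap.congr_fun hg (Module.Basis.span Q.linearIndependent i)
    rw [Module.Basis.constr_basis, LinearMap.comp_apply, Submodule.subtype_apply,
      Module.Basis.span_apply] at h1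
    exact h1
  refine ⟨g, fun y hy => ?_, fun y hy => ?_⟩
  · obtain ⟨c, hc, rfl⟩ := Q.mem_iff.1 hy
    rw [map_sum, Fintype.sum_sum_type]
    simp only [map_smul, hgv]
    exact P.mem_iff.2 ⟨fun i => c (Sum.inl i), fun i => hc (Sum.inl i), by simp⟩
  · rw [P.span_eq] at hy
    obtain ⟨c, rfl⟩ := (Submodule.mem_span_range_iff_exists_fun K).1 hy
    rw [map_sum]
    refine Finset.sum_congr rfl fun i _ => ?_
    rw [map_smul]
    exact congrArg _ (hgv (Sum.inl i))

theorem vol_pos (h : HermitianFamily K E) {X : Submodule (𝓞 K) E} (hX : X.FG) : 0 < vol h X := by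
  obtain ⟨n, 𝔞, b, P⟩ := exists_isPseudoBasis hX
  rw [P.vol_eq h]
  exact P.pseudoVol_pos h

/-- Volumes decrease when a module is enlarged inside its `K`-span. -/
theorem vol_anti (h : HermitianFamily K E) {X Y : Submodule (𝓞 K) E} (hY : Y.FG) (hXY : X ≤ Y)
    (hs : Submodule.span K (X : Set E) = Submodule.span K (Y : Set E)) : vol h Y ≤ vol h X := by
  obtain ⟨n, 𝔞, b, P⟩ := exists_isPseudoBasis (fg_of_le hY hXY)
  obtain ⟨m, 𝔠, d, Q⟩ := exists_isPseudoBasis hY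
  have hnm : n = m := by
    have h1 := P.finrank_eq
    rw [hs, Q.finrank_eq, Fintype.card_fin, Fintype.card_fin] at h1
    exact h1.symm
  subst hnm
  rw [P.vol_eq h, Q.vol_eq h]
  exact P.pseudoVol_le Q hXY h

theorem vol_bot (h : HermitianFamily K E) : vol h (⊥ : Submodule (𝓞 K) E) = 1 := by
  have P : IsPseudoBasis (⊥ : Submodule (𝓞 K) E)
      (Empty.elim : Empty → FractionalIdeal (𝓞 K)⁰ K) Empty.elim :=
    ⟨fun i => i.elim, linearIndependent_empty_type, by rw [iSup_of_empty]⟩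
  rw [P.vol_eq h]
  simp [pseudoVol, archVol, gramDet]

theorem archVol_submodular [FiniteDimensional K E] {ι κ τ : Type*} [Fintype ι] [DecidableEq ι]
    [Fintype κ] [DecidableEq κ] [Fintype τ] [DecidableEq τ] (h : HermitianFamily K E)
    (b : ι → E) (x : κ → E) (y : τ → E) :
    archVol h (Sum.elim (Sum.elim b x) y) * archVol h b ≤
      archVol h (Sum.elim b x) * archVol h (Sum.elim b y) := by
  unfold archVol
  rw [← Finset.prod_mul_distrib, ← Finset.prod_mul_distrib]
  refine Finset.prod_le_prod (fun v _ => mul_nonneg (Real.rpow_nonneg (gramDet_nonneg _ _) _)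
    (Real.rpow_nonneg (gramDet_nonneg _ _) _)) fun v _ => ?_
  rw [← Real.mul_rpow (gramDet_nonneg _ _) (gramDet_nonneg _ _),
    ← Real.mul_rpow (gramDet_nonneg _ _) (gramDet_nonneg _ _)]
  refine Real.rpow_le_rpow (mul_nonneg (gramDet_nonneg _ _) (gramDet_nonneg _ _)) ?_ (by positivity)
  have := gramDet_submodular (h v) (fun i => (1 : CAt v) ⊗ₜ[K] b i) (fun i => (1 : CAt v) ⊗ₜ[K] x i)
    (fun i => (1 : CAt v) ⊗ₜ[K] y i)
  convert this using 3
  · funext i; rcases i with (i | i) | i <;> rfl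
  · funext i; rcases i with i | i <;> rfl
  · funext i; rcases i with i | i <;> rfl

/-- Submodularity of the volume. -/
theorem vol_submodular [FiniteDimensional K E] (h : HermitianFamily K E)
    {L X Y : Submodule (𝓞 K) E} (hL : L.FG) (hX : IsPrim L X) (hY : IsPrim L Y) :
    vol h (X ⊔ Y) * vol h (X ⊓ Y) ≤ vol h X * vol h Y := by
  obtain ⟨n, 𝔞, b, P⟩ := exists_isPseudoBasis (fg_of_le hL (inf_le_left.trans hX.1 : X ⊓ Y ≤ L))
  obtain ⟨κ, _, _, 𝔠, x, Q⟩ := P.exists_extend (fg_of_le hL hX.1) ⟨inf_le_left, fun z hz hzs =>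
    ⟨hz, hY.2 z (hX.1 hz) (Submodule.span_mono (fun _ hw => hw.2) hzs)⟩⟩
  obtain ⟨τ, _, _, 𝔡, y, R⟩ := P.exists_extend (fg_of_le hL hY.1) ⟨inf_le_right, fun z hz hzs =>
    ⟨hX.2 z (hY.1 hz) (Submodule.span_mono (fun _ hw => hw.1) hzs), hz⟩⟩
  have hRi := linearIndependent_sum.1 R.linearIndependent
  have R' : IsPseudoBasis (⨆ i, idealSMul (𝔡 i) (y i)) 𝔡 y :=
    ⟨fun i => R.ideal_ne_zero (Sum.inr i), hRi.2.1, rfl⟩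
  have hdis : Disjoint (Submodule.span K (Set.range (Sum.elim b x)))
      (Submodule.span K (Set.range y)) := by
    rw [Submodule.disjoint_def]
    intro z hz hzy
    rw [← Q.span_eq] at hz
    have hzY : z ∈ Submodule.span K (Y : Set E) := by
      rw [R.span_eq]
      refine Submodule.span_mono ?_ hzy
      rintro _ ⟨i, rfl⟩
      exact ⟨Sum.inr i, rfl⟩
    obtain ⟨a, ha, haz⟩ := exists_smul_mem_of_mem_span _ hz
    obtain ⟨a', ha', haz'⟩ := exists_smul_mem_of_mem_span _ hzY
    have hD : (a * a') • z ∈ X ⊓ Y := by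
      refine ⟨?_, ?_⟩
      · rw [mul_comm, mul_smul]; exact X.smul_mem _ haz
      · rw [mul_smul]; exact Y.smul_mem _ haz'
    have hne : algebraMap (𝓞 K) K (a * a') ≠ 0 := by simpa using ⟨ha, ha'⟩
    have h1 : (algebraMap (𝓞 K) K (a * a')) • z ∈ Submodule.span K (Set.range b) := by
      rw [← P.span_eq, algebraMap_smul]
      exact Submodule.subset_span hD
    have h2 : (algebraMap (𝓞 K) K (a * a')) • z = 0 :=
      Submodule.disjoint_def.1 hRi.2.2 _ h1 (Submodule.smul_mem _ _ hzy)
    exact (smul_eq_zero.1 h2).resolve_left hne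
  have S := Q.sup R' hdis
  have hsup : X ⊔ (⨆ i, idealSMul (𝔡 i) (y i)) = X ⊔ Y := by
    have hYe : Y = (X ⊓ Y) ⊔ ⨆ i, idealSMul (𝔡 i) (y i) := by
      conv_lhs => rw [R.eq_iSup, iSup_sum]
      rw [P.eq_iSup]; rfl
    conv_rhs => rw [hYe]
    rw [← sup_assoc, sup_inf_self]
  rw [hsup] at S
  rw [P.vol_eq h, Q.vol_eq h, R.vol_eq h, S.vol_eq h]
  unfold pseudoVol
  have h1 := archVol_submodular h b x y
  simp only [Fintype.prod_sum_type, Sum.elim_inl, Sum.elim_inr, map_mul, Rat.cast_mul]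
  have ha : (0 : ℝ) ≤ (FractionalIdeal.absNorm (∏ i, 𝔞 i) : ℝ) := by
    exact_mod_cast FractionalIdeal.absNorm_nonneg _
  have hx : (0 : ℝ) ≤ (FractionalIdeal.absNorm (∏ i, 𝔠 i) : ℝ) := by
    exact_mod_cast FractionalIdeal.absNorm_nonneg _
  have hy : (0 : ℝ) ≤ (FractionalIdeal.absNorm (∏ i, 𝔡 i) : ℝ) := by
    exact_mod_cast FractionalIdeal.absNorm_nonneg _
  have := mul_le_mul_of_nonneg_left h1 (mul_nonneg (mul_nonneg ha ha) (mul_nonneg hx hy))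
  linarith

/-- Let `E` be decomposed by means of `π₁ + π₂ = 1` into two subspaces that are orthogonal at all
the infinite places, and let the `K`-span of `N` be compatible with the decomposition. Then the
volume of `N` is the product of the volumes of the kernel and of the image of `π₂` on `N`. -/
theorem vol_eq_mul_of_orthogonal (h : HermitianFamily K E) {N : Submodule (𝓞 K) E} (hN : N.FG)
    (π₁ π₂ : E →ₗ[K] E) (hπ : ∀ x, π₁ x + π₂ x = x)
    (ho : ∀ v x y, (h v).inner (1 ⊗ₜ[K] π₁ x) (1 ⊗ₜ[K] π₂ y) = 0)
    (hgr : ∀ x ∈ N, π₁ x ∈ Submodule.span K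
      ((N ⊓ (LinearMap.ker π₂).restrictScalars (𝓞 K) : Submodule (𝓞 K) E) : Set E)) :
    vol h N = vol h (N ⊓ (LinearMap.ker π₂).restrictScalars (𝓞 K)) *
      vol h (N.map (π₂.restrictScalars (𝓞 K))) ∧
    latticeRank N = latticeRank (N ⊓ (LinearMap.ker π₂).restrictScalars (𝓞 K)) +
      latticeRank (N.map (π₂.restrictScalars (𝓞 K))) := by
  set D : Submodule (𝓞 K) E := N ⊓ (LinearMap.ker π₂).restrictScalars (𝓞 K) with hdef
  obtain ⟨n, 𝔞, b, P⟩ := exists_isPseudoBasis (fg_of_le hN (inf_le_left : D ≤ N))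
  obtain ⟨κ, _, _, 𝔠, x, Q⟩ := P.exists_extend hN (isPrim_inf_restrictScalars N _)
  have hb2 : ∀ i, π₂ (b i) = 0 := by
    intro i
    have h1 : Submodule.span K (D : Set E) ≤ LinearMap.ker π₂ :=
      Submodule.span_le.2 fun y hy => hy.2
    exact h1 (P.span_eq ▸ Submodule.subset_span (Set.mem_range_self i))
  have hb1 : ∀ i, π₁ (b i) = b i := fun i => by
    have := hπ (b i); rwa [hb2, add_zero] at this
  have hx1 : ∀ k, π₁ (x k) ∈ Submodule.span K (Set.range b) := by
    intro k
    rw [← P.span_eq]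
    obtain ⟨a, ha, ha0⟩ := exists_mem_ne_zero (Q.ideal_ne_zero (Sum.inr k))
    have h1 := hgr _ (Q.smul_mem ha)
    rw [map_smul] at h1
    have h2 := Submodule.smul_mem _ a⁻¹ h1
    rwa [smul_smul, inv_mul_cancel₀ ha0, one_smul] at h2
  have hQi := linearIndependent_sum.1 Q.linearIndependent
  have R : IsPseudoBasis (N.map (π₂.restrictScalars (𝓞 K))) 𝔠 (fun k => π₂ (x k)) := by
    refine ⟨fun k => Q.ideal_ne_zero (Sum.inr k), ?_, ?_⟩
    · rw [Fintype.linearIndependent_iff]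
      intro c hc
      have h1 : ∑ k, c k • x k ∈ Submodule.span K (Set.range b) := by
        have : ∑ k, c k • x k = ∑ k, c k • π₁ (x k) := by
          rw [← add_zero (∑ k, c k • π₁ (x k)), ← hc, ← Finset.sum_add_distrib]
          refine Finset.sum_congr rfl fun k _ => ?_
          rw [← smul_add, hπ]
        rw [this]
        exact Submodule.sum_mem _ fun k _ => Submodule.smul_mem _ _ (hx1 k)
      have h2 := Submodule.disjoint_def.1 hQi.2.2 _ h1 (Submodule.sum_mem _ fun k _ =>
        Submodule.smul_mem _ _ (Submodule.subset_span (Set.mem_range_self k)))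
      exact Fintype.linearIndependent_iff.1 hQi.2.1 c h2
    · rw [Q.eq_iSup, Submodule.map_iSup, iSup_sum]
      have hmap : ∀ (I : FractionalIdeal (𝓞 K)⁰ K) (y : E),
          (idealSMul I y).map (π₂.restrictScalars (𝓞 K)) = idealSMul I (π₂ y) := by
        intro I y
        ext z
        simp [Submodule.mem_map, mem_idealSMul]
      have h0 : ⨆ i, idealSMul (𝔞 i) (0 : E) = ⊥ := by
        rw [eq_bot_iff]
        refine iSup_le fun i z hz => ?_
        obtain ⟨a, -, rfl⟩ := mem_idealSMul.1 hz
        simp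
      simp only [hmap, Sum.elim_inl, Sum.elim_inr, hb2, h0, bot_sup_eq]
  refine ⟨?_, by rw [latticeRank, latticeRank, latticeRank, P.finrank_eq, Q.finrank_eq,
    R.finrank_eq, Fintype.card_sum]⟩
  rw [P.vol_eq h, Q.vol_eq h, R.vol_eq h]
  unfold pseudoVol
  have harch : archVol h (Sum.elim b x) = archVol h b * archVol h fun k => π₂ (x k) := by
    unfold archVol
    rw [← Finset.prod_mul_distrib]
    refine Finset.prod_congr rfl fun v _ => ?_
    rw [← Real.mul_rpow (gramDet_nonneg _ _) (gramDet_nonneg _ _)]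
    congr 1
    rw [← gramDet_sumElim (h v) (fun i => (1 : CAt v) ⊗ₜ[K] b i) (fun k => (1 : CAt v) ⊗ₜ[K] x k)]
    · congr 1
      funext i; rcases i with i | i <;> rfl
    · intro k
      rw [← TensorProduct.tmul_sub, sub_eq_of_eq_add (hπ (x k)).symm]
      obtain ⟨c, hc⟩ := (Submodule.mem_span_range_iff_exists_fun K).1 (hx1 k)
      rw [← hc, TensorProduct.tmul_sum]
      refine Submodule.sum_mem _ fun i _ => ?_
      rw [TensorProduct.tmul_smul, ← algebraMap_smul (CAt v) (c i)]
      exact Submodule.smul_mem _ _ (Submodule.subset_span (Set.mem_range_self i))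
    · intro i k
      rw [← hb1 i]
      exact ho v _ _
  rw [harch]
  simp only [Fintype.prod_sum_type, Sum.elim_inl, Sum.elim_inr, map_mul, Rat.cast_mul]
  ring

end Primitive

section Tensor

variable {K E F : Type*} [Field K] [NumberField K] [AddCommGroup E] [Module K E]
  [Module (𝓞 K) E] [IsScalarTower (𝓞 K) K E] [AddCommGroup F] [Module K F]
  [Module (𝓞 K) F] [IsScalarTower (𝓞 K) K F]

/-- The image of `X ⊗ Y` in `E ⊗ F`. -/
def tensorSub (X : Submodule (𝓞 K) E) (Y : Submodule (𝓞 K) F) : Submodule (𝓞 K) (E ⊗[K] F) :=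
  Submodule.map₂ ((TensorProduct.mk K E F).restrictScalars₁₂ (𝓞 K) (𝓞 K)) X Y

theorem tmul_mem_tensorSub {X : Submodule (𝓞 K) E} {Y : Submodule (𝓞 K) F} {x : E} {y : F}
    (hx : x ∈ X) (hy : y ∈ Y) : x ⊗ₜ[K] y ∈ tensorSub X Y :=
  Submodule.apply_mem_map₂ _ hx hy

theorem tensorSub_le {X : Submodule (𝓞 K) E} {Y : Submodule (𝓞 K) F}
    {Z : Submodule (𝓞 K) (E ⊗[K] F)} :
    tensorSub X Y ≤ Z ↔ ∀ x ∈ X, ∀ y ∈ Y, x ⊗ₜ[K] y ∈ Z :=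
  Submodule.map₂_le

theorem tensorSub_idealSMul (I J : FractionalIdeal (𝓞 K)⁰ K) (x : E) (y : F) :
    tensorSub (idealSMul I x) (idealSMul J y) = idealSMul (I * J) (x ⊗ₜ[K] y) := by
  apply le_antisymm
  · rw [tensorSub_le]
    intro z hz w hw
    obtain ⟨a, ha, rfl⟩ := mem_idealSMul.1 hz
    obtain ⟨c, hc, rfl⟩ := mem_idealSMul.1 hw
    exact mem_idealSMul.2 ⟨a * c, FractionalIdeal.mul_mem_mul ha hc,
      (TensorProduct.smul_tmul_smul a c x y).symm⟩
  · intro z hz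
    obtain ⟨a, ha, rfl⟩ := mem_idealSMul.1 hz
    refine FractionalIdeal.mul_induction_on ha ?_ ?_
    · intro i hi j hj
      rw [← TensorProduct.smul_tmul_smul]
      exact tmul_mem_tensorSub (mem_idealSMul.2 ⟨i, hi, rfl⟩) (mem_idealSMul.2 ⟨j, hj, rfl⟩)
    · intro a c ha hc
      rw [add_smul]
      exact add_mem ha hc

theorem IsPseudoBasis.tensor {ι κ : Type*} {X : Submodule (𝓞 K) E} {Y : Submodule (𝓞 K) F}
    {𝔞 : ι → FractionalIdeal (𝓞 K)⁰ K} {b : ι → E} (P : IsPseudoBasis X 𝔞 b)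
    {𝔠 : κ → FractionalIdeal (𝓞 K)⁰ K} {d : κ → F} (Q : IsPseudoBasis Y 𝔠 d) :
    IsPseudoBasis (tensorSub X Y) (fun i : ι × κ => 𝔞 i.1 * 𝔠 i.2)
      (fun i : ι × κ => b i.1 ⊗ₜ[K] d i.2) where
  ideal_ne_zero i := mul_ne_zero (P.ideal_ne_zero _) (Q.ideal_ne_zero _)
  linearIndependent := P.linearIndependent.tmul_of_flat_left Q.linearIndependent
  eq_iSup := by
    have h1 := P.eq_iSup
    have h2 := Q.eq_iSup
    rw [tensorSub, h1, h2, Submodule.map₂_iSup_left]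
    simp_rw [Submodule.map₂_iSup_right]
    rw [iSup_prod]
    exact iSup_congr fun i => iSup_congr fun j => tensorSub_idealSMul _ _ _ _

theorem archVol_tensor {ι κ : Type*} [Fintype ι] [DecidableEq ι] [Fintype κ] [DecidableEq κ]
    (h : HermitianFamily K E) (h' : HermitianFamily K F) (b : ι → E) (d : κ → F) :
    archVol (fun v => tensorCore v (h v) (h' v)) (fun i : ι × κ => b i.1 ⊗ₜ[K] d i.2) =
      archVol h b ^ Fintype.card κ * archVol h' d ^ Fintype.card ι := by
  unfold archVol
  rw [← Finset.prod_pow, ← Finset.prod_pow, ← Finset.prod_mul_distrib]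
  refine Finset.prod_congr rfl fun v _ => ?_
  have key : gramDet (tensorCore v (h v) (h' v))
      (fun i : ι × κ => (1 : CAt v) ⊗ₜ[K] (b i.1 ⊗ₜ[K] d i.2)) =
      gramDet (h v) (fun i => (1 : CAt v) ⊗ₜ[K] b i) ^ Fintype.card κ *
        gramDet (h' v) (fun i => (1 : CAt v) ⊗ₜ[K] d i) ^ Fintype.card ι := by
    apply RCLike.ofReal_injective (K := CAt v)
    rw [RCLike.ofReal_mul, RCLike.ofReal_pow, RCLike.ofReal_pow, ofReal_gramDet, ofReal_gramDet,
      ofReal_gramDet, ← Matrix.det_kronecker]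
    rfl
  rw [key, Real.mul_rpow (pow_nonneg (gramDet_nonneg _ _) _) (pow_nonneg (gramDet_nonneg _ _) _),
    ← Real.rpow_natCast, ← Real.rpow_natCast, ← Real.rpow_natCast, ← Real.rpow_natCast,
    ← Real.rpow_mul (gramDet_nonneg _ _), ← Real.rpow_mul (gramDet_nonneg _ _),
    ← Real.rpow_mul (gramDet_nonneg _ _), ← Real.rpow_mul (gramDet_nonneg _ _), mul_comm (_ / 2),
    mul_comm (_ / 2)]

/-- The volume of a tensor product. -/
theorem vol_tensorSub (h : HermitianFamily K E) (h' : HermitianFamily K F)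
    {X : Submodule (𝓞 K) E} {Y : Submodule (𝓞 K) F} (hX : X.FG) (hY : Y.FG) :
    vol (fun v => tensorCore v (h v) (h' v)) (tensorSub X Y) =
      vol h X ^ Module.finrank K (Submodule.span K (Y : Set F)) *
        vol h' Y ^ Module.finrank K (Submodule.span K (X : Set E)) := by
  obtain ⟨n, 𝔞, b, P⟩ := exists_isPseudoBasis hX
  obtain ⟨m, 𝔠, d, Q⟩ := exists_isPseudoBasis hY
  rw [(P.tensor Q).vol_eq, P.vol_eq h, Q.vol_eq h', P.finrank_eq, Q.finrank_eq]
  unfold pseudoVol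
  rw [archVol_tensor, Finset.prod_mul_distrib, Fintype.prod_prod_type, Fintype.prod_prod_type]
  simp only [Finset.prod_const, Finset.card_univ, map_mul, map_pow, Finset.prod_pow, Rat.cast_mul,
    Rat.cast_pow]
  ring

end Tensor

/-! ### Finiteness of the submodules of bounded volume -/

section Plucker

variable {K E : Type*} [Field K] [AddCommGroup E] [Module K E] {m n : ℕ}

/-- The Plücker coordinates of the family `b`: the minors of its matrix of coordinates. They are
indexed by arbitrary maps `Fin n → Fin m`, not only by the increasing ones. -/
def plucker (e : Module.Basis (Fin m) K E) (b : Fin n → E) (I : Fin n → Fin m) : K :=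
  (Matrix.of fun i k => e.coord (I k) (b i)).det

/-- Vectors spanning the subspace with Plücker coordinates `w`, when `w I ≠ 0`. -/
def pluckerVec (e : Module.Basis (Fin m) K E) (w : (Fin n → Fin m) → K) (I : Fin n → Fin m)
    (k : Fin n) : E :=
  ∑ j, w (Function.update I k j) • e j

/-- A matrix with independent rows has an invertible square submatrix of full size. -/
theorem exists_plucker_ne_zero (e : Module.Basis (Fin m) K E) {b : Fin n → E}
    (hb : LinearIndependent K b) : ∃ I, plucker e b I ≠ 0 := by
  let B : Matrix (Fin n) (Fin m) K := Matrix.of fun i j => e.coord j (b i)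
  have hB : LinearIndependent K B.row :=
    hb.map' e.equivFun.toLinearMap e.equivFun.ker
  have hrank : B.rank = n := by
    have := hB.rank_matrix
    simpa using this
  have hcol : Submodule.span K (Set.range B.col) = ⊤ := by
    apply Submodule.eq_top_of_finrank_eq
    rw [← Matrix.rank_eq_finrank_span_cols, hrank, Module.finrank_fin_fun]
  obtain ⟨κ, a, -, hspan, hli⟩ := exists_linearIndependent' K B.col
  rw [hcol] at hspan
  let c := Module.Basis.mk hli hspan.ge
  have hκ : Fintype κ := FiniteDimensional.fintypeBasisIndex c
  have hcard : Fintype.card κ = n := by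
    rw [← Module.finrank_eq_card_basis c, Module.finrank_fin_fun]
  let f : Fin n ≃ κ := (Fintype.equivFinOfCardEq hcard).symm
  refine ⟨a ∘ f, ?_⟩
  have h1 : LinearIndependent K (fun k => B.col (a (f k))) := hli.comp f f.injective
  have h2 : IsUnit (Matrix.of fun i k => e.coord ((a ∘ f) k) (b i)) :=
    Matrix.linearIndependent_cols_iff_isUnit.1 h1
  exact ((Matrix.isUnit_iff_isUnit_det _).1 h2).ne_zero

/-- The Plücker coordinates, known up to a common factor, determine the subspace. -/
theorem span_range_eq_span_pluckerVec (e : Module.Basis (Fin m) K E) {b : Fin n → E}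
    (hb : LinearIndependent K b) {w : (Fin n → Fin m) → K} {c : K}
    (hw : ∀ I, w I = c * plucker e b I) {I : Fin n → Fin m} (hI : w I ≠ 0) :
    Submodule.span K (Set.range b) = Submodule.span K (Set.range (pluckerVec e w I)) := by
  have := Module.Finite.of_basis e
  refine Submodule.eq_of_le_of_finrank_le ?_ ?_
  · rw [Submodule.span_le]
    rintro _ ⟨i, rfl⟩
    let D : Matrix (Fin n) (Fin n) K := Matrix.of fun i k => e.coord (I k) (b i)
    -- Cramer's rule for the minor `D` with column set `I`.
    have hcr : ∀ j, ∑ k, D i k * w (Function.update I k j) = w I * e.coord j (b i) := by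
      intro j
      have h1 := congrFun (Matrix.mulVec_cramer D fun i => e.coord j (b i)) i
      simp only [Matrix.mulVec, dotProduct, Matrix.cramer_apply, Pi.smul_apply, smul_eq_mul] at h1
      have h2 : ∀ k, plucker e b (Function.update I k j) =
          (D.updateCol k fun i => e.coord j (b i)).det := by
        intro k
        unfold plucker
        congr 1
        ext x y
        rw [Matrix.updateCol_apply, Matrix.of_apply, Function.update_apply]
        split_ifs <;> rfl
      rw [hw I, mul_assoc]
      change _ = c * (D.det * _)
      rw [← h1, Finset.mul_sum]
      refine Finset.sum_congr rfl fun k _ => ?_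
      rw [hw, h2]; ring
    have h3 : w I • b i = ∑ k, D i k • pluckerVec e w I k := by
      unfold pluckerVec
      simp_rw [Finset.smul_sum, smul_smul]
      rw [Finset.sum_comm]
      simp_rw [← Finset.sum_smul, hcr, mul_smul, ← Finset.smul_sum]
      congr 1
      exact (e.sum_repr (b i)).symm
    have h4 : b i = (w I)⁻¹ • ∑ k, D i k • pluckerVec e w I k := by
      rw [← h3, smul_smul, inv_mul_cancel₀ hI, one_smul]
    rw [SetLike.mem_coe, h4]
    exact Submodule.smul_mem _ _ (Submodule.sum_mem _ fun k _ =>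
      Submodule.smul_mem _ _ (Submodule.subset_span (Set.mem_range_self k)))
  · rw [finrank_span_eq_card hb]
    exact finrank_range_le_card _

end Plucker

section Finiteness

variable {K E : Type*} [Field K] [NumberField K] [AddCommGroup E] [Module K E]
  [Module (𝓞 K) E] [IsScalarTower (𝓞 K) K E]

open mixedEmbedding in
/-- Minkowski's theorem: a fractional ideal contains an element whose absolute values are
controlled by given weights `t`. -/
theorem exists_mem_fractionalIdeal_lt (K : Type*) [Field K] [NumberField K] (C : ℝ) :
    ∃ s : ℝ, ∀ (A : FractionalIdeal (𝓞 K)⁰ K) (t : InfinitePlace K → ℝ), A ≠ 0 → (∀ v, 0 < t v) →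
      (FractionalIdeal.absNorm A : ℝ) * ∏ v, t v ^ v.mult ≤ C →
      ∃ a ∈ A, a ≠ 0 ∧ ∀ v : InfinitePlace K, v a * t v < s := by
  classical
  obtain ⟨κ, hκ⟩ : ∃ κ : NNReal, ∀ I : (FractionalIdeal (𝓞 K)⁰ K)ˣ,
      minkowskiBound K I = ENNReal.ofReal (FractionalIdeal.absNorm I.1) * κ := by
    have h1 : MeasureTheory.volume (ZSpan.fundamentalDomain (latticeBasis K)) *
        (2 : ENNReal) ^ (Module.finrank ℝ (mixedSpace K)) < ⊤ :=
      ENNReal.mul_lt_top (ZSpan.fundamentalDomain_isBounded _).measure_lt_top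
        (ENNReal.pow_lt_top ENNReal.ofNat_lt_top)
    refine ⟨ENNReal.toNNReal (MeasureTheory.volume (ZSpan.fundamentalDomain (latticeBasis K)) *
        (2 : ENNReal) ^ (Module.finrank ℝ (mixedSpace K))), fun I => ?_⟩
    rw [minkowskiBound, volume_fundamentalDomain_fractionalIdealLatticeBasis, mul_assoc,
      ENNReal.coe_toNNReal h1.ne]
  set s : ℝ := max C 0 * κ + 1 with hs
  have hs1 : 1 ≤ s := by
    have : 0 ≤ max C 0 * (κ : ℝ) := by positivity
    linarith
  have hs0 : 0 < s := by linarith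
  refine ⟨s, fun A t hA ht hC => ?_⟩
  let f : InfinitePlace K → NNReal := fun v => ⟨s / t v, (div_pos hs0 (ht v)).le⟩
  have hprod : 0 < ∏ v, t v ^ v.mult := Finset.prod_pos fun v _ => pow_pos (ht v) _
  have hlt : minkowskiBound K (Units.mk0 A hA) < MeasureTheory.volume (convexBodyLT K f) := by
    rw [hκ, convexBodyLT_volume]
    have e1 : ENNReal.ofReal (FractionalIdeal.absNorm A : ℝ) * κ =
        ENNReal.ofReal ((FractionalIdeal.absNorm A : ℝ) * κ) := by
      rw [ENNReal.ofReal_mul' κ.coe_nonneg, ENNReal.ofReal_coe_nnreal]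
    have e2 : ((convexBodyLTFactor K : NNReal) : ENNReal) *
        ((∏ w, f w ^ w.mult : NNReal) : ENNReal) =
        ENNReal.ofReal ((convexBodyLTFactor K : ℝ) * ∏ w, (s / t w) ^ w.mult) := by
      rw [← ENNReal.coe_mul, ← ENNReal.ofReal_coe_nnreal]
      congr 1
      push_cast
      rfl
    rw [Units.val_mk0, e1, e2]
    have hpos : 0 < ∏ w, (s / t w) ^ w.mult :=
      Finset.prod_pos fun v _ => pow_pos (div_pos hs0 (ht v)) _
    have hfac : (1 : ℝ) ≤ convexBodyLTFactor K := by exact_mod_cast one_le_convexBodyLTFactor K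
    rw [ENNReal.ofReal_lt_ofReal_iff (by positivity)]
    have h2 : ∏ w, (s / t w) ^ w.mult = s ^ Module.finrank ℚ K / ∏ v, t v ^ v.mult := by
      rw [← InfinitePlace.sum_mult_eq, ← Finset.prod_pow_eq_pow_sum, ← Finset.prod_div_distrib]
      simp_rw [div_pow]
    have h3 : s ≤ s ^ Module.finrank ℚ K :=
      le_self_pow₀ hs1 (Module.finrank_pos).ne'
    calc (FractionalIdeal.absNorm A : ℝ) * κ
        ≤ C / (∏ v, t v ^ v.mult) * κ := by
          gcongr
          rwa [le_div_iff₀ hprod]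
      _ ≤ (max C 0 * κ) / (∏ v, t v ^ v.mult) := by
          rw [div_mul_eq_mul_div]
          gcongr
          exact le_max_left _ _
      _ < s ^ Module.finrank ℚ K / ∏ v, t v ^ v.mult := by
          gcongr
          linarith
      _ = 1 * ∏ w, (s / t w) ^ w.mult := by rw [h2, one_mul]
      _ ≤ _ := by gcongr
  obtain ⟨a, ha, ha0, hav⟩ := exists_ne_zero_mem_ideal_lt K (Units.mk0 A hA) hlt
  refine ⟨a, ha, ha0, fun v => ?_⟩
  have := hav v
  exact (lt_div_iff₀ (ht v)).1 this

/-- At every place the Plücker coordinates are bounded by the Gram determinant, uniformly in the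
family `b`. -/
theorem exists_gramDet_ge {m n : ℕ} [FiniteDimensional K E] (h : HermitianFamily K E)
    (e : Module.Basis (Fin m) K E) : ∃ ε : ℝ, 0 < ε ∧ ∀ (v : InfinitePlace K) (b : Fin n → E)
      (I : Fin n → Fin m),
      ε * v (plucker e b I) ^ 2 ≤ gramDet (h v) (fun i => (1 : CAt v) ⊗ₜ[K] b i) := by
  have key : ∀ (v : InfinitePlace K) (I : Fin n → Fin m), ∃ δ : ℝ, 0 < δ ∧ ∀ b : Fin n → E,
      δ * v (plucker e b I) ^ 2 ≤ gramDet (h v) (fun i => (1 : CAt v) ⊗ₜ[K] b i) := by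
    intro v I
    let f : CAt v ⊗[K] E →ₗ[CAt v] (Fin n → CAt v) := LinearMap.pi fun k =>
      (TensorProduct.AlgebraTensorModule.rid K (CAt v) (CAt v)).toLinearMap ∘ₗ
        (e.coord (I k)).baseChange (CAt v)
    obtain ⟨δ, hδ, hf⟩ := exists_le_gramDet (h v) f
    refine ⟨δ, hδ, fun b => ?_⟩
    have h1 := hf fun i => (1 : CAt v) ⊗ₜ[K] b i
    have h2 : (Matrix.of fun i => f ((1 : CAt v) ⊗ₜ[K] b i)) =
        (Matrix.of fun i k => e.coord (I k) (b i)).map (algebraMap K (CAt v)) := by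
      ext i k
      simp [f, Algebra.smul_def]
    rw [h2, ← RingHom.mapMatrix_apply, ← RingHom.map_det] at h1
    have h3 : ‖algebraMap K (CAt v) (plucker e b I)‖ = v (plucker e b I) :=
      InfinitePlace.norm_embedding_eq v _
    rw [← h3]
    exact h1
  choose δ hδ hle using key
  by_cases hne : Nonempty (InfinitePlace K × (Fin n → Fin m))
  · obtain ⟨x, -, hx⟩ := Finset.exists_min_image (Finset.univ : Finset (InfinitePlace K ×
      (Fin n → Fin m))) (fun x => δ x.1 x.2) Finset.univ_nonempty
    refine ⟨δ x.1 x.2, hδ _ _, fun v b I => le_trans ?_ (hle v I b)⟩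
    exact mul_le_mul_of_nonneg_right (hx (v, I) (Finset.mem_univ _)) (by positivity)
  · exact ⟨1, one_pos, fun v b I => (hne ⟨(v, I)⟩).elim⟩

/-- The coordinates of the elements of a finitely generated module have a common denominator. -/
theorem exists_denominator {m : ℕ} (e : Module.Basis (Fin m) K E) {X : Submodule (𝓞 K) E}
    (hX : X.FG) : ∃ d : 𝓞 K, d ≠ 0 ∧ ∀ x ∈ X, ∀ j, ∃ y : 𝓞 K,
      algebraMap (𝓞 K) K y = algebraMap (𝓞 K) K d * e.coord j x := by
  classical
  obtain ⟨S, rfl⟩ := hX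
  obtain ⟨d, hd⟩ := IsLocalization.exist_integer_multiples_of_finset (𝓞 K)⁰
    ((S ×ˢ (Finset.univ : Finset (Fin m))).image fun x => e.coord x.2 x.1)
  refine ⟨d, nonZeroDivisors.ne_zero d.2, fun x hx j => ?_⟩
  induction hx using Submodule.span_induction with
  | mem x hx =>
    obtain ⟨y, hy⟩ := hd (e.coord j x) (Finset.mem_image.2 ⟨(x, j), by simpa using hx, rfl⟩)
    exact ⟨y, by rw [hy, Algebra.smul_def]⟩
  | zero => exact ⟨0, by simp⟩
  | add x y _ _ hx hy =>
    obtain ⟨a, ha⟩ := hx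
    obtain ⟨c, hc⟩ := hy
    exact ⟨a + c, by rw [map_add, ha, hc, map_add]; ring⟩
  | smul c x _ hx =>
    obtain ⟨a, ha⟩ := hx
    refine ⟨c * a, ?_⟩
    rw [map_mul, ha, ← algebraMap_smul K c x, map_smul, smul_eq_mul]
    ring

/-- There are finitely many primitive submodules of given rank and bounded volume. -/
theorem finite_isPrim_vol_le [FiniteDimensional K E] (h : HermitianFamily K E)
    {X : Submodule (𝓞 K) E} (hX : X.FG) (n : ℕ) (C : ℝ) :
    {N : Submodule (𝓞 K) E | IsPrim X N ∧ Module.finrank K (Submodule.span K (N : Set E)) = n ∧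
      vol h N ≤ C}.Finite := by
  classical
  let e := Module.finBasis K E
  set m := Module.finrank K E
  obtain ⟨ε, hε, hgram⟩ := exists_gramDet_ge (n := n) h e
  obtain ⟨d, hd, hden⟩ := exists_denominator e hX
  obtain ⟨s, hs⟩ := exists_mem_fractionalIdeal_lt K C
  obtain ⟨M, hM⟩ : ∃ M : ℝ, ∀ v : InfinitePlace K, v (algebraMap (𝓞 K) K d ^ n) ≤ M := by
    obtain ⟨M, hM⟩ := (Set.finite_range fun v : InfinitePlace K =>
      v (algebraMap (𝓞 K) K d ^ n)).bddAbove
    exact ⟨M, fun v => hM ⟨v, rfl⟩⟩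
  -- The set that contains the normalized Plücker coordinates.
  let S : Set K := {x : K | IsIntegral ℤ x ∧ ∀ φ : K →+* ℂ, ‖φ x‖ ≤ M * (s / √ε)}
  have hS : S.Finite := Embeddings.finite_of_norm_le K ℂ _
  have key : ∀ N : Submodule (𝓞 K) E, IsPrim X N →
      Module.finrank K (Submodule.span K (N : Set E)) = n → vol h N ≤ C →
      ∃ (w : (Fin n → Fin m) → K), (∀ I, w I ∈ S) ∧ (∃ I, w I ≠ 0) ∧
        ∀ I, w I ≠ 0 →
          Submodule.span K (N : Set E) = Submodule.span K (Set.range (pluckerVec e w I)) := by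
    intro N hN hrk hvol
    obtain ⟨n', 𝔞, b, P⟩ := exists_isPseudoBasis (fg_of_le hX hN.1)
    obtain rfl : n' = n := by rw [← hrk, P.finrank_eq, Fintype.card_fin]
    let t : InfinitePlace K → ℝ := fun v => √(gramDet (h v) fun i => (1 : CAt v) ⊗ₜ[K] b i)
    have ht : ∀ v, 0 < t v := fun v => Real.sqrt_pos.2 (gramDet_pos (h v)
      (Module.Flat.linearIndependent_one_tmul (S := CAt v) P.linearIndependent))
    have htv : pseudoVol h 𝔞 b = (FractionalIdeal.absNorm (∏ i, 𝔞 i) : ℝ) * ∏ v, t v ^ v.mult := by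
      unfold pseudoVol archVol
      congr 1
      refine Finset.prod_congr rfl fun v _ => ?_
      simp only [t]
      rw [← Real.rpow_natCast, Real.sqrt_eq_rpow, ← Real.rpow_mul (gramDet_nonneg _ _)]
      congr 1; ring
    rw [P.vol_eq h, htv] at hvol
    -- Minkowski's theorem for `∏ 𝔞_i`, with the square roots of the Gram determinants as weights.
    obtain ⟨a, ha, ha0, hav⟩ := hs _ t (Finset.prod_ne_zero_iff.2 fun i _ => P.ideal_ne_zero i)
      ht hvol
    have hdK : algebraMap (𝓞 K) K d ≠ 0 := by simpa using hd
    let c : K := algebraMap (𝓞 K) K d ^ n' * a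
    have hc0 : c ≠ 0 := mul_ne_zero (pow_ne_zero _ hdK) ha0
    obtain ⟨I₀, hI₀⟩ := exists_plucker_ne_zero e P.linearIndependent
    refine ⟨fun I => c * plucker e b I, fun I => ⟨?_, fun φ => ?_⟩, ⟨I₀, mul_ne_zero hc0 hI₀⟩,
      fun I hI => ?_⟩
    -- Integrality: `d` times the minor's matrix maps each `𝔞_i` into `𝓞 K`, so that
    -- `d ^ n · plucker e b I` maps `∏ 𝔞_i` into `𝓞 K`.
    · let T : Matrix (Fin n') (Fin n') K :=
        algebraMap (𝓞 K) K d • Matrix.of fun i k => e.coord (I k) (b i)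
      have h1 : FractionalIdeal.spanSingleton (𝓞 K)⁰ T.det * ∏ i, 𝔞 i ≤ ∏ _j : Fin n', 1 := by
        refine spanSingleton_det_mul_prod_le T fun i j x hx => ?_
        obtain ⟨y, hy⟩ := hden _ (hN.1 (P.smul_mem hx)) (I j)
        rw [FractionalIdeal.mem_one_iff]
        refine ⟨y, ?_⟩
        rw [hy, map_smul, smul_eq_mul]
        simp only [T, Matrix.smul_apply, Matrix.of_apply, smul_eq_mul]
        ring
      have h2 := FractionalIdeal.spanSingleton_mul_le_iff.1 h1 a ha
      rw [Finset.prod_const_one, FractionalIdeal.mem_one_iff] at h2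
      obtain ⟨y, hy⟩ := h2
      have h3 : c * plucker e b I = algebraMap (𝓞 K) K y := by
        rw [hy, Matrix.det_smul, Fintype.card_fin]
        simp only [c, plucker]; ring
      change IsIntegral ℤ (c * plucker e b I)
      rw [h3]
      exact RingOfIntegers.isIntegral_coe y
    · have h1 : ‖φ (c * plucker e b I)‖ = InfinitePlace.mk φ (c * plucker e b I) :=
        (InfinitePlace.apply φ _).symm
      set v := InfinitePlace.mk φ
      rw [h1, map_mul, map_mul, mul_assoc]
      have h2 : v (plucker e b I) ≤ t v / √ε := by
        rw [le_div_iff₀ (Real.sqrt_pos.2 hε)]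
        apply Real.le_sqrt_of_sq_le
        rw [mul_pow, Real.sq_sqrt hε.le, mul_comm]
        exact hgram v b I
      refine mul_le_mul (hM v) ?_ (mul_nonneg (apply_nonneg _ _) (apply_nonneg _ _))
        ((apply_nonneg _ _).trans (hM v))
      calc v a * v (plucker e b I) ≤ v a * (t v / √ε) := by
            gcongr
        _ = v a * t v / √ε := by ring
        _ ≤ s / √ε := by
            gcongr
            exact (hav v).le
    · rw [P.span_eq]
      exact span_range_eq_span_pluckerVec e P.linearIndependent (fun _ => rfl) hI
  choose! w hwS hw0 hw using key
  refine Set.Finite.of_injOn (f := w) (t := {f | ∀ I, f I ∈ S}) ?_ ?_ (Set.Finite.pi' fun _ => hS)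
  · rintro N ⟨h1, h2, h3⟩
    exact hwS N h1 h2 h3
  · rintro N ⟨h1, h2, h3⟩ N' ⟨h1', h2', h3'⟩ hNN'
    obtain ⟨I, hI⟩ := hw0 N h1 h2 h3
    have e1 := hw N h1 h2 h3 I hI
    have e2 := hw N' h1' h2' h3' I (hNN' ▸ hI)
    rw [← hNN', ← e1] at e2
    apply le_antisymm
    · intro x hx
      exact h1'.2 x (h1.1 hx) (e2 ▸ Submodule.subset_span hx)
    · intro x hx
      exact h1.2 x (h1'.1 hx) (e2 ▸ Submodule.subset_span hx)

end Finiteness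

/-! ### The minimal slope and its canonical sublattice -/

section Rank

variable {K E : Type*} [Field K] [NumberField K] [AddCommGroup E] [Module K E]
  [Module (𝓞 K) E] [IsScalarTower (𝓞 K) K E]

theorem latticeRank_pos {N : Submodule (𝓞 K) E} (hN : N.FG) (h0 : N ≠ ⊥) :
    0 < latticeRank N := by
  have := finiteDimensional_span hN
  rw [latticeRank, Module.finrank_pos_iff]
  obtain ⟨x, hx, hx0⟩ := (Submodule.ne_bot_iff N).1 h0
  exact ⟨⟨x, Submodule.subset_span hx⟩, 0, fun h => hx0 (congrArg Subtype.val h)⟩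

theorem latticeSlope_pos (h : HermitianFamily K E) {N : Submodule (𝓞 K) E} (hN : N.FG) :
    0 < latticeSlope h N :=
  Real.rpow_pos_of_pos (vol_pos h hN) _

theorem latticeSlope_pow (h : HermitianFamily K E) {N : Submodule (𝓞 K) E} (hN : N.FG)
    (h0 : N ≠ ⊥) : latticeSlope h N ^ latticeRank N = vol h N := by
  have h1 := latticeRank_pos hN h0
  rw [latticeSlope, ← Real.rpow_natCast, ← Real.rpow_mul (vol_pos h hN).le, one_div,
    inv_mul_cancel₀ (by exact_mod_cast h1.ne'), Real.rpow_one]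

theorem latticeSlope_le_iff (h : HermitianFamily K E) {N : Submodule (𝓞 K) E} (hN : N.FG)
    (h0 : N ≠ ⊥) {s : ℝ} (hs : 0 ≤ s) : latticeSlope h N ≤ s ↔ vol h N ≤ s ^ latticeRank N := by
  rw [← latticeSlope_pow h hN h0,
    pow_le_pow_iff_left₀ (latticeSlope_pos h hN).le hs (latticeRank_pos hN h0).ne']

/-- The minimum of the slopes is attained. -/
theorem exists_latticeSlope_le [FiniteDimensional K E] (h : HermitianFamily K E)
    {X : Submodule (𝓞 K) E} (hX : X.FG) (hX0 : X ≠ ⊥) :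
    ∃ N₀, IsPrim X N₀ ∧ N₀ ≠ ⊥ ∧ ∀ N, IsPrim X N → N ≠ ⊥ →
      latticeSlope h N₀ ≤ latticeSlope h N := by
  let s := latticeSlope h X
  let S : Set (Submodule (𝓞 K) E) := {N | IsPrim X N ∧ N ≠ ⊥ ∧ latticeSlope h N ≤ s}
  have hS : S.Finite := by
    refine Set.Finite.subset (Set.Finite.biUnion (Set.finite_Iic (Module.finrank K E))
      fun n _ => finite_isPrim_vol_le h hX n (s ^ n)) ?_
    rintro N ⟨h1, h2, h3⟩
    refine Set.mem_biUnion (Submodule.finrank_le _ : latticeRank N ≤ _) ⟨h1, rfl, ?_⟩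
    exact (latticeSlope_le_iff h (fg_of_le hX h1.1) h2 (latticeSlope_pos h hX).le).1 h3
  have hXS : X ∈ S := ⟨⟨le_rfl, fun _ hx _ => hx⟩, hX0, le_rfl⟩
  obtain ⟨N₀, hN₀, hmin⟩ := hS.exists_minimalFor (latticeSlope h) S ⟨X, hXS⟩
  refine ⟨N₀, hN₀.1, hN₀.2.1, fun N hN hN0 => ?_⟩
  rcases le_total (latticeSlope h N) s with hle | hle
  · rcases le_total (latticeSlope h N₀) (latticeSlope h N) with h1 | h1
    · exact h1
    · exact hmin ⟨hN, hN0, hle⟩ h1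
  · exact hN₀.2.2.trans hle

theorem span_sup_eq (X Y : Submodule (𝓞 K) E) :
    Submodule.span K ((X ⊔ Y : Submodule (𝓞 K) E) : Set E) =
      Submodule.span K (X : Set E) ⊔ Submodule.span K (Y : Set E) := by
  apply le_antisymm
  · rw [Submodule.span_le]
    intro z hz
    obtain ⟨x, hx, y, hy, rfl⟩ := Submodule.mem_sup.1 hz
    exact Submodule.add_mem_sup (Submodule.subset_span hx) (Submodule.subset_span hy)
  · exact sup_le (Submodule.span_mono (le_sup_left : X ≤ X ⊔ Y))
      (Submodule.span_mono (le_sup_right : Y ≤ X ⊔ Y))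

theorem span_inf_eq (X Y : Submodule (𝓞 K) E) :
    Submodule.span K ((X ⊓ Y : Submodule (𝓞 K) E) : Set E) =
      Submodule.span K (X : Set E) ⊓ Submodule.span K (Y : Set E) := by
  apply le_antisymm
  · exact le_inf (Submodule.span_mono (inf_le_left : X ⊓ Y ≤ X))
      (Submodule.span_mono (inf_le_right : X ⊓ Y ≤ Y))
  · rintro z ⟨hzX, hzY⟩
    obtain ⟨a, ha, haz⟩ := exists_smul_mem_of_mem_span X hzX
    obtain ⟨c, hc, hcz⟩ := exists_smul_mem_of_mem_span Y hzY
    refine mem_span_of_smul_mem (mul_ne_zero ha hc) ⟨?_, ?_⟩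
    · rw [mul_comm, mul_smul]; exact X.smul_mem _ haz
    · rw [mul_smul]; exact Y.smul_mem _ hcz

theorem IsPrim.eq_of_span_eq {L X Y : Submodule (𝓞 K) E} (hX : IsPrim L X) (hY : IsPrim L Y)
    (h : Submodule.span K (X : Set E) = Submodule.span K (Y : Set E)) : X = Y :=
  le_antisymm (fun x hx => hY.2 x (hX.1 hx) (h ▸ Submodule.subset_span hx))
    fun x hx => hX.2 x (hY.1 hx) (h ▸ Submodule.subset_span hx)

theorem span_inf_restrictScalars {X : Submodule (𝓞 K) E} {V : Submodule K E}
    (hV : V ≤ Submodule.span K (X : Set E)) :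
    Submodule.span K ((X ⊓ V.restrictScalars (𝓞 K) : Submodule (𝓞 K) E) : Set E) = V := by
  rw [span_inf_eq]
  have : Submodule.span K ((V.restrictScalars (𝓞 K) : Submodule (𝓞 K) E) : Set E) = V :=
    Submodule.span_eq V
  rw [this]
  exact inf_eq_right.2 hV

end Rank

section Transport

variable {K E E' : Type*} [Field K] [NumberField K] [AddCommGroup E] [Module K E]
  [Module (𝓞 K) E] [IsScalarTower (𝓞 K) K E] [AddCommGroup E'] [Module K E']
  [Module (𝓞 K) E'] [IsScalarTower (𝓞 K) K E']

theorem span_map_eq (φ : E →ₗ[K] E') (N : Submodule (𝓞 K) E) :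
    Submodule.span K ((N.map (φ.restrictScalars (𝓞 K)) : Submodule (𝓞 K) E') : Set E') =
      (Submodule.span K (N : Set E)).map φ := by
  rw [Submodule.map_span]; rfl

theorem latticeRank_map (φ : E ≃ₗ[K] E') (N : Submodule (𝓞 K) E) :
    latticeRank (N.map ((φ : E →ₗ[K] E').restrictScalars (𝓞 K))) = latticeRank N := by
  rw [latticeRank, span_map_eq]
  exact LinearEquiv.finrank_map_eq φ _

/-- Isometries preserve the volume. -/
theorem vol_map (φ : E ≃ₗ[K] E') {h : HermitianFamily K E} {h' : HermitianFamily K E'}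
    (hφ : ∀ v x y, (h' v).inner (1 ⊗ₜ[K] φ x) (1 ⊗ₜ[K] φ y) = (h v).inner (1 ⊗ₜ[K] x) (1 ⊗ₜ[K] y))
    {N : Submodule (𝓞 K) E} (hN : N.FG) :
    vol h' (N.map ((φ : E →ₗ[K] E').restrictScalars (𝓞 K))) = vol h N := by
  obtain ⟨n, 𝔞, b, P⟩ := exists_isPseudoBasis hN
  have Q : IsPseudoBasis (N.map ((φ : E →ₗ[K] E').restrictScalars (𝓞 K))) 𝔞 (φ ∘ b) := by
    refine ⟨P.ideal_ne_zero, P.linearIndependent.map' _ φ.ker, ?_⟩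
    rw [P.eq_iSup, Submodule.map_iSup]
    refine iSup_congr fun i => ?_
    ext z
    simp [Submodule.mem_map, mem_idealSMul]
  rw [P.vol_eq h, Q.vol_eq h']
  unfold pseudoVol archVol gramDet
  simp only [Function.comp_apply, hφ]

end Transport

section MinSlope

variable {K E : Type*} [Field K] [NumberField K] [AddCommGroup E] [Module K E]
  [Module (𝓞 K) E] [IsScalarTower (𝓞 K) K E]

theorem OKLattice.finiteDimensional (L : OKLattice K E) : FiniteDimensional K E := by
  have := finiteDimensional_span L.fg
  rw [L.span_eq_top] at this
  exact Module.Finite.equiv (Submodule.topEquiv (R := K) (M := E))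

theorem OKLattice.carrier_ne_bot [Nontrivial E] (L : OKLattice K E) : L.carrier ≠ ⊥ := by
  intro h
  have := L.span_eq_top
  rw [h, Submodule.bot_coe, Submodule.span_zero_singleton] at this
  exact bot_ne_top this

theorem OKLattice.isLeast_minSlope [Nontrivial E] (L : OKLattice K E) :
    IsLeast L.slopes L.minSlope := by
  have := L.finiteDimensional
  obtain ⟨N₀, h1, h2, h3⟩ := exists_latticeSlope_le L.herm L.fg L.carrier_ne_bot
  have : IsLeast L.slopes (latticeSlope L.herm N₀) := by
    refine ⟨⟨N₀, OKLattice.isSublattice_iff_isPrim.2 h1, h2, rfl⟩, ?_⟩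
    rintro _ ⟨N, hN, hN0, rfl⟩
    exact h3 N (OKLattice.isSublattice_iff_isPrim.1 hN) hN0
  rw [OKLattice.minSlope, this.csInf_eq]
  exact this

theorem OKLattice.minSlope_pos [Nontrivial E] (L : OKLattice K E) : 0 < L.minSlope := by
  obtain ⟨N, hN, -, h⟩ := L.isLeast_minSlope.1
  rw [h]
  exact latticeSlope_pos _ (fg_of_le L.fg hN.1)

/-- The defining inequality of the minimal slope, in a form that includes the zero submodule. -/
theorem OKLattice.minSlope_pow_le [Nontrivial E] (L : OKLattice K E) {N : Submodule (𝓞 K) E}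
    (hN : IsPrim L.carrier N) : L.minSlope ^ latticeRank N ≤ vol L.herm N := by
  by_cases h0 : N = ⊥
  · subst h0
    have : latticeRank (⊥ : Submodule (𝓞 K) E) = 0 := by
      rw [latticeRank, Submodule.bot_coe, Submodule.span_zero_singleton, finrank_bot]
    rw [this, pow_zero, vol_bot]
  · have hfg := fg_of_le L.fg hN.1
    rw [← latticeSlope_pow L.herm hfg h0]
    exact pow_le_pow_left₀ L.minSlope_pos.le
      (L.isLeast_minSlope.2 ⟨N, OKLattice.isSublattice_iff_isPrim.2 hN, h0, rfl⟩) _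

/-- Among the sublattices of minimal slope there is one that is stable under all the automorphisms:
the one of maximal rank. -/
theorem OKLattice.exists_invariant_minSlope [Nontrivial E] (L : OKLattice K E) :
    ∃ N, IsPrim L.carrier N ∧ N ≠ ⊥ ∧ vol L.herm N = L.minSlope ^ latticeRank N ∧
      ∀ g ∈ L.aut, ∀ x ∈ N, g x ∈ N := by
  have := L.finiteDimensional
  let S : Set ℕ := {n | ∃ N, IsPrim L.carrier N ∧ N ≠ ⊥ ∧
    vol L.herm N = L.minSlope ^ latticeRank N ∧ latticeRank N = n}
  have hne : S.Nonempty := by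
    obtain ⟨N, hN, h0, h⟩ := L.isLeast_minSlope.1
    refine ⟨_, N, OKLattice.isSublattice_iff_isPrim.1 hN, h0, ?_, rfl⟩
    rw [h, latticeSlope_pow _ (fg_of_le L.fg hN.1) h0]
  have hbdd : BddAbove S := by
    refine ⟨Module.finrank K E, ?_⟩
    rintro _ ⟨N, -, -, -, rfl⟩
    exact Submodule.finrank_le _
  obtain ⟨X, hX, hX0, hXv, hXn⟩ := Nat.sSup_mem hne hbdd
  refine ⟨X, hX, hX0, hXv, ?_⟩
  -- Any other such `Y` equals `X`: by submodularity the saturation `Z` of `X + Y` has minimal slope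
  -- too, so its rank is at most that of `X`.
  have huniq : ∀ Y, IsPrim L.carrier Y → vol L.herm Y = L.minSlope ^ latticeRank Y →
      latticeRank Y = latticeRank X → Y = X := by
    intro Y hY hYv hYX
    let V : Submodule K E := Submodule.span K ((X ⊔ Y : Submodule (𝓞 K) E) : Set E)
    let Z : Submodule (𝓞 K) E := L.carrier ⊓ V.restrictScalars (𝓞 K)
    have hZ : IsPrim L.carrier Z := isPrim_inf_restrictScalars _ _
    have hXYZ : X ⊔ Y ≤ Z := le_inf (sup_le hX.1 hY.1) fun z hz => Submodule.subset_span hz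
    have hZV : Submodule.span K (Z : Set E) = V :=
      span_inf_restrictScalars (by rw [L.span_eq_top]; exact le_top)
    have hZfg := fg_of_le L.fg hZ.1
    have hZvol : vol L.herm Z ≤ vol L.herm (X ⊔ Y) := vol_anti _ hZfg hXYZ hZV.symm
    have hD : IsPrim L.carrier (X ⊓ Y) := ⟨inf_le_left.trans hX.1, fun x hx hxs =>
      ⟨hX.2 x hx (Submodule.span_mono (fun _ h => h.1) hxs),
        hY.2 x hx (Submodule.span_mono (fun _ h => h.2) hxs)⟩⟩
    have hrk : latticeRank Z + latticeRank (X ⊓ Y) = latticeRank X + latticeRank Y := by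
      rw [latticeRank, latticeRank, hZV.trans (span_sup_eq X Y), span_inf_eq,
        Submodule.finrank_sup_add_finrank_inf_eq]
    have hμ := L.minSlope_pos
    have h1 : vol L.herm Z * L.minSlope ^ latticeRank (X ⊓ Y) ≤
        L.minSlope ^ latticeRank Z * L.minSlope ^ latticeRank (X ⊓ Y) := by
      calc vol L.herm Z * L.minSlope ^ latticeRank (X ⊓ Y)
          ≤ vol L.herm (X ⊔ Y) * vol L.herm (X ⊓ Y) :=
            mul_le_mul hZvol (L.minSlope_pow_le hD) (by positivity)
              (vol_pos _ (fg_of_le L.fg (sup_le hX.1 hY.1))).le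
        _ ≤ vol L.herm X * vol L.herm Y := vol_submodular _ L.fg hX hY
        _ = L.minSlope ^ latticeRank Z * L.minSlope ^ latticeRank (X ⊓ Y) := by
            rw [hXv, hYv, ← pow_add, ← pow_add, hrk]
    have h2 : vol L.herm Z = L.minSlope ^ latticeRank Z :=
      le_antisymm (le_of_mul_le_mul_right h1 (by positivity)) (L.minSlope_pow_le hZ)
    have hXZ : X ≤ Z := le_sup_left.trans hXYZ
    have hYZ : Y ≤ Z := le_sup_right.trans hXYZ
    have h3 : latticeRank Z ≤ latticeRank X := by
      rw [hXn]
      exact le_csSup hbdd ⟨Z, hZ, fun h => hX0 (le_bot_iff.1 (h ▸ hXZ)), h2, rfl⟩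
    have hsX : Submodule.span K (X : Set E) = Submodule.span K (Z : Set E) :=
      Submodule.eq_of_le_of_finrank_le (Submodule.span_mono hXZ) h3
    have hsY : Submodule.span K (Y : Set E) = Submodule.span K (Z : Set E) :=
      Submodule.eq_of_le_of_finrank_le (Submodule.span_mono hYZ) (h3.trans hYX.ge)
    exact hY.eq_of_span_eq hX (hsY.trans hsX.symm)
  intro g hg x hx
  have hmap : X.map ((g : E →ₗ[K] E).restrictScalars (𝓞 K)) = X := by
    have hvol : vol L.herm (X.map ((g : E →ₗ[K] E).restrictScalars (𝓞 K))) = vol L.herm X :=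
      vol_map g (fun v x y => by simpa using hg.2 v (1 ⊗ₜ[K] x) (1 ⊗ₜ[K] y)) (fg_of_le L.fg hX.1)
    refine huniq _ ⟨?_, ?_⟩ ?_ (latticeRank_map g X)
    · rintro _ ⟨y, hy, rfl⟩
      exact (hg.1 y).2 (hX.1 hy)
    · intro y hy hys
      rw [span_map_eq] at hys
      obtain ⟨z, hz, rfl⟩ := hys
      exact ⟨z, hX.2 z ((hg.1 z).1 hy) hz, rfl⟩
    · rw [hvol, latticeRank_map, hXv]
  rw [← hmap]
  exact ⟨x, hx, rfl⟩

end MinSlope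

/-! ### Absolutely irreducible representations and stable subspaces -/

section AbsIrreducible

variable {K G V : Type*} [Field K] [Group G] [AddCommGroup V] [Module K V]

theorem one_tmul_eq_zero {A : Type*} [CommRing A] [Nontrivial A] [Algebra K A] {x : V}
    (h : (1 : A) ⊗ₜ[K] x = 0) : x = 0 := by
  by_contra hx
  have h1 : LinearIndependent K fun _ : Unit => x := LinearIndependent.of_subsingleton () hx
  exact (Module.Flat.linearIndependent_one_tmul (S := A) h1).ne_zero () h

theorem geometricRep_apply (ρ : Representation K G V) (g : G) :
    geometricRep ρ g = (ρ g).baseChange (AlgebraicClosure K) := rfl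

/-- An absolutely irreducible representation is irreducible, since subrepresentations extend to the
algebraic closure. -/
theorem IsAbsIrreducible.isIrreducible {ρ : Representation K G V} (h : IsAbsIrreducible ρ) :
    ρ.IsIrreducible := by
  have h' : IsSimpleOrder (Subrepresentation (geometricRep ρ)) := h
  let bc : Subrepresentation ρ → Subrepresentation (geometricRep ρ) := fun σ =>
    ⟨σ.toSubmodule.baseChange (AlgebraicClosure K), fun g x hx => by
      rw [geometricRep_apply]
      rw [Submodule.baseChange_eq_span] at hx
      induction hx using Submodule.span_induction with
      | mem x hx =>
        obtain ⟨y, hy, rfl⟩ := hx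
        exact Submodule.tmul_mem_baseChange_of_mem 1 (σ.apply_mem_toSubmodule g hy)
      | zero => simp
      | add x y _ _ hx hy => rw [map_add]; exact Submodule.add_mem _ hx hy
      | smul a x _ hx => rw [map_smul]; exact Submodule.smul_mem _ _ hx⟩
  have hbot : ∀ σ, bc σ = ⊥ → σ = ⊥ := by
    intro σ hσ
    apply Subrepresentation.toSubmodule_injective
    refine le_bot_iff.1 fun x hx => ?_
    have h1 : (1 : AlgebraicClosure K) ⊗ₜ[K] x ∈ (bc σ).toSubmodule :=
      Submodule.tmul_mem_baseChange_of_mem 1 hx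
    rw [hσ] at h1
    exact one_tmul_eq_zero h1
  have htop : ∀ σ, bc σ = ⊤ → σ = ⊤ := by
    intro σ hσ
    apply Subrepresentation.toSubmodule_injective
    refine top_le_iff.1 fun x _ => ?_
    by_contra hx
    obtain ⟨f, hfx, hf⟩ := Submodule.exists_le_ker_of_notMem hx
    have h1 : (1 : AlgebraicClosure K) ⊗ₜ[K] x ∈ σ.toSubmodule.baseChange (AlgebraicClosure K) := by
      change _ ∈ (bc σ).toSubmodule
      rw [hσ]; trivial
    have h2 : σ.toSubmodule.baseChange (AlgebraicClosure K) ≤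
        LinearMap.ker (f.baseChange (AlgebraicClosure K)) := by
      rw [Submodule.baseChange_eq_span, Submodule.span_le]
      rintro _ ⟨y, hy, rfl⟩
      have : f y = 0 := hf hy
      simp [this]
    have h3 := h2 h1
    rw [LinearMap.mem_ker, LinearMap.baseChange_tmul] at h3
    exact hfx (one_tmul_eq_zero h3)
  have hnt : (⊥ : Subrepresentation ρ) ≠ ⊤ := by
    intro he
    have : (⊥ : Subrepresentation (geometricRep ρ)) = ⊤ := by
      apply Subrepresentation.toSubmodule_injective
      have hV : ∀ x : V, x = 0 := fun x => by
        have : x ∈ (⊤ : Subrepresentation ρ).toSubmodule := trivial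
        rw [← he] at this
        exact this
      refine (top_le_iff.1 fun x _ => ?_)
      induction x using TensorProduct.induction_on with
      | zero => exact Submodule.zero_mem _
      | tmul a y => rw [hV y, TensorProduct.tmul_zero]; exact Submodule.zero_mem _
      | add x y hx hy => exact Submodule.add_mem _ (hx trivial) (hy trivial)
    exact bot_ne_top this
  refine { exists_pair_ne := ⟨⊥, ⊤, hnt⟩, eq_bot_or_eq_top := fun σ => ?_ }
  rcases h'.eq_bot_or_eq_top (bc σ) with h1 | h1
  · exact Or.inl (hbot σ h1)
  · exact Or.inr (htop σ h1)

/-- Schur's lemma for absolutely irreducible representations. -/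
theorem IsAbsIrreducible.exists_eq_smul [FiniteDimensional K V] {ρ : Representation K G V}
    (h : IsAbsIrreducible ρ) (f : V →ₗ[K] V) (hf : ∀ g v, f (ρ g v) = ρ g (f v)) :
    ∃ c : K, ∀ v, f v = c • v := by
  have h' : (geometricRep ρ).IsIrreducible := h
  let F : Representation.IntertwiningMap (geometricRep ρ) (geometricRep ρ) :=
    (f.baseChange (AlgebraicClosure K)).intertwiningMap_of_isIntertwiningMap _ _ fun g v => by
      rw [geometricRep_apply, ← LinearMap.comp_apply, ← LinearMap.comp_apply,
        ← LinearMap.baseChange_comp, ← LinearMap.baseChange_comp]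
      congr 2
      exact LinearMap.ext (hf g)
  obtain ⟨c, hc⟩ :=
    (Representation.IsIrreducible.algebraMap_intertwiningMap_bijective_of_isAlgClosed
      (ρ := geometricRep ρ)).2 F
  have hcv : ∀ v : V, (1 : AlgebraicClosure K) ⊗ₜ[K] f v = c ⊗ₜ[K] v := by
    intro v
    have h1 : F ((1 : AlgebraicClosure K) ⊗ₜ[K] v) = c • ((1 : AlgebraicClosure K) ⊗ₜ[K] v) := by
      rw [← hc]; rfl
    rw [TensorProduct.smul_tmul', smul_eq_mul, mul_one] at h1
    rw [← h1]; rfl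
  by_cases hV : ∀ v : V, v = 0
  · exact ⟨0, fun v => by rw [hV v]; simp⟩
  push Not at hV
  obtain ⟨x, hx⟩ := hV
  obtain ⟨l, hl⟩ : ∃ l : V →ₗ[K] K, l x = 1 := by
    obtain ⟨l, hl⟩ : ∃ f : V →ₗ[K] K, f x ≠ 0 := by
      by_contra hcon
      push Not at hcon
      exact hx ((Module.forall_dual_apply_eq_zero_iff K x).1 hcon)
    exact ⟨(l x)⁻¹ • l, by simp [hl]⟩
  have hcK : c = algebraMap K (AlgebraicClosure K) (l (f x)) := by
    have h1 := congrArg (fun z => TensorProduct.rid K (AlgebraicClosure K)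
      (l.baseChange (AlgebraicClosure K) z)) (hcv x)
    simp only [LinearMap.baseChange_tmul, hl, TensorProduct.rid_tmul, one_smul] at h1
    rw [← h1, Algebra.algebraMap_eq_smul_one]
  refine ⟨l (f x), fun v => ?_⟩
  rw [← sub_eq_zero]
  apply one_tmul_eq_zero (K := K) (A := AlgebraicClosure K)
  rw [TensorProduct.tmul_sub, hcv, hcK, Algebra.algebraMap_eq_smul_one,
    TensorProduct.smul_tmul, sub_self]

end AbsIrreducible

section MultiplicityFree

variable {K E : Type*} [Field K] [AddCommGroup E] [Module K E]

/-- A decomposition of `E`, given by its projections, into subspaces that are stable and simple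
under a set `S` of endomorphisms and on which every endomorphism that commutes with `S` acts by
scalars. -/
structure SchurDecomposition (S : Set (Module.End K E)) (r : ℕ) where
  proj : Fin r → E →ₗ[K] E
  sum_proj : ∀ x, ∑ i, proj i x = x
  proj_proj : ∀ i x, proj i (proj i x) = proj i x
  proj_proj_of_ne : ∀ i j, i ≠ j → ∀ x, proj i (proj j x) = 0
  commute : ∀ i, ∀ g ∈ S, ∀ x, proj i (g x) = g (proj i x)
  simple : ∀ i, ∀ U : Submodule K E, U ≤ LinearMap.range (proj i) → (∀ g ∈ S, ∀ x ∈ U, g x ∈ U) →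
    U = ⊥ ∨ U = LinearMap.range (proj i)
  nonzero : ∀ i, LinearMap.range (proj i) ≠ ⊥
  scalar : ∀ φ : E →ₗ[K] E, (∀ g ∈ S, ∀ x, φ (g x) = g (φ x)) →
    ∃ c : Fin r → K, ∀ i x, φ (proj i x) = c i • proj i x

/-- The projections of an internal direct sum. -/
theorem exists_projections {r : ℕ} {W : Fin r → Submodule K E} (hW : DirectSum.IsInternal W) :
    ∃ P : Fin r → E →ₗ[K] E, (∀ i x, P i x ∈ W i) ∧ (∀ x, ∑ i, P i x = x) ∧
      (∀ i, ∀ x ∈ W i, P i x = x) ∧ ∀ i j, i ≠ j → ∀ x ∈ W j, P i x = 0 := by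
  classical
  let e := LinearEquiv.ofBijective (DirectSum.coeLinearMap W) hW
  have he : ∀ i (x : W i), e.symm x = DirectSum.lof K (Fin r) (fun i => W i) i x := by
    intro i x
    rw [LinearEquiv.symm_apply_eq]
    exact (DirectSum.coeLinearMap_lof W i x).symm
  refine ⟨fun i => (W i).subtype ∘ₗ DirectSum.component K (Fin r) (fun i => W i) i ∘ₗ
    e.symm.toLinearMap, fun i x => Subtype.property _, fun x => ?_, fun i x hx => ?_,
    fun i j hij x hx => ?_⟩
  · have h1 := e.apply_symm_apply x
    conv_rhs => rw [← h1]
    change _ = DirectSum.coeLinearMap W (e.symm x)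
    rw [DirectSum.coeLinearMap_eq_dfinsuppSum, DFinsupp.sum_eq_sum_fintype]
    · rfl
    · simp
  · have := he i ⟨x, hx⟩
    simp only [LinearMap.comp_apply, LinearEquiv.coe_coe]
    rw [this, DirectSum.component.lof_self]
    rfl
  · have := he j ⟨x, hx⟩
    simp only [LinearMap.comp_apply, LinearEquiv.coe_coe]
    rw [this, DirectSum.component.of, dif_neg hij.symm]
    rfl

/-- The components of a multiplicity-free representation form a Schur decomposition: an endomorphism
that commutes with the group has no off-diagonal blocks, the components being non-isomorphic, and
scalar diagonal blocks, by Schur's lemma. -/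
theorem IsMultiplicityFree.exists_schurDecomposition {G : Type*} [Group G] [FiniteDimensional K E]
    {ρ : Representation K G E} {r : ℕ} (h : IsMultiplicityFree ρ r) :
    Nonempty (SchurDecomposition (Set.range ρ) r) := by
  obtain ⟨W, hint, hirr, hne⟩ := h
  obtain ⟨P, hPW, hsum, hPid, hP0⟩ := exists_projections hint
  have hrange : ∀ i, LinearMap.range (P i) = (W i).toSubmodule := by
    intro i
    apply le_antisymm
    · rintro _ ⟨x, rfl⟩
      exact hPW i x
    · intro x hx
      exact ⟨x, hPid i x hx⟩
  have hcomm : ∀ i, ∀ g ∈ Set.range ρ, ∀ x, P i (g x) = g (P i x) := by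
    rintro i _ ⟨g, rfl⟩ x
    conv_lhs => rw [← hsum x]
    rw [map_sum, map_sum, Finset.sum_eq_single i]
    · exact hPid i _ ((W i).apply_mem_toSubmodule g (hPW i x))
    · intro j _ hj
      exact hP0 i j hj.symm _ ((W j).apply_mem_toSubmodule g (hPW j x))
    · simp
  have hir : ∀ i, (W i).toRepresentation.IsIrreducible := fun i => (hirr i).isIrreducible
  refine ⟨⟨P, hsum, fun i x => hPid i _ (hPW i x), fun i j hij x => hP0 i j hij _ (hPW j x), hcomm,
    fun i U hU hUS => ?_, fun i hi => ?_, fun φ hφ => ?_⟩⟩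
  · rw [hrange] at hU ⊢
    let σ : Subrepresentation (W i).toRepresentation :=
      ⟨U.comap (W i).toSubmodule.subtype, fun g x hx => hUS _ ⟨g, rfl⟩ _ hx⟩
    rcases (hir i).eq_bot_or_eq_top σ with h1 | h1
    · left
      refine le_bot_iff.1 fun x hx => ?_
      have h2 : (⟨x, hU hx⟩ : (W i).toSubmodule) ∈ σ.toSubmodule := hx
      rw [h1] at h2
      exact congrArg Subtype.val (show (⟨x, hU hx⟩ : (W i).toSubmodule) = 0 from h2)
    · right
      refine le_antisymm hU fun x hx => ?_
      have h2 : (⟨x, hx⟩ : (W i).toSubmodule) ∈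
        (⊤ : Subrepresentation (W i).toRepresentation).toSubmodule := trivial
      rw [← h1] at h2
      exact h2
  · rw [hrange] at hi
    refine (bot_ne_top : (⊥ : Subrepresentation (W i).toRepresentation) ≠ ⊤) ?_
    apply Subrepresentation.toSubmodule_injective
    refine (top_le_iff.1 fun x _ => ?_)
    have : (x : E) ∈ (⊥ : Submodule K E) := hi ▸ x.2
    exact Subtype.ext this
  · have hc : ∀ i, ∃ c : K, ∀ x ∈ (W i).toSubmodule, φ x = c • x := by
      intro i
      let f : ∀ j, (W i).toSubmodule →ₗ[K] (W j).toSubmodule := fun j =>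
        (P j ∘ₗ φ ∘ₗ (W i).toSubmodule.subtype).codRestrict _ fun x => hPW j _
      have hf : ∀ j g v, f j ((W i).toRepresentation g v) = (W j).toRepresentation g (f j v) := by
        intro j g v
        apply Subtype.ext
        change P j (φ (ρ g v)) = ρ g (P j (φ v))
        rw [hφ _ ⟨g, rfl⟩, hcomm _ _ ⟨g, rfl⟩]
      obtain ⟨c, hc⟩ := (hirr i).exists_eq_smul (f i) (hf i)
      refine ⟨c, fun x hx => ?_⟩
      rw [← hsum (φ x), Finset.sum_eq_single i]
      · exact congrArg Subtype.val (hc ⟨x, hx⟩)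
      · intro j _ hj
        have := hne i j hj.symm
        have h1 : (f j).intertwiningMap_of_isIntertwiningMap (W i).toRepresentation
          (W j).toRepresentation (hf j) = 0 := Subsingleton.elim _ _
        have h2 : f j ⟨x, hx⟩ = 0 := congrArg (fun F => F ⟨x, hx⟩) h1
        exact congrArg Subtype.val h2
      · simp
    choose c hc using hc
    exact ⟨c, fun i x => hc i _ (hPW i x)⟩

variable {F : Type*} [AddCommGroup F] [Module K F]

/-- The image of `V ⊗ A` in `E ⊗ F`, for subspaces `V` and `A`. -/
abbrev tensorSubspace (V : Submodule K E) (A : Submodule K F) : Submodule K (E ⊗[K] F) :=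
  Submodule.map₂ (TensorProduct.mk K E F) V A

namespace SchurDecomposition

variable {S : Set (Module.End K E)} {r : ℕ} (D : SchurDecomposition S r)

/-- By the density theorem, a subspace of `E ⊗ F` that is stable under `S` is stable under all the
endomorphisms of `E` with image in one component that vanish on the other components. -/
theorem rTensor_mem_of_stable [FiniteDimensional K E] {U : Submodule K (E ⊗[K] F)}
    (hU : ∀ g ∈ S, ∀ u ∈ U, LinearMap.rTensor F g u ∈ U) (i : Fin r) (T : E →ₗ[K] E)
    (hT : ∀ x, D.proj i (T x) = T x) (hT' : ∀ x, T (D.proj i x) = T x) :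
    ∀ u ∈ U, LinearMap.rTensor F T u ∈ U := by
  let A : Subalgebra K (Module.End K E) := Algebra.adjoin K S
  have hstab : ∀ (V : Submodule K E), (∀ g ∈ S, ∀ x ∈ V, g x ∈ V) → ∀ a ∈ A, ∀ x ∈ V, a x ∈ V := by
    intro V hV a ha
    induction ha using Algebra.adjoin_induction with
    | mem g hg => exact hV g hg
    | algebraMap c => intro x hx; exact V.smul_mem c hx
    | add a b _ _ ha hb => intro x hx; exact V.add_mem (ha x hx) (hb x hx)
    | mul a b _ _ ha hb => intro x hx; exact ha _ (hb x hx)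
  -- Stability under `S` gives stability under the algebra that `S` generates, for which `E` is
  -- semisimple, so that `T` belongs to it by the density theorem once it commutes with `End_A E`.
  have hUA : ∀ a ∈ A, ∀ u ∈ U, LinearMap.rTensor F a u ∈ U := by
    intro a ha
    induction ha using Algebra.adjoin_induction with
    | mem g hg => exact hU g hg
    | algebraMap c =>
      intro u hu
      have : LinearMap.rTensor F (algebraMap K (Module.End K E) c) = c • LinearMap.id := by
        ext x y; simp [TensorProduct.smul_tmul']
      rw [this]
      exact U.smul_mem c hu
    | add a b _ _ ha hb =>
      intro u hu
      rw [LinearMap.rTensor_add]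
      exact U.add_mem (ha u hu) (hb u hu)
    | mul a b _ _ ha hb =>
      intro u hu
      rw [LinearMap.rTensor_mul]
      exact ha _ (hb u hu)
  let N : Fin r → Submodule A E := fun i =>
    { (LinearMap.range (D.proj i)) with
      smul_mem' := fun a x hx => hstab _ (by
        rintro g hg _ ⟨y, rfl⟩
        exact ⟨g y, D.commute i g hg y⟩) a.1 a.2 x hx }
  have hss : IsSemisimpleModule A E := by
    apply isSemisimpleModule_of_isSemisimpleModule_submodule' (p := N)
    · intro i
      have : IsSimpleModule A (N i) := by
        rw [isSimpleModule_iff_isAtom]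
        refine ⟨fun h => D.nonzero i ?_, fun V hV => ?_⟩
        · refine le_bot_iff.1 fun x hx => ?_
          have : x ∈ N i := hx
          rw [h] at this
          exact this
        · let V' : Submodule K E :=
            { V with smul_mem' := fun c x hx => V.smul_mem (algebraMap K A c) hx }
          rcases D.simple i V' (fun x hx => hV.le hx)
            (fun g hg x hx => V.smul_mem (⟨g, Algebra.subset_adjoin hg⟩ : A) hx) with h1 | h1
          · refine le_bot_iff.1 fun x hx => ?_
            have : x ∈ V' := hx
            rw [h1] at this
            exact this
          · refine absurd (le_antisymm hV.le fun x hx => ?_) hV.ne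
            have : x ∈ V' := by rw [h1]; exact hx
            exact this
      infer_instance
    · refine top_le_iff.1 fun x _ => ?_
      rw [← D.sum_proj x]
      exact Submodule.sum_mem _ fun i _ => Submodule.mem_iSup_of_mem i ⟨x, rfl⟩
  have hscal : ∀ φ : Module.End A E, ∀ x, T (φ x) = φ (T x) := by
    intro φ x
    let φ' : E →ₗ[K] E :=
      { toFun := φ
        map_add' := φ.map_add
        map_smul' := fun c x => φ.map_smul (algebraMap K A c) x }
    obtain ⟨c, hc⟩ := D.scalar φ' fun g hg x => φ.map_smul (⟨g, Algebra.subset_adjoin hg⟩ : A) x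
    have h1 : φ (T x) = c i • T x := by
      have := hc i (T x)
      rwa [hT] at this
    have h2 : D.proj i (φ' x) = c i • D.proj i x := by
      conv_lhs => rw [← D.sum_proj x]
      rw [map_sum, map_sum, Finset.sum_eq_single i]
      · rw [hc, map_smul, D.proj_proj]
      · intro j _ hj
        rw [hc, map_smul, D.proj_proj_of_ne i j hj.symm, smul_zero]
      · simp
    rw [h1, ← hT' (φ x)]
    change T (D.proj i (φ' x)) = _
    rw [h2, map_smul, hT']
  let f : Module.End (Module.End A E) E :=
    { toFun := T
      map_add' := T.map_add
      map_smul' := fun φ x => hscal φ x }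
  classical
  obtain ⟨a, ha⟩ := jacobson_density f (Finset.univ.image (Module.finBasis K E))
  have hTa : T = a.1 := by
    refine (Module.finBasis K E).ext fun k => ?_
    exact ha _ (Finset.mem_image_of_mem _ (Finset.mem_univ k))
  rw [hTa]
  exact hUA a.1 a.2

/-- The stable subspaces of `E ⊗ F` are the sums of products of the components of `E` with
subspaces of `F`. -/
theorem exists_eq_iSup_tensorSubspace [FiniteDimensional K E] {U : Submodule K (E ⊗[K] F)}
    (hU : ∀ g ∈ S, ∀ u ∈ U, LinearMap.rTensor F g u ∈ U) :
    ∃ A : Fin r → Submodule K F, U = ⨆ i, tensorSubspace (LinearMap.range (D.proj i)) (A i) := by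
  let A : Fin r → Submodule K F := fun i =>
    ⨅ x : LinearMap.range (D.proj i), U.comap (TensorProduct.mk K E F x)
  have hA : ∀ i y, y ∈ A i ↔ ∀ x ∈ LinearMap.range (D.proj i), x ⊗ₜ[K] y ∈ U := by
    intro i y
    simp [A, Submodule.mem_iInf]
  refine ⟨A, le_antisymm (fun u hu => ?_) (iSup_le fun i => ?_)⟩
  · have hsum : u = ∑ i, LinearMap.rTensor F (D.proj i) u := by
      have : ∑ i, LinearMap.rTensor F (D.proj i) = LinearMap.id := by
        ext x y
        simp [LinearMap.sum_apply, ← TensorProduct.sum_tmul, D.sum_proj]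
      rw [← LinearMap.sum_apply, this, LinearMap.id_apply]
    rw [hsum]
    refine Submodule.sum_mem _ fun i _ => Submodule.mem_iSup_of_mem i ?_
    let b := Module.finBasis K (LinearMap.range (D.proj i))
    let l : ∀ k, E →ₗ[K] K := fun k => b.coord k ∘ₗ (D.proj i).rangeRestrict
    let T : ∀ _ : E, ∀ k, E →ₗ[K] E := fun x k => (l k).smulRight x
    let q : ∀ k, E ⊗[K] F →ₗ[K] F := fun k =>
      (TensorProduct.lid K F).toLinearMap ∘ₗ LinearMap.rTensor F (l k)
    have hTq : ∀ x k, LinearMap.rTensor F (T x k) u = x ⊗ₜ[K] q k u := by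
      intro x k
      have : LinearMap.rTensor F (T x k) = TensorProduct.mk K E F x ∘ₗ q k := by
        ext y z
        simp [T, q, TensorProduct.smul_tmul]
      rw [this]; rfl
    have hq : ∀ k, q k u ∈ A i := by
      intro k
      rw [hA]
      rintro _ ⟨x, rfl⟩
      rw [← hTq]
      refine D.rTensor_mem_of_stable hU i _ (fun y => ?_) (fun y => ?_) u hu
      · simp [T, D.proj_proj]
      · simp only [T, l, LinearMap.smulRight_apply, LinearMap.comp_apply]
        congr 1
        exact congrArg (b.coord k) (Subtype.ext (D.proj_proj i y))
    have hsum2 : LinearMap.rTensor F (D.proj i) u = ∑ k, (b k : E) ⊗ₜ[K] q k u := by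
      simp_rw [← hTq]
      have : LinearMap.rTensor F (D.proj i) = ∑ k, LinearMap.rTensor F (T (b k) k) := by
        ext x y
        have h1 := congrArg (LinearMap.range (D.proj i)).subtype
          (b.sum_repr ((D.proj i).rangeRestrict x))
        rw [map_sum] at h1
        simp only [TensorProduct.AlgebraTensorModule.curry_apply, LinearMap.restrictScalars_self,
          TensorProduct.curry_apply, LinearMap.sum_apply, LinearMap.rTensor_tmul,
          ← TensorProduct.sum_tmul]
        congr 1
        exact h1.symm
      rw [this, LinearMap.sum_apply]
    rw [hsum2]
    exact Submodule.sum_mem _ fun k _ => Submodule.apply_mem_map₂ _ (b k).2 (hq k)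
  · rw [Submodule.map₂_le]
    intro x hx y hy
    exact (hA i y).1 hy x hx

end SchurDecomposition

end MultiplicityFree

/-! ### Orthogonality of the components and the slope of the tensor product -/

section Orthogonality

variable {K E : Type*} [Field K] [AddCommGroup E] [Module K E]

/-- Invariance of a sesquilinear form needs to be checked on pure tensors with scalar `1` only. -/
theorem core_inner_congr {v : InfinitePlace K} (c : InnerProductSpace.Core (CAt v) (CAt v ⊗[K] E))
    (T : CAt v ⊗[K] E →ₗ[CAt v] CAt v ⊗[K] E)
    (hT : ∀ x y : E, c.inner (T (1 ⊗ₜ x)) (T (1 ⊗ₜ y)) = c.inner (1 ⊗ₜ x) (1 ⊗ₜ y))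
    (x y : CAt v ⊗[K] E) : c.inner (T x) (T y) = c.inner x y := by
  let _ : NormedAddCommGroup (CAt v ⊗[K] E) := c.toNormedAddCommGroup
  let _ : InnerProductSpace (CAt v) (CAt v ⊗[K] E) := InnerProductSpace.ofCore c.toCore
  change inner (CAt v) (T x) (T y) = inner (CAt v) x y
  have hsmul : ∀ (a : CAt v) (z : E), a ⊗ₜ[K] z = a • ((1 : CAt v) ⊗ₜ[K] z) := fun a z => by
    rw [TensorProduct.smul_tmul', smul_eq_mul, mul_one]
  induction x using TensorProduct.induction_on with
  | zero => simp
  | add x x' hx hx' => rw [map_add, inner_add_left, inner_add_left, hx, hx']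
  | tmul a x =>
    induction y using TensorProduct.induction_on with
    | zero => simp
    | add y y' hy hy' => rw [map_add, inner_add_right, inner_add_right, hy, hy']
    | tmul b y =>
      rw [hsmul a, hsmul b, map_smul, map_smul, inner_smul_left, inner_smul_left, inner_smul_right,
        inner_smul_right]
      congr 2
      exact hT x y

/-- A vector of `A ⊗ E` is zero if it is killed by all the maps `l ⊗ 1` with `l : A → K`
linear. -/
theorem eq_zero_of_forall_lid_rTensor [FiniteDimensional K E] {A : Type*} [CommRing A] [Algebra K A]
    {z : A ⊗[K] E} (hz : ∀ l : A →ₗ[K] K, TensorProduct.lid K E (LinearMap.rTensor E l z) = 0) :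
    z = 0 := by
  let e := Module.finBasis K E
  let b := Algebra.TensorProduct.basis A e
  have key : ∀ (l : A →ₗ[K] K) (k) (z : A ⊗[K] E),
      l (b.repr z k) = e.coord k (TensorProduct.lid K E (LinearMap.rTensor E l z)) := by
    intro l k z
    induction z using TensorProduct.induction_on with
    | zero => simp
    | add x y hx hy => simp only [map_add, Finsupp.add_apply, hx, hy]
    | tmul a x =>
      simp only [b, Algebra.TensorProduct.basis_repr_tmul, LinearMap.rTensor_tmul,
        TensorProduct.lid_tmul, Finsupp.smul_apply, Finsupp.mapRange_apply, smul_eq_mul, map_smul,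
        Module.Basis.coord_apply]
      rw [mul_comm a, ← Algebra.smul_def, map_smul, smul_eq_mul, mul_comm]
  apply b.repr.injective
  ext k
  rw [map_zero, Finsupp.zero_apply, ← Module.forall_dual_apply_eq_zero_iff K]
  intro l
  rw [key, hz, map_zero]

/-- The components of a Schur decomposition are orthogonal for every Hermitian form that is
invariant under `S`: otherwise the adjoint of a projection would give a nonzero map between two
components that commutes with `S`. -/
theorem SchurDecomposition.inner_proj_eq_zero [FiniteDimensional K E] {S : Set (Module.End K E)}
    {r : ℕ} (D : SchurDecomposition S r) {v : InfinitePlace K}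
    (c : InnerProductSpace.Core (CAt v) (CAt v ⊗[K] E))
    (hc : ∀ g ∈ S, ∀ x y, c.inner (LinearMap.baseChange (CAt v) g x)
      (LinearMap.baseChange (CAt v) g y) = c.inner x y) {i j : Fin r} (hij : i ≠ j) (x y : E) :
    c.inner (1 ⊗ₜ D.proj i x) (1 ⊗ₜ D.proj j y) = 0 := by
  let _ : NormedAddCommGroup (CAt v ⊗[K] E) := c.toNormedAddCommGroup
  let _ : InnerProductSpace (CAt v) (CAt v ⊗[K] E) := InnerProductSpace.ofCore c.toCore
  let P : Fin r → Module.End (CAt v) (CAt v ⊗[K] E) := fun i => (D.proj i).baseChange (CAt v)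
  -- Here `T` maps the `i`-th component to the `j`-th one and commutes with `S`, so it vanishes.
  let T : Module.End (CAt v) (CAt v ⊗[K] E) := P j * LinearMap.adjoint (P j) * P i
  have hcomm : ∀ g ∈ S, ∀ k, P k * LinearMap.baseChange (CAt v) g =
      LinearMap.baseChange (CAt v) g * P k := by
    intro g hg k
    change (D.proj k).baseChange (CAt v) ∘ₗ LinearMap.baseChange (CAt v) g =
      LinearMap.baseChange (CAt v) g ∘ₗ (D.proj k).baseChange (CAt v)
    rw [← LinearMap.baseChange_comp, ← LinearMap.baseChange_comp]
    congr 1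
    exact LinearMap.ext (D.commute k g hg)
  have hT : ∀ g ∈ S, T * LinearMap.baseChange (CAt v) g = LinearMap.baseChange (CAt v) g * T := by
    intro g hg
    set γ : Module.End (CAt v) (CAt v ⊗[K] E) := LinearMap.baseChange (CAt v) g with hγ
    have h1 : LinearMap.adjoint γ * γ = 1 := by
      refine LinearMap.ext fun x => ext_inner_left (CAt v) fun y => ?_
      rw [Module.End.mul_apply, LinearMap.adjoint_inner_right]
      exact hc g hg y x
    have h2 : γ * LinearMap.adjoint γ = 1 := mul_eq_one_comm.1 h1
    have h3 : LinearMap.adjoint γ * LinearMap.adjoint (P j) =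
        LinearMap.adjoint (P j) * LinearMap.adjoint γ := by
      have := congrArg LinearMap.adjoint (hcomm g hg j)
      rw [Module.End.mul_eq_comp, LinearMap.adjoint_comp, Module.End.mul_eq_comp,
        LinearMap.adjoint_comp] at this
      exact this
    have h4 : LinearMap.adjoint (P j) * γ = γ * LinearMap.adjoint (P j) := by
      calc LinearMap.adjoint (P j) * γ = γ * LinearMap.adjoint γ * LinearMap.adjoint (P j) * γ := by
            rw [h2, one_mul]
        _ = γ * (LinearMap.adjoint γ * LinearMap.adjoint (P j)) * γ := by simp only [mul_assoc]
        _ = γ * LinearMap.adjoint (P j) * (LinearMap.adjoint γ * γ) := by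
            rw [h3]; simp only [mul_assoc]
        _ = _ := by rw [h1, mul_one]
    calc T * γ = P j * LinearMap.adjoint (P j) * (P i * γ) := by simp only [T, mul_assoc]
      _ = P j * (LinearMap.adjoint (P j) * γ) * P i := by
          rw [hcomm g hg i]; simp only [mul_assoc, hγ]
      _ = (P j * γ) * LinearMap.adjoint (P j) * P i := by rw [h4]; simp only [mul_assoc]
      _ = γ * T := by rw [hcomm g hg j]; simp only [T, mul_assoc, hγ]
  have hT0 : ∀ x : E, T (1 ⊗ₜ x) = 0 := by
    intro x
    apply eq_zero_of_forall_lid_rTensor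
    intro l
    -- The map `x ↦ (l ⊗ 1) (T (1 ⊗ x))` commutes with `S`, so it preserves the components.
    let q : CAt v ⊗[K] E →ₗ[K] E :=
      (TensorProduct.lid K E).toLinearMap ∘ₗ LinearMap.rTensor E l
    have hq : ∀ (f : E →ₗ[K] E) z, q (LinearMap.baseChange (CAt v) f z) = f (q z) := by
      intro f z
      induction z using TensorProduct.induction_on with
      | zero => simp
      | add x y hx hy => simp only [map_add, hx, hy]
      | tmul a x => simp [q]
    let φ : E →ₗ[K] E := q ∘ₗ (T.restrictScalars K) ∘ₗ (TensorProduct.mk K (CAt v) E 1)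
    have hφ : ∀ x, φ x = q (T (1 ⊗ₜ x)) := fun _ => rfl
    obtain ⟨a, ha⟩ := D.scalar φ fun g hg x => by
      rw [hφ, hφ, ← hq]
      congr 1
      have := LinearMap.congr_fun (hT g hg) (1 ⊗ₜ x)
      rwa [Module.End.mul_apply, Module.End.mul_apply, LinearMap.baseChange_tmul] at this
    have h1 : φ x = φ (D.proj i x) := by
      rw [hφ, hφ]
      congr 1
      simp only [T, Module.End.mul_apply]
      congr 2
      simp only [P, LinearMap.baseChange_tmul, D.proj_proj]
    have h2 : D.proj j (φ x) = φ x := by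
      rw [hφ, ← hq]
      congr 1
      simp only [T, Module.End.mul_apply]
      change P j (P j _) = P j _
      rw [← Module.End.mul_apply]
      congr 1
      change (D.proj j).baseChange (CAt v) ∘ₗ (D.proj j).baseChange (CAt v) = _
      rw [← LinearMap.baseChange_comp]
      congr 1
      exact LinearMap.ext (D.proj_proj j)
    change φ x = 0
    rw [← h2, h1, ha, map_smul, D.proj_proj_of_ne j i hij.symm, smul_zero]
  change inner (CAt v) (P i (1 ⊗ₜ x)) (P j (1 ⊗ₜ y)) = 0
  -- `P j P j^* z = 0` implies `P j^* z = 0`.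
  have h1 : LinearMap.adjoint (P j) (P i (1 ⊗ₜ x)) = 0 := by
    rw [← inner_self_eq_zero (𝕜 := CAt v), LinearMap.adjoint_inner_left]
    have : P j (LinearMap.adjoint (P j) (P i (1 ⊗ₜ x))) = 0 := hT0 x
    rw [this, inner_zero_right]
  rw [← LinearMap.adjoint_inner_left, h1, inner_zero_left]

end Orthogonality

section TensorLattice

variable {K E F : Type*} [Field K] [NumberField K] [AddCommGroup E] [Module K E]
  [Module (𝓞 K) E] [IsScalarTower (𝓞 K) K E] [AddCommGroup F] [Module K F]
  [Module (𝓞 K) F] [IsScalarTower (𝓞 K) K F]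

theorem span_tensorSub (X : Submodule (𝓞 K) E) (Y : Submodule (𝓞 K) F) :
    Submodule.span K (tensorSub X Y : Set (E ⊗[K] F)) =
      tensorSubspace (Submodule.span K (X : Set E)) (Submodule.span K (Y : Set F)) := by
  apply le_antisymm
  · have : tensorSub X Y ≤ (tensorSubspace (Submodule.span K (X : Set E))
        (Submodule.span K (Y : Set F))).restrictScalars (𝓞 K) :=
      tensorSub_le.2 fun x hx y hy => Submodule.apply_mem_map₂ _ (Submodule.subset_span hx)
        (Submodule.subset_span hy)
    exact Submodule.span_le.2 this
  · rw [tensorSubspace, Submodule.map₂_span_span, Submodule.span_le]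
    rintro _ ⟨x, hx, y, hy, rfl⟩
    exact Submodule.subset_span (tmul_mem_tensorSub hx hy)

theorem tensorSub_fg {X : Submodule (𝓞 K) E} {Y : Submodule (𝓞 K) F} (hX : X.FG) (hY : Y.FG) :
    (tensorSub X Y).FG :=
  Submodule.FG.map₂ _ hX hY

theorem latticeRank_tensorSub {X : Submodule (𝓞 K) E} {Y : Submodule (𝓞 K) F} (hX : X.FG)
    (hY : Y.FG) : latticeRank (tensorSub X Y) = latticeRank X * latticeRank Y := by
  obtain ⟨n, 𝔞, b, P⟩ := exists_isPseudoBasis hX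
  obtain ⟨m, 𝔠, d, Q⟩ := exists_isPseudoBasis hY
  rw [latticeRank, latticeRank, latticeRank, (P.tensor Q).finrank_eq, P.finrank_eq, Q.finrank_eq,
    Fintype.card_prod]

/-- The intersection of `X ⊗ Y` with the span of `D ⊗ D'` is `D ⊗ D'`, for primitive `D` and
`D'`. -/
theorem mem_tensorSub_of_isPrim {X D : Submodule (𝓞 K) E} {Y D' : Submodule (𝓞 K) F} (hX : X.FG)
    (hY : Y.FG) (hD : IsPrim X D) (hD' : IsPrim Y D') {z : E ⊗[K] F} (hz : z ∈ tensorSub X Y)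
    (hz' : z ∈ tensorSubspace (Submodule.span K (D : Set E)) (Submodule.span K (D' : Set F))) :
    z ∈ tensorSub D D' := by
  obtain ⟨p, hp, hp'⟩ := hD.exists_retraction hX
  obtain ⟨q, hq, hq'⟩ := hD'.exists_retraction hY
  have h1 : tensorSub X Y ≤
      (tensorSub D D').comap ((TensorProduct.map p q).restrictScalars (𝓞 K)) :=
    tensorSub_le.2 fun x hx y hy => tmul_mem_tensorSub (hp x hx) (hq y hy)
  have h2 : tensorSubspace (Submodule.span K (D : Set E)) (Submodule.span K (D' : Set F)) ≤
      LinearMap.eqLocus (TensorProduct.map p q) LinearMap.id := by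
    rw [Submodule.map₂_le]
    intro x hx y hy
    simp [hp' x hx, hq' y hy]
  have h3 : TensorProduct.map p q z = z := h2 hz'
  have h4 : TensorProduct.map p q z ∈ tensorSub D D' := h1 hz
  rwa [h3] at h4

theorem IsPrim.tensorSub {X D : Submodule (𝓞 K) E} {Y D' : Submodule (𝓞 K) F} (hX : X.FG)
    (hY : Y.FG) (hD : IsPrim X D) (hD' : IsPrim Y D') :
    IsPrim (tensorSub X Y) (tensorSub D D') := by
  refine ⟨tensorSub_le.2 fun x hx y hy => tmul_mem_tensorSub (hD.1 hx) (hD'.1 hy),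
    fun z hz hzs => mem_tensorSub_of_isPrim hX hY hD hD' hz ?_⟩
  rwa [span_tensorSub] at hzs

theorem isPrim_self (X : Submodule (𝓞 K) E) : IsPrim X X := ⟨le_rfl, fun _ hx _ => hx⟩

namespace OKLattice

variable [Nontrivial E] [Nontrivial F]

/-- The easy inequality, given by the tensor product of two sublattices of minimal slope. -/
theorem minSlope_tensor_le (L : OKLattice K E) (M : OKLattice K F) :
    (L.tensor M).minSlope ≤ L.minSlope * M.minSlope := by
  obtain ⟨N, hN, hN0, hNμ⟩ := L.isLeast_minSlope.1
  obtain ⟨N', hN', hN'0, hN'μ⟩ := M.isLeast_minSlope.1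
  rw [isSublattice_iff_isPrim] at hN hN'
  have hfg := fg_of_le L.fg hN.1
  have hfg' := fg_of_le M.fg hN'.1
  have hP : IsPrim (L.tensor M).carrier (tensorSub N N') := IsPrim.tensorSub L.fg M.fg hN hN'
  have hr : 0 < latticeRank (tensorSub N N') := by
    rw [latticeRank_tensorSub hfg hfg']
    exact Nat.mul_pos (latticeRank_pos hfg hN0) (latticeRank_pos hfg' hN'0)
  have h0 : tensorSub N N' ≠ ⊥ := by
    intro h
    rw [h, latticeRank, Submodule.bot_coe, Submodule.span_zero_singleton, finrank_bot] at hr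
    exact lt_irrefl _ hr
  refine ((L.tensor M).isLeast_minSlope.2 ⟨_, isSublattice_iff_isPrim.2 hP, h0, rfl⟩).trans ?_
  rw [latticeSlope_le_iff _ (tensorSub_fg hfg hfg') h0
    (mul_pos L.minSlope_pos M.minSlope_pos).le, latticeRank_tensorSub hfg hfg']
  change vol (fun v => tensorCore v (L.herm v) (M.herm v)) _ ≤ _
  rw [vol_tensorSub _ _ hfg hfg', ← latticeSlope_pow _ hfg hN0, ← latticeSlope_pow _ hfg' hN'0,
    ← hNμ, ← hN'μ, ← pow_mul, ← pow_mul, mul_pow, mul_comm (latticeRank N') (latticeRank N)]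

/-- The lower bound for the volume of a sublattice of `L ⊗ M` whose span is of the form
`E₁ ⊗ A + E₂ ⊗ B`, for an orthogonal decomposition `E = E₁ + E₂` and `dim B ≤ dim A`. -/
theorem pow_le_vol_tensor_of_finrank_le (L : OKLattice K E) (M : OKLattice K F)
    (π₁ π₂ : E →ₗ[K] E) (hπ : ∀ x, π₁ x + π₂ x = x) (h₁₂ : ∀ x, π₁ (π₂ x) = 0)
    (h₂₁ : ∀ x, π₂ (π₁ x) = 0)
    (ho : ∀ v x y, (L.herm v).inner (1 ⊗ₜ[K] π₁ x) (1 ⊗ₜ[K] π₂ y) = 0) (A B : Submodule K F)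
    (hAB : Module.finrank K B ≤ Module.finrank K A) {N : Submodule (𝓞 K) (E ⊗[K] F)}
    (hN : IsPrim (L.tensor M).carrier N)
    (hs : Submodule.span K (N : Set (E ⊗[K] F)) =
      tensorSubspace (LinearMap.range π₁) A ⊔ tensorSubspace (LinearMap.range π₂) B) :
    (L.minSlope * M.minSlope) ^ latticeRank N ≤ vol (L.tensor M).herm N := by
  have hker : LinearMap.ker π₂ = LinearMap.range π₁ := by
    ext x
    refine ⟨fun hx => ⟨x, ?_⟩, ?_⟩
    · have := hπ x
      rwa [LinearMap.mem_ker.1 hx, add_zero] at this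
    · rintro ⟨y, rfl⟩; exact h₂₁ y
  have hidem₁ : ∀ x ∈ LinearMap.range π₁, π₁ x = x := by
    intro x hx
    have h1 := hπ x
    rw [← hker] at hx
    rwa [LinearMap.mem_ker.1 hx, add_zero] at h1
  have hidem₂ : ∀ x ∈ LinearMap.range π₂, π₂ x = x := by
    rintro _ ⟨x, rfl⟩
    have h1 := hπ (π₂ x)
    rwa [h₁₂, zero_add] at h1
  have hNfg : N.FG := fg_of_le (L.tensor M).fg hN.1
  -- The orthogonal decomposition of `L`: `L₁` is a sublattice, `L₂` is only a projection.
  set L₁ : Submodule (𝓞 K) E := L.carrier ⊓ (LinearMap.ker π₂).restrictScalars (𝓞 K) with hL₁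
  set L₂ : Submodule (𝓞 K) E := L.carrier.map (π₂.restrictScalars (𝓞 K)) with hL₂
  have hL₁s : Submodule.span K (L₁ : Set E) = LinearMap.range π₁ := by
    rw [hL₁, span_inf_restrictScalars (by rw [L.span_eq_top]; exact le_top), hker]
  have hL₂s : Submodule.span K (L₂ : Set E) = LinearMap.range π₂ := by
    rw [hL₂, span_map_eq, L.span_eq_top, Submodule.map_top]
  have hL₁P : IsPrim L.carrier L₁ := isPrim_inf_restrictScalars _ _
  have hL₁fg := fg_of_le L.fg hL₁P.1
  have hL₂fg : L₂.FG := L.fg.map _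
  obtain ⟨hLv, hLr⟩ := vol_eq_mul_of_orthogonal L.herm L.fg π₁ π₂ hπ ho fun x _ => by
    rw [← hL₁, hL₁s]; exact ⟨x, rfl⟩
  set MA : Submodule (𝓞 K) F := M.carrier ⊓ A.restrictScalars (𝓞 K) with hMA
  set MB : Submodule (𝓞 K) F := M.carrier ⊓ B.restrictScalars (𝓞 K) with hMB
  have hMAs : Submodule.span K (MA : Set F) = A :=
    span_inf_restrictScalars (by rw [M.span_eq_top]; exact le_top)
  have hMBs : Submodule.span K (MB : Set F) = B :=
    span_inf_restrictScalars (by rw [M.span_eq_top]; exact le_top)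
  have hMAP : IsPrim M.carrier MA := isPrim_inf_restrictScalars _ _
  have hMBP : IsPrim M.carrier MB := isPrim_inf_restrictScalars _ _
  have hMAfg := fg_of_le M.fg hMAP.1
  have hMBfg := fg_of_le M.fg hMBP.1
  -- The corresponding projections of `E ⊗ F`, which decompose `N`.
  let p₁ := LinearMap.rTensor F π₁
  let p₂ := LinearMap.rTensor F π₂
  have hp : ∀ z, p₁ z + p₂ z = z := by
    intro z
    rw [← LinearMap.add_apply, ← LinearMap.rTensor_add]
    have : π₁ + π₂ = LinearMap.id := LinearMap.ext hπ
    rw [this, LinearMap.rTensor_id, LinearMap.id_apply]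
  have hp₂₁ : ∀ z, p₂ (p₁ z) = 0 := by
    intro z
    rw [← LinearMap.comp_apply, ← LinearMap.rTensor_comp]
    have : π₂ ∘ₗ π₁ = 0 := LinearMap.ext h₂₁
    rw [this, LinearMap.rTensor_zero, LinearMap.zero_apply]
  have hU₁ : ∀ z ∈ tensorSubspace (LinearMap.range π₁) A, p₁ z = z ∧ p₂ z = 0 := by
    intro z hz
    have h1 : tensorSubspace (LinearMap.range π₁) A ≤ LinearMap.eqLocus p₁ LinearMap.id := by
      rw [Submodule.map₂_le]
      intro x hx y hy
      simp [p₁, hidem₁ x hx]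
    have h2 : p₁ z = z := h1 hz
    refine ⟨h2, ?_⟩
    rw [← h2, hp₂₁]
  have hU₂ : ∀ z ∈ tensorSubspace (LinearMap.range π₂) B, p₂ z = z ∧ p₁ z = 0 := by
    intro z hz
    have h1 : tensorSubspace (LinearMap.range π₂) B ≤ LinearMap.eqLocus p₂ LinearMap.id := by
      rw [Submodule.map₂_le]
      intro x hx y hy
      simp [p₂, hidem₂ x hx]
    have h2 : p₂ z = z := h1 hz
    refine ⟨h2, ?_⟩
    have h3 := hp z
    rwa [h2, add_eq_right] at h3
  have hpU : ∀ z ∈ Submodule.span K (N : Set (E ⊗[K] F)),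
      p₁ z ∈ tensorSubspace (LinearMap.range π₁) A ∧
      p₂ z ∈ tensorSubspace (LinearMap.range π₂) B := by
    intro z hz
    rw [hs] at hz
    obtain ⟨x, hx, y, hy, rfl⟩ := Submodule.mem_sup.1 hz
    rw [map_add, map_add, (hU₁ x hx).1, (hU₁ x hx).2, (hU₂ y hy).1, (hU₂ y hy).2, add_zero,
      zero_add]
    exact ⟨hx, hy⟩
  set N₁ : Submodule (𝓞 K) (E ⊗[K] F) := N ⊓ (LinearMap.ker p₂).restrictScalars (𝓞 K) with hN₁
  set N₂ : Submodule (𝓞 K) (E ⊗[K] F) := N.map (p₂.restrictScalars (𝓞 K)) with hN₂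
  have hN₁s : Submodule.span K (N₁ : Set (E ⊗[K] F)) = tensorSubspace (LinearMap.range π₁) A := by
    have h1 : Submodule.span K (((LinearMap.ker p₂).restrictScalars (𝓞 K) :
        Submodule (𝓞 K) (E ⊗[K] F)) : Set (E ⊗[K] F)) = LinearMap.ker p₂ := Submodule.span_eq _
    rw [hN₁, span_inf_eq, h1]
    apply le_antisymm
    · rintro z ⟨hz, hz2⟩
      have h2 := hp z
      rw [LinearMap.mem_ker.1 hz2, add_zero] at h2
      rw [← h2]
      exact (hpU z hz).1
    · intro z hz
      exact ⟨hs ▸ Submodule.mem_sup_left hz, (hU₁ z hz).2⟩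
  have hN₂s : Submodule.span K (N₂ : Set (E ⊗[K] F)) = tensorSubspace (LinearMap.range π₂) B := by
    rw [hN₂, span_map_eq]
    apply le_antisymm
    · rintro _ ⟨z, hz, rfl⟩
      exact (hpU z hz).2
    · intro z hz
      exact ⟨z, hs ▸ Submodule.mem_sup_right hz, (hU₂ z hz).1⟩
  have hop : ∀ v z w, ((L.tensor M).herm v).inner (1 ⊗ₜ[K] p₁ z) (1 ⊗ₜ[K] p₂ w) = 0 := by
    intro v z w
    let c := (L.tensor M).herm v
    let _ : NormedAddCommGroup (CAt v ⊗[K] (E ⊗[K] F)) := c.toNormedAddCommGroup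
    let _ : InnerProductSpace (CAt v) (CAt v ⊗[K] (E ⊗[K] F)) := InnerProductSpace.ofCore c.toCore
    change inner (CAt v) ((1 : CAt v) ⊗ₜ[K] p₁ z) ((1 : CAt v) ⊗ₜ[K] p₂ w) = 0
    induction z using TensorProduct.induction_on with
    | zero => simp
    | add z z' hz hz' => rw [map_add, TensorProduct.tmul_add, inner_add_left, hz, hz', add_zero]
    | tmul x y =>
      induction w using TensorProduct.induction_on with
      | zero => simp
      | add w w' hw hw' => rw [map_add, TensorProduct.tmul_add, inner_add_right, hw, hw', add_zero]
      | tmul x' y' =>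
        change (tensorCore v (L.herm v) (M.herm v)).inner (1 ⊗ₜ (π₁ x ⊗ₜ y))
          (1 ⊗ₜ (π₂ x' ⊗ₜ y')) = 0
        rw [tensorCore_inner, ho, zero_mul]
  obtain ⟨hNv, hNr⟩ := vol_eq_mul_of_orthogonal (L.tensor M).herm hNfg p₁ p₂ hp hop fun x hx => by
    rw [← hN₁, hN₁s]; exact (hpU x (Submodule.subset_span hx)).1
  have hT₁fg := tensorSub_fg hL₁fg hMAfg
  have hT₂fg := tensorSub_fg hL₂fg hMBfg
  have hT₁s : Submodule.span K (N₁ : Set (E ⊗[K] F)) =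
      Submodule.span K (tensorSub L₁ MA : Set (E ⊗[K] F)) := by
    rw [hN₁s, span_tensorSub, hL₁s, hMAs]
  have hT₂s : Submodule.span K (N₂ : Set (E ⊗[K] F)) =
      Submodule.span K (tensorSub L₂ MB : Set (E ⊗[K] F)) := by
    rw [hN₂s, span_tensorSub, hL₂s, hMBs]
  have hle₁ : N₁ ≤ tensorSub L₁ MA := fun z hz =>
    mem_tensorSub_of_isPrim L.fg M.fg hL₁P hMAP (hN.1 hz.1) (by
      rw [← span_tensorSub, ← hT₁s]; exact Submodule.subset_span hz)
  have hle₂ : N₂ ≤ tensorSub L₂ MB := by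
    intro z hz
    refine mem_tensorSub_of_isPrim hL₂fg M.fg (isPrim_self L₂) hMBP ?_ (by
      rw [← span_tensorSub, ← hT₂s]; exact Submodule.subset_span hz)
    obtain ⟨w, hw, rfl⟩ := hz
    have h1 : tensorSub L.carrier M.carrier ≤
        (tensorSub L₂ M.carrier).comap (p₂.restrictScalars (𝓞 K)) :=
      tensorSub_le.2 fun x hx y hy => tmul_mem_tensorSub ⟨x, hx, rfl⟩ hy
    exact h1 (hN.1 hw)
  have hv₁ := vol_anti (L.tensor M).herm hT₁fg hle₁ hT₁s
  have hv₂ := vol_anti (L.tensor M).herm hT₂fg hle₂ hT₂s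
  have hr₁ : latticeRank N₁ = latticeRank L₁ * latticeRank MA := by
    rw [← latticeRank_tensorSub hL₁fg hMAfg, latticeRank, hT₁s]
  have hr₂ : latticeRank N₂ = latticeRank L₂ * latticeRank MB := by
    rw [← latticeRank_tensorSub hL₂fg hMBfg, latticeRank, hT₂s]
  have e₁ : vol (L.tensor M).herm (tensorSub L₁ MA) =
      vol L.herm L₁ ^ latticeRank MA * vol M.herm MA ^ latticeRank L₁ :=
    vol_tensorSub L.herm M.herm hL₁fg hMAfg
  have e₂ : vol (L.tensor M).herm (tensorSub L₂ MB) =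
      vol L.herm L₂ ^ latticeRank MB * vol M.herm MB ^ latticeRank L₂ :=
    vol_tensorSub L.herm M.herm hL₂fg hMBfg
  rw [e₁] at hv₁
  rw [e₂] at hv₂
  have hAB' : latticeRank MB ≤ latticeRank MA := by
    rw [latticeRank, latticeRank, hMAs, hMBs]; exact hAB
  -- The module `L₂` need not be a sublattice of `L`, so its volume is used only in the product
  -- `vol L₁ * vol L₂ = vol L`; the remaining factor `vol L₁ ^ k` has the exponent
  -- `k = dim A - dim B ≥ 0`.
  obtain ⟨k, hk⟩ := Nat.exists_eq_add_of_le hAB'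
  have i₁ := L.minSlope_pow_le hL₁P
  have i₂ := L.minSlope_pow_le (isPrim_self L.carrier)
  have i₃ := M.minSlope_pow_le hMAP
  have i₄ := M.minSlope_pow_le hMBP
  rw [hLv, hLr] at i₂
  rw [hNv, hNr, hr₁, hr₂]
  have hμ := L.minSlope_pos
  have hν := M.minSlope_pos
  have hL₁0 := vol_pos L.herm hL₁fg
  have hL₂0 := vol_pos L.herm hL₂fg
  have hMA0 := vol_pos M.herm hMAfg
  have hMB0 := vol_pos M.herm hMBfg
  rw [← hL₁, ← hL₂] at i₂
  rw [hk] at hv₁ i₃ ⊢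
  generalize latticeRank MB = β at *
  generalize latticeRank L₁ = a at *
  generalize latticeRank L₂ = b at *
  calc (L.minSlope * M.minSlope) ^ (a * (β + k) + b * β)
      = (L.minSlope ^ a) ^ k * (L.minSlope ^ (a + b)) ^ β *
          ((M.minSlope ^ (β + k)) ^ a * (M.minSlope ^ β) ^ b) := by
        simp only [mul_pow, ← pow_mul]; ring
    _ ≤ vol L.herm L₁ ^ k * (vol L.herm L₁ * vol L.herm L₂) ^ β *
          (vol M.herm MA ^ a * vol M.herm MB ^ b) := by gcongr
    _ = (vol L.herm L₁ ^ (β + k) * vol M.herm MA ^ a) *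
          (vol L.herm L₂ ^ β * vol M.herm MB ^ b) := by ring
    _ ≤ vol (L.tensor M).herm N₁ * vol (L.tensor M).herm N₂ :=
        mul_le_mul hv₁ hv₂ (by positivity) (vol_pos _ (fg_of_le hNfg inf_le_left)).le

/-- The bound of `pow_le_vol_tensor_of_finrank_le`, whichever of `A` and `B` is larger. -/
theorem pow_le_vol_tensor (L : OKLattice K E) (M : OKLattice K F)
    (π₁ π₂ : E →ₗ[K] E) (hπ : ∀ x, π₁ x + π₂ x = x) (h₁₂ : ∀ x, π₁ (π₂ x) = 0)
    (h₂₁ : ∀ x, π₂ (π₁ x) = 0)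
    (ho : ∀ v x y, (L.herm v).inner (1 ⊗ₜ[K] π₁ x) (1 ⊗ₜ[K] π₂ y) = 0) (A B : Submodule K F)
    {N : Submodule (𝓞 K) (E ⊗[K] F)} (hN : IsPrim (L.tensor M).carrier N)
    (hs : Submodule.span K (N : Set (E ⊗[K] F)) =
      tensorSubspace (LinearMap.range π₁) A ⊔ tensorSubspace (LinearMap.range π₂) B) :
    (L.minSlope * M.minSlope) ^ latticeRank N ≤ vol (L.tensor M).herm N := by
  rcases le_total (Module.finrank K B) (Module.finrank K A) with h | h
  · exact L.pow_le_vol_tensor_of_finrank_le M π₁ π₂ hπ h₁₂ h₂₁ ho A B h hN hs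
  · refine L.pow_le_vol_tensor_of_finrank_le M π₂ π₁ (fun x => by rw [add_comm, hπ]) h₂₁ h₁₂
      (fun v x y => ?_) B A h hN (by rw [hs, sup_comm])
    rw [← (L.herm v).conj_inner_symm, ho, map_zero]

/-- The automorphisms of `L` act on `L ⊗ M` through the first factor. -/
theorem congr_mem_aut_tensor (L : OKLattice K E) (M : OKLattice K F) {g : E ≃ₗ[K] E}
    (hg : g ∈ L.aut) : TensorProduct.congr g (LinearEquiv.refl K F) ∈ (L.tensor M).aut := by
  have key : ∀ g ∈ L.aut, ∀ z ∈ tensorSub L.carrier M.carrier,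
      TensorProduct.congr g (LinearEquiv.refl K F) z ∈ tensorSub L.carrier M.carrier := by
    intro g hg z hz
    have h1 : tensorSub L.carrier M.carrier ≤ (tensorSub L.carrier M.carrier).comap
        ((TensorProduct.congr g (LinearEquiv.refl K F)).toLinearMap.restrictScalars (𝓞 K)) :=
      tensorSub_le.2 fun x hx y hy => tmul_mem_tensorSub ((hg.1 x).2 hx) hy
    exact h1 hz
  refine ⟨fun z => ⟨fun hz => ?_, key g hg z⟩, fun v => core_inner_congr _ _ fun z w => ?_⟩
  · have h1 := key g⁻¹ (L.aut.inv_mem hg) _ hz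
    have h2 : ∀ z, TensorProduct.congr g⁻¹ (LinearEquiv.refl K F)
        (TensorProduct.congr g (LinearEquiv.refl K F) z) = z := by
      intro z
      induction z using TensorProduct.induction_on with
      | zero => simp
      | add z z' hz hz' => simp only [map_add, hz, hz']
      | tmul x y =>
        rw [TensorProduct.congr_tmul, TensorProduct.congr_tmul]
        congr 1
        exact g.symm_apply_apply x
    rwa [h2] at h1
  · let c := (L.tensor M).herm v
    let _ : NormedAddCommGroup (CAt v ⊗[K] (E ⊗[K] F)) := c.toNormedAddCommGroup
    let _ : InnerProductSpace (CAt v) (CAt v ⊗[K] (E ⊗[K] F)) := InnerProductSpace.ofCore c.toCore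
    rw [LinearMap.baseChange_tmul, LinearMap.baseChange_tmul]
    change inner (CAt v) _ _ = inner (CAt v) _ _
    induction z using TensorProduct.induction_on with
    | zero => simp
    | add z z' hz hz' => rw [map_add, TensorProduct.tmul_add, TensorProduct.tmul_add,
        inner_add_left, inner_add_left, hz, hz']
    | tmul x y =>
      induction w using TensorProduct.induction_on with
      | zero => simp
      | add w w' hw hw' => rw [map_add, TensorProduct.tmul_add, TensorProduct.tmul_add,
          inner_add_right, inner_add_right, hw, hw']
      | tmul x' y' =>
        change (tensorCore v (L.herm v) (M.herm v)).inner (1 ⊗ₜ (g x ⊗ₜ y)) (1 ⊗ₜ (g x' ⊗ₜ y')) =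
          (tensorCore v (L.herm v) (M.herm v)).inner (1 ⊗ₜ (x ⊗ₜ y)) (1 ⊗ₜ (x' ⊗ₜ y'))
        rw [tensorCore_inner, tensorCore_inner]
        congr 1
        simpa using hg.2 v (1 ⊗ₜ[K] x) (1 ⊗ₜ[K] x')

/-- The theorem under the assumption that the first lattice has at most two components; no group
acting on the second lattice is needed. -/
theorem minSlope_tensor (L : OKLattice K E) (M : OKLattice K F) (G : Subgroup (E ≃ₗ[K] E))
    (hG : G ≤ L.aut) {r : ℕ} (hr : IsMultiplicityFree (tautRep G) r) (hr2 : r ≤ 2) :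
    (L.tensor M).minSlope = L.minSlope * M.minSlope := by
  have := L.finiteDimensional
  refine le_antisymm (L.minSlope_tensor_le M) ?_
  obtain ⟨D⟩ := hr.exists_schurDecomposition
  obtain ⟨N, hN, hN0, hNv, hNG⟩ := (L.tensor M).exists_invariant_minSlope
  have hNfg := fg_of_le (L.tensor M).fg hN.1
  obtain ⟨A, hA⟩ := D.exists_eq_iSup_tensorSubspace
    (U := Submodule.span K (N : Set (E ⊗[K] F))) (by
      rintro _ ⟨g, rfl⟩ u hu
      have h1 := hNG _ (L.congr_mem_aut_tensor M (hG g.2))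
      have h2 : Submodule.span K (N : Set (E ⊗[K] F)) ≤
          (Submodule.span K (N : Set (E ⊗[K] F))).comap (LinearMap.rTensor F (tautRep G g)) :=
        Submodule.span_le.2 fun z hz => Submodule.subset_span (h1 z hz)
      exact h2 hu)
  have ho : ∀ i j, i ≠ j → ∀ v x y,
      (L.herm v).inner (1 ⊗ₜ[K] D.proj i x) (1 ⊗ₜ[K] D.proj j y) = 0 := fun i j hij v x y =>
    D.inner_proj_eq_zero (L.herm v) (by rintro _ ⟨g, rfl⟩ x y; exact (hG g.2).2 v x y) hij x y
  have key : (L.minSlope * M.minSlope) ^ latticeRank N ≤ vol (L.tensor M).herm N := by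
    interval_cases r
    · obtain ⟨x, hx⟩ := exists_ne (0 : E)
      exact absurd (by simpa using (D.sum_proj x).symm) hx
    · refine L.pow_le_vol_tensor M (D.proj 0) 0 (fun x => ?_) (fun x => by simp) (fun x => by simp)
        (fun v x y => ?_) (A 0) ⊥ hN ?_
      · have := D.sum_proj x
        simpa using this
      · let c := L.herm v
        let _ : NormedAddCommGroup (CAt v ⊗[K] E) := c.toNormedAddCommGroup
        let _ : InnerProductSpace (CAt v) (CAt v ⊗[K] E) := InnerProductSpace.ofCore c.toCore
        rw [LinearMap.zero_apply, TensorProduct.tmul_zero]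
        exact inner_zero_right (𝕜 := CAt v) _
      · have h0 : tensorSubspace (LinearMap.range (0 : E →ₗ[K] E)) (⊥ : Submodule K F) = ⊥ :=
          Submodule.map₂_bot_right _ _
        rw [hA, h0, sup_bot_eq]
        refine le_antisymm (iSup_le fun i => ?_)
          (le_iSup (fun i => tensorSubspace (LinearMap.range (D.proj i)) (A i)) 0)
        rw [Subsingleton.elim i 0]
    · refine L.pow_le_vol_tensor M (D.proj 0) (D.proj 1) (fun x => ?_)
        (D.proj_proj_of_ne 0 1 (by decide)) (D.proj_proj_of_ne 1 0 (by decide))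
        (ho 0 1 (by decide)) (A 0) (A 1) hN ?_
      · have := D.sum_proj x
        rwa [Fin.sum_univ_two] at this
      · rw [hA]
        apply le_antisymm
        · refine iSup_le fun i => ?_
          fin_cases i
          · exact le_sup_left
          · exact le_sup_right
        · exact sup_le (le_iSup (fun i => tensorSubspace (LinearMap.range (D.proj i)) (A i)) 0)
            (le_iSup (fun i => tensorSubspace (LinearMap.range (D.proj i)) (A i)) 1)
  rw [hNv] at key
  exact (pow_le_pow_iff_left₀ (mul_pos L.minSlope_pos M.minSlope_pos).le
    (L.tensor M).minSlope_pos.le (latticeRank_pos hNfg hN0).ne').1 key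

/-- One half of the symmetry of the minimal slope of a tensor product in the factors. -/
theorem minSlope_tensor_comm_le (L : OKLattice K E) (M : OKLattice K F) :
    (M.tensor L).minSlope ≤ (L.tensor M).minSlope := by
  obtain ⟨N, hN, hN0, hNμ⟩ := (L.tensor M).isLeast_minSlope.1
  rw [isSublattice_iff_isPrim] at hN
  have hfg := fg_of_le (L.tensor M).fg hN.1
  let φ := TensorProduct.comm K E F
  have hsub : ∀ z, z ∈ tensorSub L.carrier M.carrier ↔ φ z ∈ tensorSub M.carrier L.carrier := by
    intro z
    have h1 : tensorSub L.carrier M.carrier ≤ (tensorSub M.carrier L.carrier).comap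
        (φ.toLinearMap.restrictScalars (𝓞 K)) :=
      tensorSub_le.2 fun x hx y hy => tmul_mem_tensorSub hy hx
    have h2 : tensorSub M.carrier L.carrier ≤ (tensorSub L.carrier M.carrier).comap
        (φ.symm.toLinearMap.restrictScalars (𝓞 K)) :=
      tensorSub_le.2 fun x hx y hy => tmul_mem_tensorSub hy hx
    refine ⟨fun hz => h1 hz, fun hz => ?_⟩
    have h3 : φ.symm (φ z) ∈ tensorSub L.carrier M.carrier := h2 hz
    rwa [LinearEquiv.symm_apply_apply] at h3
  have hiso : ∀ v z w, ((M.tensor L).herm v).inner (1 ⊗ₜ[K] φ z) (1 ⊗ₜ[K] φ w) =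
      ((L.tensor M).herm v).inner (1 ⊗ₜ[K] z) (1 ⊗ₜ[K] w) := by
    intro v z w
    let c := (L.tensor M).herm v
    let c' := (M.tensor L).herm v
    let _ : NormedAddCommGroup (CAt v ⊗[K] (E ⊗[K] F)) := c.toNormedAddCommGroup
    let _ : InnerProductSpace (CAt v) (CAt v ⊗[K] (E ⊗[K] F)) := InnerProductSpace.ofCore c.toCore
    let _ : NormedAddCommGroup (CAt v ⊗[K] (F ⊗[K] E)) := c'.toNormedAddCommGroup
    let _ : InnerProductSpace (CAt v) (CAt v ⊗[K] (F ⊗[K] E)) := InnerProductSpace.ofCore c'.toCore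
    change inner (CAt v) _ _ = inner (CAt v) _ _
    induction z using TensorProduct.induction_on with
    | zero => simp
    | add z z' hz hz' => rw [map_add, TensorProduct.tmul_add, TensorProduct.tmul_add,
        inner_add_left, inner_add_left, hz, hz']
    | tmul x y =>
      induction w using TensorProduct.induction_on with
      | zero => simp
      | add w w' hw hw' => rw [map_add, TensorProduct.tmul_add, TensorProduct.tmul_add,
          inner_add_right, inner_add_right, hw, hw']
      | tmul x' y' => exact mul_comm _ _
  have hP : IsPrim (M.tensor L).carrier
      (N.map ((φ : E ⊗[K] F →ₗ[K] F ⊗[K] E).restrictScalars (𝓞 K))) := by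
    refine ⟨?_, fun y hy hys => ?_⟩
    · rintro _ ⟨z, hz, rfl⟩
      exact (hsub z).1 (hN.1 hz)
    · rw [span_map_eq] at hys
      obtain ⟨z, hz, rfl⟩ := hys
      exact ⟨z, hN.2 z ((hsub z).2 hy) hz, rfl⟩
  have h0 : N.map ((φ : E ⊗[K] F →ₗ[K] F ⊗[K] E).restrictScalars (𝓞 K)) ≠ ⊥ := by
    obtain ⟨x, hx, hx0⟩ := (Submodule.ne_bot_iff N).1 hN0
    exact (Submodule.ne_bot_iff _).2 ⟨φ x, ⟨x, hx, rfl⟩, fun h => hx0 (φ.map_eq_zero_iff.1 h)⟩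
  refine ((M.tensor L).isLeast_minSlope.2 ⟨_, isSublattice_iff_isPrim.2 hP, h0, rfl⟩).trans ?_
  rw [hNμ, latticeSlope, latticeSlope, vol_map φ hiso hfg]
  have hrk := latticeRank_map φ N
  rw [latticeRank, latticeRank] at hrk
  rw [hrk]

end OKLattice

end TensorLattice

end

theorem theorem3p1 {K E F : Type*} [Field K] [NumberField K]
    (hK : IsTotallyReal K ∨ IsCMField K)
    [AddCommGroup E] [Module K E] [Module (𝓞 K) E] [IsScalarTower (𝓞 K) K E] [Nontrivial E]
    [AddCommGroup F] [Module K F] [Module (𝓞 K) F] [IsScalarTower (𝓞 K) K F] [Nontrivial F]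
    (L : OKLattice K E) (M : OKLattice K F)
    (G : Subgroup (E ≃ₗ[K] E)) (hG : G ≤ L.aut)
    (H : Subgroup (F ≃ₗ[K] F)) (hH : H ≤ M.aut)
    (r s : ℕ) (hr : IsMultiplicityFree (tautRep G) r) (hs : IsMultiplicityFree (tautRep H) s)
    (hrs : min r s ≤ 2) :
    IsLeast L.slopes L.minSlope ∧ IsLeast M.slopes M.minSlope ∧
      IsLeast (L.tensor M).slopes (L.tensor M).minSlope ∧
      (L.tensor M).minSlope = L.minSlope * M.minSlope := by
  refine ⟨L.isLeast_minSlope, M.isLeast_minSlope, (L.tensor M).isLeast_minSlope, ?_⟩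
  rcases min_le_iff.1 hrs with h | h
  · exact L.minSlope_tensor M G hG hr h
  · rw [le_antisymm (M.minSlope_tensor_comm_le L) (L.minSlope_tensor_comm_le M),
      M.minSlope_tensor L H hH hs h, mul_comm]
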